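/- **Problem.** An instance $\mathcal G$ of chromatic $k$-means consists of $n$ point-sets $G_1,\dots,G_n$ in $\mathbb R^d$, where $G_i$ has $k_i\le k$ points. A *chromatic partition* is a partition of all $N=\sum_i k_i$ points into $k$ (possibly empty) cells $U_1,\dots,U_k$, each containing at most one point from each $G_i$. A *solution* consists of $k$ points $m_1,\dots,m_k\in\mathbb R^d$ and a chromatic partition; its value is $\frac1n\sum_{j=1}^k\sum_{q\in U_j}\|q-m_j\|^2$. A $(1+\epsilon)$-approximation is a solution of value at most $(1+\epsilon)$ times the minimum value. Given $m_1,\dots,m_k$, the *bipartite matching procedure* computes, for each $G_i$, a minimum weight matching of its points into $\{m_1,\dots,m_k\}$ (weights: squared distances), which yields a best chromatic partition for these centers. **Algorithm $k$-CMeans** (input $\mathcal G$, $k\ge2$, accuracy parameter $\epsilon$). Logarithms $\log$ below are to base 2, and non-integral counts are rounded up. 1. Run the sampling-based $k$-means approximation scheme of Kumar, Sabharwal and Sen (spelled out below) with accuracy $\epsilon$ on all $N$ points. Among all $k$-tuples of the centers obtained, find one for which the bipartite matching procedure gives the smallest total squared distance, and let $\Delta$ be this total divided by $N$. 2. For $i=1,\dots,2k/\epsilon$: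 set $\delta=\frac{\sqrt\Delta}{2k}+i\frac{\epsilon}{2k}\sqrt\Delta$ and run Sphere-Peeling-Tree with $\delta$, obtaining a tree $\mathcal T_i$. 3. For each root-to-leaf path of each $\mathcal T_i$, apply the bipartite matching procedure to the $k$ points on the path. Output the best solution found. *Sphere-Peeling-Tree* grows a rooted tree of height $k$ with a point at each non-root node. To a node of height $j<k$ with points $p_1,\dots,p_j$ on the path from the root, it adds children as follows. For each radius candidate $r=\frac{1+l\epsilon/2}{2(1+\epsilon)}(j+1)2^{t/2}\sqrt\epsilon\,\delta$, where $0\le t\le\log(kn)$ and $0\le l\le 4+\frac2\epsilon$ are integers: remove all input points within distance $r$ of some $p_l$; draw $m=\frac{8k^3}{\epsilon^9}\ln\frac{k^2}{\epsilon^6}$ independent uniformly random points from the remaining ones (none if none remain); for the mean $\pi$ of every nonempty subset of the sample, add one child for each grid point of the simplex with vertices $p_1,\dots,p_j,\pi$; also add one child for each grid point of the simplex with vertices $p_1,\dots,p_j$. The grid of a simplex with $v$ vertices consists of the convex combinations of the vertices whose coefficients are multiples of $1/M$, with $M=\lfloor 8v^2/\epsilon^2\rfloor+1$. *The $k$-means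 scheme*, with $\alpha=\epsilon/(64k)$: for each $\kappa=1,\dots,k$ search recursively for $\kappa$ centers, keeping the list $C$ of centers found and the list $Q$ of unassigned points. If centers are still missing and $Q\neq\emptyset$, try all of the following: for the mean of every nonempty subset of a sample of $64k^2/\alpha^2$ independent uniformly random points of $Q$, add this mean to $C$ and recurse; and, if $C\ne\emptyset$, assign the half of $Q$ nearest to $C$ to nearest centers, remove it from $Q$, and recurse. Otherwise assign the points of $Q$ to their nearest centers. Return the centers $C$ of smallest total assignment cost found. **Theorem.** There are absolute constants $c\in(0,1]$, $p>0$, $C>0$ and a polynomial $\mathrm{poly}$ such that for all $n\ge2$, $k\ge2$, $d\ge1$, $0<\epsilon\le1$ and every instance $\mathcal G$ of chromatic $k$-means with $n$ point-sets in $\mathbb R^d$ and at least one point, Algorithm $k$-CMeans, run with accuracy parameter $c\,\epsilon/k^3$, returns with probability at least $p$ a $(1+\epsilon)$-approximation for chromatic $k$-means on $\mathcal G$, and always makes at most $C\cdot 2^{\mathrm{poly}(k/\epsilon)}\,n\,(\ln n)^{k+1}\,d$ steps. Here a step is an arithmetic operation, square root or comparison on real numbers, the drawing of a uniformly random entry of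 an array, or a pass of a loop; operations on points of $\mathbb R^d$ count coordinatewise. -/

import Mathlib

namespace ChromaticClustering

noncomputable section

/-! ## The chromatic k-means problem -/

/-- Points of `d`-dimensional Euclidean space. -/
abbrev Pt (d : ℕ) : Type := EuclideanSpace ℝ (Fin d)

/-- `n` point-sets `G_1, …, G_n` in `ℝ^d`, the `i`-th one consisting of `size i ≤ k` points.
Points are indexed, so coinciding points are allowed and counted separately. -/
structure ChromaticInstance (n k d : ℕ) where
  size : Fin n → ℕ
  size_le : ∀ i, size i ≤ k
  pt : (i : Fin n) → Fin (size i) → Pt d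

variable {n k d : ℕ}

/-- A chromatic partition: every point is put into one of the `k` cells, and two different
points of the same point-set are never put into the same cell. Cells may be empty. -/
def ChromaticPartition (G : ChromaticInstance n k d) : Type :=
  (i : Fin n) → Fin (G.size i) ↪ Fin k

/-- The cell `U_j` of a chromatic partition, as a set of (indices of) points. -/
def ChromaticPartition.cell {G : ChromaticInstance n k d} (U : ChromaticPartition G)
    (j : Fin k) : Finset ((i : Fin n) × Fin (G.size i)) :=
  Finset.univ.filter fun x => U x.1 x.2 = j

/-- A feasible solution: `k` points of `ℝ^d` and a chromatic partition. -/
structure Solution (G : ChromaticInstance n k d) where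
  center : Fin k → Pt d
  part : ChromaticPartition G

/-- The objective value `(1/n) ∑_j ∑_{q ∈ U_j} ‖q - m_j‖²`. -/
def Solution.objective {G : ChromaticInstance n k d} (s : Solution G) : ℝ :=
  (1 / (n : ℝ)) * ∑ j : Fin k, ∑ x ∈ s.part.cell j, ‖G.pt x.1 x.2 - s.center j‖ ^ 2

/-- `s` is a `(1+ε)`-approximation: its objective value is at most `1+ε` times the objective
value of any feasible solution (equivalently, of an optimal one). -/
def Solution.IsApprox {G : ChromaticInstance n k d} (ε : ℝ) (s : Solution G) : Prop :=
  ∀ s' : Solution G, s.objective ≤ (1 + ε) * s'.objective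

/-- The list of all points of the instance. -/
def ChromaticInstance.points (G : ChromaticInstance n k d) : List (Pt d) :=
  (List.ofFn fun i => List.ofFn (G.pt i)).flatten

/-! ## Randomized computations with a step count

A computation is the joint law of its result and of the number of steps it makes, on a real RAM:
an arithmetic operation (including square roots), a comparison, and drawing a uniformly random
cell of an array each cost one step, operations on points cost their number of coordinate
operations, and every pass of a loop costs an extra step. -/

/-- A randomized computation with result in `α`: joint law of the result and the step count. -/
def RT (α : Type) : Type := PMF (α × ℕ)

namespace RT

variable {α β : Type}

/-- Return `a`, spending `c` steps. -/
def charge (c : ℕ) (a : α) : RT α := PMF.pure (a, c)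

/-- Sequential composition, with fresh independent randomness; step counts add up. -/
def bind (x : RT α) (f : α → RT β) : RT β :=
  PMF.bind x fun a => PMF.map (fun b => (b.1, a.2 + b.2)) (f a.1)

instance : Monad RT where
  pure a := charge 0 a
  bind := bind

/-- The probability that the result of `x` satisfies `S`. -/
def prob (x : RT α) (S : α → Prop) : ENNReal :=
  PMF.toOuterMeasure x {a | S a.1}

/-- Every run of `x` makes at most `T` steps. -/
def TimeLE (x : RT α) (T : ℝ) : Prop :=
  ∀ a ∈ PMF.support x, (a.2 : ℝ) ≤ T

/-- A uniformly random entry of the nonempty array `a :: l`. -/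
def draw (a : α) (l : List α) : RT α :=
  PMF.map (fun i => ((a :: l).get i, 1)) (PMF.uniformOfFintype (Fin (l.length + 1)))

/-- Run `f` on all entries of a list and collect the results. -/
def mapList (f : α → RT β) : List α → RT (List β)
  | [] => charge 1 []
  | a :: l => do
    let b ← f a
    let bs ← mapList f l
    charge 1 (b :: bs)

/-- Run `f` on all entries of a list and concatenate the results. -/
def flatMapList (f : α → RT (List β)) (l : List α) : RT (List β) := do
  let ls ← mapList f l
  charge ls.flatten.length ls.flatten

/-- Keep the entries that pass the test `f`. -/
def filterList (f : α → RT Bool) : List α → RT (List α)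
  | [] => charge 1 []
  | a :: l => do
    let b ← f a
    let r ← filterList f l
    charge 1 (if b then a :: r else r)

/-- Run `f i` for `i = 0, 1, …` and tabulate the results. -/
def tabulate : {n : ℕ} → {γ : Fin n → Type} → ((i : Fin n) → RT (γ i)) → RT ((i : Fin n) → γ i)
  | 0, _, _ => charge 1 (fun i => i.elim0)
  | _ + 1, _, f => do
    let a ← f 0
    let r ← tabulate fun i => f i.succ
    charge 1 (Fin.cons a r)

/-- The sum of a list of reals. -/
def sumList (l : List ℝ) : RT ℝ := charge (l.length + 1) l.sum

/-- Of two candidates with values, keep the one of smaller value. -/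
def better : Option (β × ℝ) → Option (β × ℝ) → RT (Option (β × ℝ))
  | none, y => charge 1 y
  | some x, none => charge 1 (some x)
  | some x, some y => charge 1 (if x.2 ≤ y.2 then some x else some y)

/-- Run `f` on all entries of a list and keep the result of smallest value. -/
def argmin (f : α → RT (Option (β × ℝ))) : List α → RT (Option (β × ℝ))
  | [] => charge 1 none
  | a :: l => do
    let x ← f a
    let y ← argmin f l
    better x y

/-- Squared Euclidean distance: `d` subtractions, `d` multiplications, `d` additions. -/
def sqDist (p q : Pt d) : RT ℝ := charge (3 * d) (‖p - q‖ ^ 2)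

/-- The mean of a list of points. -/
def mean (s : List (Pt d)) : RT (Pt d) :=
  charge ((s.length + 1) * d) ((s.length : ℝ)⁻¹ • s.sum)

end RT

open RT

/-! ## Random sampling -/

/-- Draw `z` independent uniformly random points from the list (none if the list is empty) and
return the means of all nonempty subsets of the sample. -/
def sampleMeans (z : ℕ) : List (Pt d) → RT (List (Pt d))
  | [] => charge 1 []
  | a :: l => do
    let s ← mapList (fun _ => draw a l) (List.range z)
    let subsets := s.sublists.filter fun t => !t.isEmpty
    let subsets ← charge (subsets.map fun t => t.length + 1).sum subsets
    mapList mean subsets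

/-! ## The bipartite matching procedure -/

/-- A minimum weight matching of the points of `G_i` into the `k` given centers, where the
weight of an edge is the squared distance, together with its weight. The minimum is taken over
all injections, a nonempty list because `size i ≤ k`, so the default value is never used. -/
def matchSet (G : ChromaticInstance n k d) (m : Fin k → Pt d) (i : Fin n) :
    RT ((Fin (G.size i) ↪ Fin k) × ℝ) := do
  let w ← tabulate fun a => tabulate fun j => sqDist (G.pt i a) (m j)
  let injections := (Finset.univ : Finset (Fin (G.size i) ↪ Fin k)).toList
  let injections ← charge (injections.length * (G.size i + 1)) injections
  let r ← argmin (fun e => do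
    let v ← sumList (List.ofFn fun a => w a (e a))
    return some (e, v)) injections
  return r.getD (Fin.castLEEmb (G.size_le i), 0)

/-- The chromatic partition that is best for the centers `m`, with its total squared distance. -/
def bipartiteMatching (G : ChromaticInstance n k d) (m : Fin k → Pt d) :
    RT (ChromaticPartition G × ℝ) := do
  let r ← tabulate (matchSet G m)
  let v ← sumList (List.ofFn fun i => (r i).2)
  return (fun i => (r i).1, v)

/-- Of a list of `k`-tuples of points, the one that the bipartite matching procedure extends to a
solution of smallest value, as that solution and its total squared distance. -/
def bestTuple (G : ChromaticInstance n k d) (ms : List (Fin k → Pt d)) :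
    RT (Option (Solution G × ℝ)) :=
  argmin (fun m => do
    let r ← bipartiteMatching G m
    return some (⟨m, r.1⟩, r.2)) ms

/-! ## The sampling-based approximation scheme for ordinary k-means
of Kumar, Sabharwal and Sen -/

/-- Squared distance of `q` to the nearest of the centers `c :: cs`. -/
def nearest (q c : Pt d) : List (Pt d) → RT ℝ
  | [] => sqDist q c
  | c' :: cs => do
    let x ← sqDist q c
    let y ← nearest q c' cs
    charge 1 (min x y)

/-- Assign the points of `Q` to their nearest centers in `C`, where `s` is the cost of the points
that were assigned before; the result is `C` and the total cost. -/
def assignAll (Q C : List (Pt d)) (s : ℝ) : RT (Option (List (Pt d) × ℝ)) :=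
  match C with
  | [] => charge 1 none
  | c :: cs => do
    let D ← mapList (fun q => nearest q c cs) Q
    let v ← sumList D
    charge 1 (some (C, s + v))

/-- One stage of the search for the next center, `C` being the centers found so far, `Q` the
points not yet assigned and `s` the cost of the assigned ones: guess the next center as the mean
of a subset of a random sample of `Q` (and go on with `next`); or (if `C` is nonempty) assign the
half of `Q` nearest to `C` and search on with the other half. The best result is returned.
Since `Q` gets shorter, `fuel = |Q|` is enough. -/
def halving (z : ℕ) (next : List (Pt d) → List (Pt d) → ℝ → RT (Option (List (Pt d) × ℝ))) :
    (fuel : ℕ) → (Q C : List (Pt d)) → (s : ℝ) → RT (Option (List (Pt d) × ℝ))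
  | 0, Q, C, s => assignAll Q C s
  | fuel + 1, Q, C, s =>
    match Q with
    | [] => assignAll [] C s
    | a :: l => do
      let guesses ← sampleMeans z (a :: l)
      let x ← argmin (fun c => do
        let C' ← charge (C.length + 1) (C ++ [c])
        next (a :: l) C' s) guesses
      match C with
      | [] => return x
      | c :: cs => do
        let D ← mapList (fun q => do
          let v ← nearest q c cs
          return (v, q)) (a :: l)
        -- merge sort by distance
        let D ← charge (2 * D.length * (Nat.clog 2 D.length + 1))
          (D.mergeSort fun u v => decide (u.1 ≤ v.1))
        let h := (D.length + 1) / 2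
        let v ← sumList ((D.take h).map Prod.fst)
        let rest ← charge D.length ((D.drop h).map Prod.snd)
        let y ← halving z next fuel rest (c :: cs) (s + v)
        better x y

/-- Search for `m` more centers. -/
def irredKMeans (z : ℕ) : (m : ℕ) → (Q C : List (Pt d)) → (s : ℝ) →
    RT (Option (List (Pt d) × ℝ))
  | 0, Q, C, s => assignAll Q C s
  | m + 1, Q, C, s => halving z (irredKMeans z m) Q.length Q C s

/-- The approximation scheme for `k`-means with accuracy `ε`: search for `1, …, k` centers, with
samples of size `O(k² / α²)`, where `α = ε / (64 k)`, and return the best set of centers found,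
with its cost. -/
def kMeansPTAS (k : ℕ) (ε : ℝ) (P : List (Pt d)) : RT (Option (List (Pt d) × ℝ)) :=
  let α : ℝ := ε / (64 * k)
  argmin (fun i => irredKMeans ⌈64 * (k : ℝ) ^ 2 / α ^ 2⌉₊ (i + 1) P [] 0) (List.range k)

/-- All `k`-tuples with entries in a list. -/
def tuples {α : Type} (C : List α) : (k : ℕ) → List (Fin k → α)
  | 0 => [fun i => i.elim0]
  | k + 1 => C.flatMap fun c => (tuples C k).map fun f => (Fin.cons c f : Fin (k + 1) → α)

/-- The initial upper bound `Δ` for the optimal value of chromatic `k`-means (mean squared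
distance over all points): the best value of a `k`-tuple of approximate `k`-means centers. -/
def initialBound (G : ChromaticInstance n k d) (ε : ℝ) : RT (Option ℝ) := do
  let C ← kMeansPTAS k ε G.points
  match C with
  | none => return none
  | some (C, _) => do
    let ts ← charge ((tuples C k).length * (k + 1)) (tuples C k)
    let r ← bestTuple G ts
    match r with
    | none => return none
    | some (_, v) => charge 1 (some (v / G.points.length))

/-! ## Sphere peeling -/

/-- The grid in the simplex determined by the points `V`: all convex combinations whose
coefficients are multiples of `1/N`, where `N ≥ 2 j² / ε` with `j` the number of vertices. -/
def simplexGrid (ε : ℝ) (V : List (Pt d)) : RT (List (Pt d)) :=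
  let N : ℕ := ⌊2 * (V.length : ℝ) ^ 2 / ε⌋₊ + 1
  mapList (fun a : Fin V.length → ℕ =>
      charge (V.length * (2 * d + 2)) (∑ i, ((a i : ℝ) / N) • V.get i))
    (List.Nat.antidiagonalTuple V.length N)

/-- The radius candidates for a node of height `j`. -/
def radii (n k : ℕ) (ε δ : ℝ) (j : ℕ) : List ℝ :=
  (List.range (Nat.clog 2 (k * n) + 1)).flatMap fun t =>
    (List.range (⌈4 + 2 / ε⌉₊ + 1)).map fun l =>
      (1 + l * (ε / 2)) / (2 * (1 + ε)) * (j + 1) * √(2 ^ t) * √ε * δ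

/-- The size of the random samples. -/
def sampleSize (k : ℕ) (ε : ℝ) : ℕ :=
  ⌈8 * (k : ℝ) ^ 3 / ε ^ 9 * Real.log ((k : ℝ) ^ 2 / ε ^ 6)⌉₊

/-- Is `p` outside all closed balls of radius `r` around the given centers? -/
def outside (r : ℝ) (p : Pt d) : List (Pt d) → RT Bool
  | [] => charge 1 true
  | c :: cs => do
    let s ← sqDist p c
    let inside ← charge 2 (decide (s ≤ r ^ 2))
    if inside then return false else outside r p cs

/-- The points associated with the children of a node, where `path` lists the points associated
with the nodes on the path from the root to this node. -/
def children (G : ChromaticInstance n k d) (ε δ : ℝ) (path : List (Pt d)) :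
    RT (List (Pt d)) := do
  let R ← charge (12 * (radii n k ε δ path.length).length) (radii n k ε δ path.length)
  flatMapList (fun r => do
    let rest ← filterList (fun p => outside r p path) G.points
    let means ← sampleMeans (sampleSize k ε) rest
    let grids ← flatMapList (fun q => do
      let V ← charge (path.length + 1) (path ++ [q])
      simplexGrid (ε ^ 2 / 4) V) means
    let grid ← simplexGrid (ε ^ 2 / 4) path
    charge (grids.length + grid.length) (grids ++ grid)) R

/-- Rooted trees all of whose leaves have height `h`, with a point at every node but the root:
the list of the children of the root, each with its point and the tree below it. -/
def PeelingTree (d : ℕ) : ℕ → Type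
  | 0 => Unit
  | h + 1 => List (Pt d × PeelingTree d h)

/-- Grow the tree below the node with the given path by `h` more levels. -/
def grow (G : ChromaticInstance n k d) (ε δ : ℝ) : (h : ℕ) → List (Pt d) → RT (PeelingTree d h)
  | 0, _ => charge 1 ()
  | h + 1, path => do
    let cs ← children G ε δ path
    mapList (fun p => do
      let path' ← charge (path.length + 1) (path ++ [p])
      let T ← grow G ε δ h path'
      return (p, T)) cs

/-- Algorithm Sphere-Peeling-Tree. -/
def spherePeelingTree (G : ChromaticInstance n k d) (ε δ : ℝ) : RT (PeelingTree d k) :=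
  grow G ε δ k []

/-- The points on the root-to-leaf paths of a tree. -/
def PeelingTree.paths : (h : ℕ) → PeelingTree d h → List (Fin h → Pt d)
  | 0, _ => [fun i => i.elim0]
  | h + 1, T =>
    List.flatMap (fun c : Pt d × PeelingTree d h =>
      (PeelingTree.paths h c.2).map fun f => (Fin.cons c.1 f : Fin (h + 1) → Pt d)) T

/-! ## The algorithm -/

/-- Algorithm `k`-CMeans with accuracy parameter `ε`. It returns the `k` points on the best path
and the chromatic partition found for them by the bipartite matching procedure (and `none` only
if there is no path at all, which happens for an instance without points). -/
def kCMeans (G : ChromaticInstance n k d) (ε : ℝ) : RT (Option (Solution G)) := do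
  let b ← initialBound G ε
  match b with
  | none => return none
  | some Δ => do
    let ms ← flatMapList (fun i => do
      let δ ← charge 10 (√Δ / (2 * k) + ((i : ℝ) + 1) * (ε / (2 * k)) * √Δ)
      let T ← spherePeelingTree G ε δ
      charge ((T.paths k).length * (k + 1)) (T.paths k)) (List.range ⌈2 * (k : ℝ) / ε⌉₊)
    let r ← bestTuple G ms
    return r.map Prod.fst

end

end ChromaticClustering

/-!
Why the algorithm works. Let `V` be the optimal total squared distance and `N` the number of
points, and write `e = ε / (100 k ^ 3)` for the accuracy parameter. The cells of an optimal
partition are taken in order of decreasing size, with their means `m_0, m_1, …`, sizes `b_l` and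
costs `v_l` (`exists_sorted_optimum`). It is enough that some root-to-leaf path `p_0, …, p_{k-1}`
is *good* (`GoodPath`): `‖p_l - m_l‖ ≤ e √(v_l / b_l) + (1 + e) (l + 1) √(e V / b_l)` for every
nonempty cell. Indeed, moving a center from the mean `m_l` to `p_l` costs `b_l ‖p_l - m_l‖ ^ 2`
more, and these sum up to at most `ε V` (`totalCost_le_of_goodPath`); the bipartite matching
procedure then finds a partition that is, for these centers, at least as good as the optimal one.

*Extending a good path.* Let `j` be the length of the path. If `δ` approximates `√(V / N)`, one of
the radius candidates approximates `R = (j + 1) √(e V / b_j)` (`exists_radius`). By Chebyshev's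
inequality, few points of the earlier cells are outside the balls of radius `R` around the path,
and later cells are not larger than the current one; hence at most `5 b_j / e` points remain
(`card_farPoints_le`). If a fraction of at least `e ^ 2 / 16` of the current cell remains, a
uniform sample of the remaining points has, with probability at least `1 - 1 / (4 k)`, a subset
whose mean `π` is close to the mean of the remaining points of the cell (`le_prob_sampleMeans`, a
second-moment argument). The points of the cell that were removed are within about `R` of the
path, so the mean of the cell is close to a convex combination of the path and `π`, and a grid
point of the simplex replaces it (`exists_child_of_sample`, based on the rounding lemma
`exists_grid_point`). If less of the cell remains, the grid of the simplex spanned by the path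
alone is enough (`exists_child_of_few`). Only one child per level has to be followed, so a tree
contains a good path with probability at least `(1 - 1 / (4 k)) ^ k ≥ 3 / 4`.

*The value of `δ`.* That one of the values tried approximates `√(V / N)` follows if the initial
bound `Δ` is between `V / N` and `16 V / N`. For this the scheme for ordinary k-means only has to
be a 4-approximation with good probability (`le_prob_kMeansPTAS`). This is shown by following one
branch of the search: as long as a good part of the remaining points is in clusters without a
center, the mean of one of these clusters is guessed by sampling; otherwise the nearest half is
assigned, and the points assigned wrongly are charged to the remaining ones, which are farther
away (`halving_step_bound`). For ordinary centers `C`, replacing each optimal chromatic center by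
its nearest point of `C` gives a `k`-tuple of cost at most `16 V` (`exists_tuple_cost_le`).

*Steps.* Every run obeys explicit bounds on the sizes of all lists, proved together with the facts
on results that are certain (`Bd`). Each of the `k` levels contributes a factor `log n`: the
halving depth in the k-means scheme, the number of radius candidates in the tree. Sorting
contributes the last factor `log n`. Everything that depends on `k` and `ε` only is bounded by a
power of `2 ^ M ^ 2`, where `M` is polynomial in `k / ε` (`bd_kCMeans`, `sizeBound`).
-/

namespace ChromaticClustering

noncomputable section

variable {n k d : ℕ}

/-! ### Reasoning about randomized computations -/

namespace RT

variable {α β : Type}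

/-- The joint law of the result and the step count, as a probability mass function. -/
def law (x : RT α) : PMF (α × ℕ) := x

theorem law_bind (x : RT α) (f : α → RT β) :
    (x >>= f).law = x.law.bind fun a => (f a.1).law.map fun b => (b.1, a.2 + b.2) := rfl

theorem law_charge (c : ℕ) (a : α) : (charge c a).law = PMF.pure (a, c) := rfl

theorem law_draw (a : α) (l : List α) : (draw a l).law =
    (PMF.uniformOfFintype (Fin (l.length + 1))).map fun i => ((a :: l).get i, 1) := rfl

theorem prob_eq (x : RT α) (S : α → Prop) : x.prob S = x.law.toOuterMeasure {a | S a.1} := rfl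

/-- Every run of `x` returns a result satisfying `P` and makes at most `T` steps. -/
def Bd (x : RT α) (P : α → Prop) (T : ℕ) : Prop :=
  ∀ a ∈ x.law.support, P a.1 ∧ a.2 ≤ T

theorem Bd.mono {x : RT α} {P Q : α → Prop} {S T : ℕ} (h : Bd x P S) (hPQ : ∀ a, P a → Q a)
    (hST : S ≤ T) : Bd x Q T :=
  fun a ha => ⟨hPQ _ (h a ha).1, (h a ha).2.trans hST⟩

theorem Bd.imp {x : RT α} {P Q : α → Prop} {T : ℕ} (h : Bd x P T) (hPQ : ∀ a, P a → Q a) :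
    Bd x Q T :=
  h.mono hPQ le_rfl

theorem Bd.le {x : RT α} {P : α → Prop} {S T : ℕ} (h : Bd x P S) (hST : S ≤ T) : Bd x P T :=
  h.mono (fun _ => id) hST

theorem bd_charge {P : α → Prop} {c T : ℕ} {a : α} (ha : P a) (h : c ≤ T) :
    Bd (charge c a) P T := by
  intro b hb
  rw [law_charge, PMF.mem_support_pure_iff] at hb
  subst hb
  exact ⟨ha, h⟩

theorem bd_pure {P : α → Prop} {T : ℕ} {a : α} (ha : P a) : Bd (pure a : RT α) P T :=
  bd_charge ha (Nat.zero_le _)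

theorem Bd.bind {x : RT α} {f : α → RT β} {P : α → Prop} {Q : β → Prop} {S T U : ℕ}
    (hx : Bd x P S) (hf : ∀ a, P a → Bd (f a) Q T) (h : S + T ≤ U) : Bd (x >>= f) Q U := by
  intro b hb
  rw [law_bind, PMF.mem_support_bind_iff] at hb
  obtain ⟨a, ha, hb⟩ := hb
  rw [PMF.mem_support_map_iff] at hb
  obtain ⟨c, hc, rfl⟩ := hb
  have h1 := hx a ha
  have h2 := hf a.1 h1.1 c hc
  exact ⟨h2.1, (add_le_add h1.2 h2.2).trans h⟩

theorem bd_draw (a : α) (l : List α) : Bd (draw a l) (fun b => b ∈ a :: l) 1 := by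
  intro b hb
  rw [law_draw, PMF.mem_support_map_iff] at hb
  obtain ⟨i, -, rfl⟩ := hb
  exact ⟨List.get_mem _ _, le_rfl⟩

theorem bd_mapList {f : α → RT β} {R : α → β → Prop} {T : ℕ} :
    ∀ {l : List α}, (∀ a ∈ l, Bd (f a) (R a) T) →
      Bd (mapList f l) (fun bs => List.Forall₂ R l bs) (l.length * (T + 1) + 1)
  | [], _ => bd_charge List.Forall₂.nil (by simp)
  | a :: l, h => by
    rw [mapList]
    refine (h a (by simp)).bind (T := l.length * (T + 1) + 1 + 1) (fun b hb => ?_)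
      (by simp only [List.length_cons]; ring_nf; omega)
    refine (bd_mapList (l := l) fun a ha => h a (by simp [ha])).bind (T := 1)
      (fun bs hbs => ?_) le_rfl
    exact bd_charge (List.Forall₂.cons hb hbs) le_rfl

theorem bd_mapList_eq {f : α → RT β} {g : α → β} {T : ℕ} {l : List α}
    (h : ∀ a ∈ l, Bd (f a) (fun b => b = g a) T) :
    Bd (mapList f l) (fun bs => bs = l.map g) (l.length * (T + 1) + 1) := by
  refine (bd_mapList (R := fun a b => b = g a) h).imp fun bs hbs => ?_
  induction hbs with
  | nil => rfl
  | cons h' _ ih => rw [List.map_cons, ← h', ← ih fun a ha => h a (by simp [ha])]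

theorem bd_flatMapList {f : α → RT (List β)} {R : α → List β → Prop} {T M : ℕ} {l : List α}
    (h : ∀ a ∈ l, Bd (f a) (fun bs => R a bs ∧ bs.length ≤ M) T) :
    Bd (flatMapList f l) (fun bs => bs.length ≤ l.length * M ∧
      ∃ ls, List.Forall₂ R l ls ∧ bs = ls.flatten) (l.length * (T + M + 1) + 1) := by
  refine (bd_mapList h).bind (T := l.length * M) (fun ls hls => ?_) (by ring_nf; omega)
  have h1 : ls.flatten.length ≤ l.length * M ∧ List.Forall₂ R l ls := by
    clear h
    induction hls with
    | nil => simp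
    | cons h _ ih =>
      refine ⟨?_, List.Forall₂.cons h.1 ih.2⟩
      rw [List.flatten_cons, List.length_append, List.length_cons]
      have h1 := ih.1
      have h2 := h.2
      nlinarith
  exact bd_charge ⟨h1.1, ls, h1.2, rfl⟩ h1.1

theorem bd_filterList {f : α → RT Bool} {g : α → Bool} {T : ℕ} :
    ∀ {l : List α}, (∀ a ∈ l, Bd (f a) (fun b => b = g a) T) →
      Bd (filterList f l) (fun bs => bs = l.filter g) (l.length * (T + 1) + 1)
  | [], _ => bd_charge rfl (by simp)
  | a :: l, h => by
    rw [filterList]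
    refine (h a (by simp)).bind (T := l.length * (T + 1) + 1 + 1) (fun b hb => ?_)
      (by simp only [List.length_cons]; ring_nf; omega)
    refine (bd_filterList (l := l) fun a ha => h a (by simp [ha])).bind (T := 1)
      (fun bs hbs => ?_) le_rfl
    refine bd_charge ?_ le_rfl
    rw [hb, hbs, List.filter_cons]

theorem bd_tabulate {T : ℕ} : ∀ {m : ℕ} {γ : Fin m → Type} {f : (i : Fin m) → RT (γ i)}
    {R : (i : Fin m) → γ i → Prop}, (∀ i, Bd (f i) (R i) T) →
      Bd (tabulate f) (fun r => ∀ i, R i (r i)) (m * (T + 1) + 1)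
  | 0, _, _, _, _ => bd_charge (fun i => i.elim0) (by simp)
  | m + 1, γ, f, R, h => by
    rw [tabulate]
    refine (h 0).bind (T := m * (T + 1) + 1 + 1) (fun b hb => ?_) (by ring_nf; omega)
    refine (bd_tabulate (f := fun i => f i.succ) (R := fun i => R i.succ)
      fun i => h i.succ).bind (T := 1) (fun r hr => ?_) le_rfl
    refine bd_charge (fun i => ?_) le_rfl
    refine Fin.cases ?_ (fun i => ?_) i
    · simpa using hb
    · simpa using hr i

theorem bd_sumList (l : List ℝ) : Bd (sumList l) (fun v => v = l.sum) (l.length + 1) :=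
  bd_charge rfl le_rfl

theorem bd_sqDist (p q : Pt d) : Bd (sqDist p q) (fun v => v = ‖p - q‖ ^ 2) (3 * d) :=
  bd_charge rfl le_rfl

theorem bd_better (x y : Option (β × ℝ)) :
    Bd (better x y) (fun r => (r = x ∨ r = y) ∧ (x ≠ none ∨ y ≠ none → r ≠ none) ∧
      ∀ b v, r = some (b, v) → (∀ b' v', x = some (b', v') → v ≤ v') ∧
        ∀ b' v', y = some (b', v') → v ≤ v') 1 := by
  rcases x with - | ⟨a, u⟩ <;> rcases y with - | ⟨b, w⟩ <;>
    refine bd_charge ?_ le_rfl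
  · simp
  · simp +contextual
  · simp +contextual
  · dsimp only
    split_ifs with h
    · refine ⟨Or.inl rfl, by simp, fun b' v' e => ?_⟩
      simp only [Option.some.injEq, Prod.mk.injEq] at e
      obtain ⟨rfl, rfl⟩ := e
      simp only [Option.some.injEq, Prod.mk.injEq, and_imp]
      exact ⟨by rintro _ _ _ rfl; exact le_rfl, by rintro _ _ _ rfl; exact h⟩
    · refine ⟨Or.inr rfl, by simp, fun b' v' e => ?_⟩
      simp only [Option.some.injEq, Prod.mk.injEq] at e
      obtain ⟨rfl, rfl⟩ := e
      simp only [Option.some.injEq, Prod.mk.injEq, and_imp]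
      exact ⟨by rintro _ _ _ rfl; exact (not_le.1 h).le, by rintro _ _ _ rfl; exact le_rfl⟩

theorem bd_argmin {f : α → RT (Option (β × ℝ))} {R : α → Option (β × ℝ) → Prop} {T : ℕ} :
    ∀ {l : List α}, (∀ a ∈ l, Bd (f a) (R a) T) →
      Bd (argmin f l) (fun y => (y = none → ∀ a ∈ l, R a none) ∧
        ∀ b v, y = some (b, v) → (∃ a ∈ l, R a (some (b, v))) ∧
          ∀ a ∈ l, ∃ r, R a r ∧ ∀ b' v', r = some (b', v') → v ≤ v') (l.length * (T + 1) + 1)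
  | [], _ => bd_charge (by simp) (by simp)
  | a :: l, h => by
    rw [argmin]
    refine (h a (by simp)).bind (T := l.length * (T + 1) + 1 + 1) (fun x hx => ?_)
      (by simp only [List.length_cons]; ring_nf; omega)
    refine (bd_argmin (l := l) fun a ha => h a (by simp [ha])).bind (T := 1)
      (fun y hy => ?_) le_rfl
    refine (bd_better x y).imp fun r hr => ?_
    obtain ⟨h1, h2, h3⟩ := hr
    constructor
    · rintro rfl
      have : x = none ∧ y = none := by
        by_contra hc
        exact h2 (by tauto) rfl
      obtain ⟨rfl, rfl⟩ := this
      intro b hb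
      rcases List.mem_cons.1 hb with rfl | hb
      · exact hx
      · exact hy.1 rfl b hb
    · rintro b v rfl
      obtain ⟨hl, hr⟩ := h3 b v rfl
      constructor
      · rcases h1 with rfl | rfl
        · exact ⟨a, by simp, hx⟩
        · obtain ⟨⟨a', ha', hh⟩, -⟩ := hy.2 b v rfl
          exact ⟨a', by simp [ha'], hh⟩
      · intro a' ha'
        rcases List.mem_cons.1 ha' with rfl | ha'
        · exact ⟨x, hx, hl⟩
        · rcases y with - | ⟨b1, v1⟩
          · exact ⟨none, hy.1 rfl a' ha', by simp⟩
          · obtain ⟨r, hr1, hr2⟩ := (hy.2 b1 v1 rfl).2 a' ha'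
            exact ⟨r, hr1, fun b' v' e => (hr b1 v1 rfl).trans (hr2 b' v' e)⟩

/-! ### Lower bounds for success probabilities -/

theorem prob_bind (x : RT α) (f : α → RT β) (S : β → Prop) :
    (x >>= f).prob S = ∑' a : α × ℕ, x.law a * (f a.1).prob S := by
  rw [prob_eq, law_bind, PMF.toOuterMeasure_bind_apply]
  refine tsum_congr fun a => ?_
  rw [PMF.toOuterMeasure_map_apply]
  rfl

theorem prob_le_one (x : RT α) (S : α → Prop) : x.prob S ≤ 1 := by
  have h : x.law.toOuterMeasure Set.univ = 1 :=
    (PMF.toOuterMeasure_apply_eq_one_iff _ _).2 (Set.subset_univ _)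
  rw [← h]
  exact MeasureTheory.measure_mono (Set.subset_univ _)

theorem Bd.prob_mono {x : RT α} {P S S' : α → Prop} {T : ℕ} (hx : Bd x P T)
    (h : ∀ a, P a → S a → S' a) : x.prob S ≤ x.prob S' :=
  PMF.toOuterMeasure_mono _ fun a ha => h a.1 (hx a ha.2).1 ha.1

theorem prob_mono {x : RT α} {S S' : α → Prop} (h : ∀ a, S a → S' a) : x.prob S ≤ x.prob S' :=
  MeasureTheory.measure_mono fun a => h a.1

theorem prob_add_prob_not (x : RT α) (S : α → Prop) :
    x.prob S + x.prob (fun a => ¬ S a) = 1 := by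
  have h : ∑' a, x.law a = 1 := PMF.tsum_coe _
  rw [prob_eq, prob_eq, PMF.toOuterMeasure_apply, PMF.toOuterMeasure_apply, ← ENNReal.tsum_add, ← h]
  refine tsum_congr fun a => ?_
  by_cases ha : S a.1 <;> simp [ha]

theorem le_prob_of_prob_not_le {x : RT α} {S : α → Prop} {η : ENNReal}
    (h : x.prob (fun a => ¬ S a) ≤ η) : 1 - η ≤ x.prob S := by
  rw [← prob_add_prob_not x S]
  exact tsub_le_iff_right.2 (add_le_add le_rfl h)

theorem le_prob_bind {x : RT α} {f : α → RT β} {A : α → Prop} {S : β → Prop} {p q : ENNReal}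
    (hx : p ≤ x.prob A) (hf : ∀ a, A a → q ≤ (f a).prob S) : p * q ≤ (x >>= f).prob S := by
  rw [prob_bind]
  refine (mul_le_mul_left hx q).trans ?_
  rw [prob_eq, PMF.toOuterMeasure_apply, ← ENNReal.tsum_mul_right]
  refine ENNReal.tsum_le_tsum fun a => ?_
  by_cases ha : A a.1
  · rw [Set.indicator_of_mem (by exact ha)]
    exact mul_le_mul_right (hf _ ha) _
  · rw [Set.indicator_of_notMem (by exact ha)]
    simp

theorem Bd.prob_eq_one {x : RT α} {P : α → Prop} {T : ℕ} (hx : Bd x P T) : x.prob P = 1 :=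
  (PMF.toOuterMeasure_apply_eq_one_iff _ _).2 fun a ha => (hx a ha).1

theorem Bd.le_prob_bind {x : RT α} {f : α → RT β} {P : α → Prop} {S : β → Prop} {T : ℕ}
    {q : ENNReal} (hx : Bd x P T) (hf : ∀ a, P a → q ≤ (f a).prob S) :
    q ≤ (x >>= f).prob S := by
  simpa using RT.le_prob_bind hx.prob_eq_one.ge hf

theorem le_prob_bind_of_forall {x : RT α} {f : α → RT β} {S : β → Prop} {q : ENNReal}
    (hf : ∀ a, q ≤ (f a).prob S) : q ≤ (x >>= f).prob S := by
  have h : x.prob (fun _ => True) = 1 :=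
    (PMF.toOuterMeasure_apply_eq_one_iff _ _).2 fun _ _ => trivial
  simpa using RT.le_prob_bind h.ge fun a _ => hf a

theorem le_prob_bind_bd {x : RT α} {f : α → RT β} {A : α → Prop} {S : β → Prop} {p : ENNReal}
    {T : ℕ} (hx : p ≤ x.prob A) (hf : ∀ a, A a → Bd (f a) S T) : p ≤ (x >>= f).prob S := by
  simpa using RT.le_prob_bind hx fun a ha => (hf a ha).prob_eq_one.ge

theorem Bd.le_prob {x : RT α} {P : α → Prop} {T : ℕ} {q : ENNReal} (hx : Bd x P T)
    (hq : q ≤ 1) : q ≤ x.prob P :=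
  hq.trans hx.prob_eq_one.ge

theorem le_prob_charge {S : α → Prop} {a : α} {c : ℕ} {q : ENNReal} (hq : q ≤ 1) (ha : S a) :
    q ≤ (charge c a).prob S :=
  (bd_charge (T := c) ha le_rfl).le_prob hq

theorem prob_true (x : RT α) : x.prob (fun _ => True) = 1 :=
  (PMF.toOuterMeasure_apply_eq_one_iff _ _).2 fun _ _ => trivial

/-- A success of the run on one entry is enough; the other runs are ignored. -/
theorem le_prob_mapList {f : α → RT β} {S : β → Prop} {q : ENNReal} {a : α} :
    ∀ {l : List α}, a ∈ l → q ≤ (f a).prob S → q ≤ (mapList f l).prob (fun bs => ∃ b ∈ bs, S b)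
  | [], h, _ => by simp at h
  | b :: l, h, hq => by
    have hq1 : q ≤ 1 := hq.trans (prob_le_one _ _)
    rw [mapList]
    rcases List.mem_cons.1 h with rfl | h
    · rw [← mul_one q]
      refine le_prob_bind hq fun b hb => ?_
      rw [← mul_one 1]
      refine le_prob_bind (prob_true _).ge fun bs _ => ?_
      exact le_prob_charge le_rfl ⟨b, by simp, hb⟩
    · rw [← one_mul q]
      refine le_prob_bind (prob_true _).ge fun b _ => ?_
      rw [← mul_one q]
      refine le_prob_bind (le_prob_mapList h hq) fun bs hbs => ?_
      obtain ⟨c, hc, hS⟩ := hbs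
      exact le_prob_charge le_rfl ⟨c, by simp [hc], hS⟩

theorem le_prob_flatMapList {f : α → RT (List β)} {S : β → Prop} {q : ENNReal} {a : α}
    {l : List α} (ha : a ∈ l) (hq : q ≤ (f a).prob (fun bs => ∃ b ∈ bs, S b)) :
    q ≤ (flatMapList f l).prob (fun bs => ∃ b ∈ bs, S b) := by
  rw [flatMapList, ← mul_one q]
  refine le_prob_bind (le_prob_mapList ha hq) fun ls hls => ?_
  obtain ⟨bs, hbs, b, hb, hS⟩ := hls
  exact le_prob_charge le_rfl ⟨b, List.mem_flatten.2 ⟨bs, hbs, hb⟩, hS⟩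

/-- The better of two candidates is good if one of them is. -/
theorem bd_better_le {x y : Option (β × ℝ)} {t : ℝ}
    (h : (∃ b v, x = some (b, v) ∧ v ≤ t) ∨ ∃ b v, y = some (b, v) ∧ v ≤ t) :
    Bd (better x y) (fun r => ∃ b v, r = some (b, v) ∧ v ≤ t) 1 := by
  refine (bd_better x y).imp fun r hr => ?_
  obtain ⟨-, h2, h3⟩ := hr
  have hne : r ≠ none := by
    apply h2
    rcases h with ⟨b, v, rfl, -⟩ | ⟨b, v, rfl, -⟩ <;> simp
  obtain ⟨⟨b, v⟩, rfl⟩ := Option.ne_none_iff_exists'.1 hne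
  refine ⟨b, v, rfl, ?_⟩
  obtain ⟨h4, h5⟩ := h3 b v rfl
  rcases h with ⟨b', v', rfl, h⟩ | ⟨b', v', rfl, h⟩
  · exact (h4 b' v' rfl).trans h
  · exact (h5 b' v' rfl).trans h

theorem le_prob_argmin {f : α → RT (Option (β × ℝ))} {t : ℝ} {q : ENNReal} {a : α} :
    ∀ {l : List α}, a ∈ l → q ≤ (f a).prob (fun r => ∃ b v, r = some (b, v) ∧ v ≤ t) →
      q ≤ (argmin f l).prob (fun r => ∃ b v, r = some (b, v) ∧ v ≤ t)
  | [], h, _ => by simp at h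
  | b :: l, h, hq => by
    rw [argmin]
    rcases List.mem_cons.1 h with rfl | h
    · rw [← mul_one q]
      refine le_prob_bind hq fun x hx => ?_
      rw [← mul_one 1]
      exact le_prob_bind (prob_true _).ge fun y _ => (bd_better_le (Or.inl hx)).prob_eq_one.ge
    · rw [← one_mul q]
      refine le_prob_bind (prob_true _).ge fun x _ => ?_
      exact le_prob_bind_bd (le_prob_argmin h hq) fun y hy => bd_better_le (Or.inr hy)

end RT

/-! ### Means of random samples -/

namespace RT

variable {α β : Type}

theorem prob_draw_bind (a : α) (l : List α) (f : α → RT β) (S : β → Prop) :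
    (draw a l >>= f).prob S =
      ∑ i : Fin (l.length + 1), ((l.length + 1 : ℕ) : ENNReal)⁻¹ *
        (f ((a :: l).get i)).prob S := by
  rw [prob_eq, law_bind, law_draw, PMF.bind_map, PMF.toOuterMeasure_bind_apply, tsum_fintype]
  refine Finset.sum_congr rfl fun i _ => ?_
  have h : PMF.uniformOfFintype (Fin (l.length + 1)) i = ((l.length + 1 : ℕ) : ENNReal)⁻¹ := by
    rw [PMF.uniformOfFintype_apply, Fintype.card_fin]
  rw [Function.comp, PMF.toOuterMeasure_map_apply]
  exact congrArg (· * _) h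

theorem sum_get_cons {ι M : Type} [AddCommMonoid M] (a : ι) (l : List ι) (F : ι → M) :
    ∑ i : Fin (l.length + 1), F ((a :: l).get i) = ((a :: l).map F).sum := by
  rw [← Fin.sum_univ_fun_getElem]
  rfl

/-- The second-moment computation behind random sampling, carried out one draw at a time. For
independent uniformly random entries of the list `L`, let `Y` be the sum of the `f`-values, which
average to `0`, and `W` the sum of the `c`-values. The potential
`A (‖Y‖² + i σ) + B ((W + i ρ - μ)² + i ρ)`, where `i` is the number of draws still to be made, does
not increase in expectation, so that Markov's inequality bounds its final value. Entries of the
list are tags, and `g` gives the points that are actually drawn. -/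
theorem prob_draws_le {ι κ : Type} (g : ι → Pt d) (a : ι) (l : List ι) (f : ι → Pt d)
    (c : ι → ℝ) (hc : ∀ x, c x ^ 2 = c x) (hf : ((a :: l).map f).sum = 0)
    {A B μ σ ρ : ℝ} (hA : 0 ≤ A) (hB : 0 ≤ B)
    (hσ : σ = ((a :: l).map fun x => ‖f x‖ ^ 2).sum / (l.length + 1 : ℕ))
    (hρ : ρ = ((a :: l).map c).sum / (l.length + 1 : ℕ)) :
    ∀ (ks : List κ) (y : Pt d) (w : ℝ),
      (mapList (fun _ => draw (g a) (l.map g)) ks).prob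
        (fun s => ¬ ∃ t : List ι, (∀ x ∈ t, x ∈ a :: l) ∧ s = t.map g ∧
          A * ‖y + (t.map f).sum‖ ^ 2 + B * (w + (t.map c).sum - μ) ^ 2 < 1) ≤
        ENNReal.ofReal (A * (‖y‖ ^ 2 + ks.length * σ) +
          B * ((w + ks.length * ρ - μ) ^ 2 + ks.length * ρ))
  | [], y, w => by
    by_cases h : A * ‖y‖ ^ 2 + B * (w - μ) ^ 2 < 1
    · refine le_trans (le_of_eq ?_) zero_le
      rw [prob_eq, PMF.toOuterMeasure_apply_eq_zero_iff, mapList, law_charge, PMF.support_pure,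
        Set.disjoint_singleton_left]
      simp only [Set.mem_ofPred_eq, not_not]
      exact ⟨[], by simp, by simp, by simpa using h⟩
    · refine (prob_le_one _ _).trans ?_
      rw [ENNReal.one_le_ofReal]
      simpa using h
  | q :: ks, y, w => by
    have hn : (0 : ℝ) < (l.length + 1 : ℕ) := by positivity
    have hρ0 : 0 ≤ ρ := by
      rw [hρ]
      refine div_nonneg (List.sum_nonneg fun i hi => ?_) hn.le
      obtain ⟨x, -, rfl⟩ := List.mem_map.1 hi
      rw [← hc]; positivity
    have hσ0 : 0 ≤ σ := by
      rw [hσ]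
      refine div_nonneg (List.sum_nonneg fun i hi => ?_) hn.le
      obtain ⟨x, -, rfl⟩ := List.mem_map.1 hi
      positivity
    have key : ∀ x ∈ a :: l,
        (mapList (fun _ => draw (g a) (l.map g)) ks >>= fun bs =>
          charge 1 (g x :: bs)).prob
        (fun s => ¬ ∃ t : List ι, (∀ x ∈ t, x ∈ a :: l) ∧ s = t.map g ∧
          A * ‖y + (t.map f).sum‖ ^ 2 + B * (w + (t.map c).sum - μ) ^ 2 < 1) ≤
        ENNReal.ofReal (A * (‖y + f x‖ ^ 2 + ks.length * σ) +
          B * ((w + c x + ks.length * ρ - μ) ^ 2 + ks.length * ρ)) := by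
      intro x hx
      refine le_trans ?_ (prob_draws_le g a l f c hc hf hA hB hσ hρ ks (y + f x) (w + c x))
      rw [prob_bind, prob_eq, PMF.toOuterMeasure_apply]
      refine ENNReal.tsum_le_tsum fun bs => ?_
      by_cases h : ∃ t : List ι, (∀ x ∈ t, x ∈ a :: l) ∧ bs.1 = t.map g ∧
          A * ‖y + f x + (t.map f).sum‖ ^ 2 + B * (w + c x + (t.map c).sum - μ) ^ 2 < 1
      · refine le_trans (le_of_eq ?_) zero_le
        rw [mul_eq_zero]
        right
        rw [prob_eq, PMF.toOuterMeasure_apply_eq_zero_iff, law_charge, PMF.support_pure,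
          Set.disjoint_singleton_left]
        simp only [Set.mem_ofPred_eq, not_not]
        obtain ⟨t, h1, h2, h3⟩ := h
        refine ⟨x :: t, ?_, by simp [h2], by simpa [add_assoc] using h3⟩
        intro u hu
        rcases List.mem_cons.1 hu with rfl | hu
        · exact hx
        · exact h1 u hu
      · rw [Set.indicator_of_mem (by exact h)]
        exact mul_le_of_le_one_right zero_le (prob_le_one _ _)
    rw [mapList, prob_draw_bind]
    -- the list of the points is the image of the list of the tags
    have hlen : (l.map g).length + 1 = l.length + 1 := by simp
    rw [← (finCongr hlen).symm.sum_comp]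
    have hget : ∀ i : Fin (l.length + 1),
        (g a :: l.map g).get ((finCongr hlen).symm i) = g ((a :: l).get i) := by
      intro i
      refine Fin.cases ?_ (fun i => ?_) i <;> simp
    simp only [hget, hlen]
    refine (Finset.sum_le_sum fun i _ => mul_le_mul_right (key _ (List.get_mem _ _)) _).trans ?_
    rw [← Finset.mul_sum, ← ENNReal.ofReal_sum_of_nonneg (fun i _ => by positivity),
      ← ENNReal.ofReal_natCast, ← ENNReal.ofReal_inv_of_pos hn,
      ← ENNReal.ofReal_mul (by positivity)]
    refine ENNReal.ofReal_le_ofReal ?_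
    rw [inv_mul_le_iff₀ hn]
    set m : ℝ := (ks.length : ℝ) with hm
    have e1 : ∀ i : Fin (l.length + 1), A * (‖y + f ((a :: l).get i)‖ ^ 2 + m * σ) +
        B * ((w + c ((a :: l).get i) + m * ρ - μ) ^ 2 + m * ρ) =
        (A * (‖y‖ ^ 2 + m * σ) + B * ((w + m * ρ - μ) ^ 2 + m * ρ)) +
        2 * A * inner ℝ y (f ((a :: l).get i)) + A * ‖f ((a :: l).get i)‖ ^ 2 +
        (2 * B * (w + m * ρ - μ) + B) * c ((a :: l).get i) := by
      intro i
      rw [norm_add_sq_real]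
      linear_combination B * hc ((a :: l).get i)
    rw [Finset.sum_congr rfl fun i _ => e1 i, Finset.sum_add_distrib, Finset.sum_add_distrib,
      Finset.sum_add_distrib, ← Finset.mul_sum, ← Finset.mul_sum, ← Finset.mul_sum, ← inner_sum,
      sum_get_cons, sum_get_cons a l c, sum_get_cons a l fun x => ‖f x‖ ^ 2, hf, inner_zero_right,
      Finset.sum_const, Finset.card_univ, Fintype.card_fin, nsmul_eq_mul,
      (div_eq_iff hn.ne').1 hσ.symm, (div_eq_iff hn.ne').1 hρ.symm]
    have : ((q :: ks).length : ℝ) = m + 1 := by simp [hm]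
    rw [this]
    have h3 : 0 ≤ ((l.length + 1 : ℕ) : ℝ) * (B * ρ ^ 2) := by positivity
    linarith

end RT

open RT

/-- The mean of a list of points. -/
def listMean (s : List (Pt d)) : Pt d := (s.length : ℝ)⁻¹ • s.sum

theorem bd_subsetMeans (s : List (Pt d)) :
    Bd (charge ((s.sublists.filter fun t => !t.isEmpty).map fun t => t.length + 1).sum
        (s.sublists.filter fun t => !t.isEmpty) >>= mapList mean)
      (fun ms => ms = (s.sublists.filter fun t => !t.isEmpty).map listMean)
      (2 ^ s.length * (s.length + 1) + (2 ^ s.length * ((s.length + 1) * d + 1) + 1)) := by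
  have h1 : ∀ t ∈ s.sublists.filter (fun t => !t.isEmpty), t.length ≤ s.length := by
    intro t ht
    rw [List.mem_filter, List.mem_sublists] at ht
    exact ht.1.length_le
  have h2 : (s.sublists.filter fun t => !t.isEmpty).length ≤ 2 ^ s.length :=
    (List.length_filter_le _ _).trans (by rw [List.length_sublists])
  refine (bd_charge (P := fun u => u = s.sublists.filter (fun t => !t.isEmpty)) rfl ?_).bind
    (T := 2 ^ s.length * ((s.length + 1) * d + 1) + 1) (fun u hu => ?_) le_rfl
  · refine (List.sum_le_card_nsmul _ (s.length + 1) ?_).trans ?_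
    · intro x hx
      obtain ⟨t, ht, rfl⟩ := List.mem_map.1 hx
      exact Nat.succ_le_succ (h1 t ht)
    · rw [List.length_map, smul_eq_mul]
      exact Nat.mul_le_mul_right _ h2
  · subst hu
    refine (bd_mapList_eq (g := listMean) (T := (s.length + 1) * d) fun t ht => ?_).le ?_
    · exact bd_charge rfl (Nat.mul_le_mul_right _ (Nat.succ_le_succ (h1 t ht)))
    · exact Nat.succ_le_succ (Nat.mul_le_mul_right _ h2)

theorem bd_sampleMeans (z : ℕ) (L : List (Pt d)) :
    Bd (sampleMeans z L) (fun ms => ms.length ≤ 2 ^ z)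
      (2 * z + 2 + 2 ^ z * (z + 1) + 2 ^ z * ((z + 1) * d + 1)) := by
  rcases L with - | ⟨a, l⟩
  · exact bd_charge (by simp) (by omega)
  rw [sampleMeans]
  refine (bd_mapList (T := 1) fun _ _ => bd_draw a l).bind
    (T := 2 ^ z * (z + 1) + (2 ^ z * ((z + 1) * d + 1) + 1)) (fun s hs => ?_)
    (by rw [List.length_range]; omega)
  have hs' : s.length = z := by rw [← hs.length_eq, List.length_range]
  subst hs'
  refine (bd_subsetMeans s).imp fun ms hms => ?_
  rw [hms, List.length_map, ← List.length_sublists]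
  exact List.length_filter_le _ _

/-- With good probability, among the means of the subsets of a random sample there is one close to
the mean `τ` of a given part of the list. The part may be taken to be what the predicate `p` on
tags singles out, and the subset consists of all sampled points of that part. -/
theorem le_prob_sampleMeans {ι : Type} (g : ι → Pt d) (a : ι) (l : List ι) (p : ι → Bool)
    (z : ℕ) (hz : 0 < z) {T : ℝ} (hT : 0 < T) (τ : Pt d) (S b : ℝ) (hb : 0 < b)
    (hbl : b = ((a :: l).filter p).length)
    (hτ : b • τ = (((a :: l).filter p).map g).sum)
    (hS : S = (((a :: l).filter p).map fun x => ‖g x - τ‖ ^ 2).sum) :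
    1 - ENNReal.ofReal (4 * (l.length + 1 : ℕ) / (z * b) + 1 / T) ≤
      (sampleMeans z (g a :: l.map g)).prob
        (fun ms => ∃ π ∈ ms, b * ‖π - τ‖ ^ 2 ≤ 4 * T * (l.length + 1 : ℕ) / (z * b) * S) := by
  set N : ℝ := ((l.length + 1 : ℕ) : ℝ) with hN
  have hN0 : 0 < N := by rw [hN]; positivity
  have hz0 : (0 : ℝ) < z := by exact_mod_cast hz
  set f : ι → Pt d := fun x => if p x then g x - τ else 0 with hf
  set c : ι → ℝ := fun x => if p x then 1 else 0 with hc
  have sumf : ∀ t : List ι, (t.map f).sum =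
      ((t.filter p).map g).sum - ((t.filter p).length : ℝ) • τ := by
    intro t
    induction t with
    | nil => simp
    | cons x t ih =>
      rw [List.map_cons, List.sum_cons, ih]
      by_cases hx : p x
      · simp only [hx, hf, if_true, List.filter_cons_of_pos, List.map_cons, List.sum_cons,
          List.length_cons, Nat.cast_succ, add_smul, one_smul]
        abel
      · simp [hx, hf]
  have sumc : ∀ t : List ι, (t.map c).sum = ((t.filter p).length : ℝ) := by
    intro t
    induction t with
    | nil => simp
    | cons x t ih =>
      rw [List.map_cons, List.sum_cons, ih]
      by_cases hx : p x <;> simp [hx, hc, add_comm]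
  have sumS : ∀ t : List ι, (t.map fun x => ‖f x‖ ^ 2).sum =
      ((t.filter p).map fun x => ‖g x - τ‖ ^ 2).sum := by
    intro t
    induction t with
    | nil => simp
    | cons x t ih =>
      rw [List.map_cons, List.sum_cons, ih]
      by_cases hx : p x <;> simp [hx, hf]
  have hS0 : 0 ≤ S := by
    rw [hS]
    refine List.sum_nonneg fun x hx => ?_
    obtain ⟨u, -, rfl⟩ := List.mem_map.1 hx
    positivity
  set μ : ℝ := z * (b / N) with hμ
  have hμ0 : 0 < μ := by positivity
  have key := prob_draws_le g a l f c (fun x => by by_cases hx : p x <;> simp [hc, hx])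
    (by rw [sumf, ← hbl, ← hτ, sub_self]) (A := 1 / (T * (z * (S / N)))) (B := 4 / μ ^ 2)
    (μ := μ) (σ := S / N) (ρ := b / N) (by positivity) (by positivity)
    (by rw [sumS, ← hS]) (by rw [sumc, ← hbl]) (List.range z) 0 0
  rw [sampleMeans]
  refine (le_prob_of_prob_not_le (key.trans (ENNReal.ofReal_le_ofReal ?_))).trans ?_
  · rw [List.length_range, zero_add, ← hμ, sub_self, norm_zero]
    have h1 : 4 / μ ^ 2 * (0 ^ 2 + μ) = 4 * N / (z * b) := by
      rw [hμ]; field_simp; ring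
    have h2 : 1 / (T * (z * (S / N))) * (0 ^ 2 + z * (S / N)) ≤ 1 / T := by
      rcases hS0.eq_or_lt with h | h
      · rw [← h]; simp [hT.le]
      · apply le_of_eq
        field_simp
        ring
    linarith
  · refine (mul_one _).ge.trans (le_prob_bind le_rfl fun s hs => ?_)
    obtain ⟨t, ht, rfl, hlt⟩ := hs
    refine ((bd_subsetMeans (t.map g)).imp ?_).prob_eq_one.ge
    rintro ms rfl
    rw [zero_add, zero_add, sumc] at hlt
    set W : ℝ := ((t.filter p).length : ℝ) with hW
    have hA0 : 0 ≤ 1 / (T * (z * (S / N))) * ‖(t.map f).sum‖ ^ 2 := by positivity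
    have hW1 : (W - μ) ^ 2 < (μ / 2) ^ 2 := by
      have : 4 / μ ^ 2 * (W - μ) ^ 2 < 1 := by linarith
      rw [div_mul_eq_mul_div, div_lt_one (by positivity)] at this
      linarith
    have hW2 : μ / 2 < W := by
      have := (abs_lt_of_sq_lt_sq' hW1 (by positivity)).1
      linarith
    have hW0 : 0 < W := by linarith
    have hY : ‖(t.map f).sum‖ ^ 2 ≤ T * (z * (S / N)) := by
      rcases hS0.eq_or_lt with h | h
      · -- all points of the part coincide with `τ`
        have : (t.map f).sum = 0 := by
          apply List.sum_eq_zero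
          intro x hx
          obtain ⟨u, hu, rfl⟩ := List.mem_map.1 hx
          by_cases hp : p u
          · have hmem : ‖g u - τ‖ ^ 2 ≤ S := by
              rw [hS]
              refine List.single_le_sum (fun x hx => ?_) _
                (List.mem_map_of_mem (List.mem_filter.2 ⟨ht u hu, hp⟩))
              obtain ⟨u, -, rfl⟩ := List.mem_map.1 hx
              positivity
            rw [← h] at hmem
            have : ‖g u - τ‖ = 0 := by nlinarith [norm_nonneg (g u - τ)]
            simpa [hf, hp] using this
          · simp [hf, hp]
        rw [this, ← h]
        simp
      · have hB0 : 0 ≤ 4 / μ ^ 2 * (W - μ) ^ 2 := by positivity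
        have : 1 / (T * (z * (S / N))) * ‖(t.map f).sum‖ ^ 2 < 1 := by linarith
        rw [div_mul_eq_mul_div, one_mul, div_lt_one (by positivity)] at this
        exact this.le
    refine ⟨listMean ((t.filter p).map g), List.mem_map_of_mem ?_, ?_⟩
    · rw [List.mem_filter, List.mem_sublists]
      refine ⟨List.filter_sublist.map g, ?_⟩
      have : (t.filter p) ≠ [] := by
        intro h
        rw [hW, h] at hW0
        simp at hW0
      simpa using this
    · have e : listMean ((t.filter p).map g) - τ = W⁻¹ • (t.map f).sum := by
        rw [sumf, listMean, List.length_map, ← hW, smul_sub, smul_smul, inv_mul_cancel₀ hW0.ne',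
          one_smul]
      rw [e, norm_smul, mul_pow, norm_inv, Real.norm_of_nonneg hW0.le]
      have h1 : (W⁻¹) ^ 2 ≤ 4 / μ ^ 2 := by
        rw [inv_pow, inv_eq_one_div, div_le_div_iff₀ (by positivity) (by positivity)]
        nlinarith
      calc b * ((W⁻¹) ^ 2 * ‖(t.map f).sum‖ ^ 2) ≤ b * (4 / μ ^ 2 * (T * (z * (S / N)))) := by
            gcongr
        _ = 4 * T * N / (z * b) * S := by
            rw [hμ]; field_simp

/-! ### The scheme for ordinary k-means: results and running time -/

/-- Squared distance of a point to the nearest entry of a list; `0` for the empty list. -/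
def distSq (q : Pt d) : List (Pt d) → ℝ
  | [] => 0
  | [c] => ‖q - c‖ ^ 2
  | c :: c' :: cs => min (‖q - c‖ ^ 2) (distSq q (c' :: cs))

theorem distSq_nonneg (q : Pt d) : ∀ C : List (Pt d), 0 ≤ distSq q C
  | [] => le_rfl
  | [c] => by rw [distSq]; positivity
  | c :: c' :: cs => le_min (by positivity) (distSq_nonneg q (c' :: cs))

theorem distSq_le {q x : Pt d} : ∀ {C : List (Pt d)}, x ∈ C → distSq q C ≤ ‖q - x‖ ^ 2
  | [], h => by simp at h
  | [c], h => by rw [List.mem_singleton] at h; rw [h, distSq]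
  | c :: c' :: cs, h => by
    rcases List.mem_cons.1 h with rfl | h
    · exact min_le_left _ _
    · exact (min_le_right _ _).trans (distSq_le h)

theorem exists_distSq (q : Pt d) : ∀ {C : List (Pt d)}, C ≠ [] → ∃ x ∈ C, distSq q C = ‖q - x‖ ^ 2
  | [], h => absurd rfl h
  | [c], _ => ⟨c, by simp, rfl⟩
  | c :: c' :: cs, _ => by
    obtain ⟨x, hx, h⟩ := exists_distSq q (C := c' :: cs) (by simp)
    rcases le_total (‖q - c‖ ^ 2) (distSq q (c' :: cs)) with h' | h'
    · exact ⟨c, by simp, min_eq_left h'⟩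
    · exact ⟨x, List.mem_cons_of_mem _ hx, (min_eq_right h').trans h⟩

theorem distSq_anti {q : Pt d} {C C' : List (Pt d)} (hC : C ≠ []) (h : C ⊆ C') :
    distSq q C' ≤ distSq q C := by
  obtain ⟨x, hx, e⟩ := exists_distSq q hC
  rw [e]
  exact distSq_le (h hx)

/-- The cost of assigning the points of `Q` to their nearest centers in `C`. -/
def assignCost (Q C : List (Pt d)) : ℝ := (Q.map fun q => distSq q C).sum

theorem assignCost_append (Q R C : List (Pt d)) :
    assignCost (Q ++ R) C = assignCost Q C + assignCost R C := by
  simp [assignCost]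

theorem assignCost_perm {Q R : List (Pt d)} (h : Q.Perm R) (C : List (Pt d)) :
    assignCost Q C = assignCost R C :=
  (h.map _).sum_eq

theorem assignCost_anti {C C' : List (Pt d)} (hC : C ≠ []) (h : C ⊆ C') (Q : List (Pt d)) :
    assignCost Q C' ≤ assignCost Q C :=
  List.sum_le_sum fun _ _ => distSq_anti hC h

theorem bd_nearest (q : Pt d) : ∀ (c : Pt d) (cs : List (Pt d)),
    Bd (nearest q c cs) (fun v => v = distSq q (c :: cs)) ((cs.length + 1) * (3 * d + 1))
  | c, [] => (bd_sqDist q c).le (by simp)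
  | c, c' :: cs => by
    rw [nearest]
    refine (bd_sqDist q c).bind (T := (cs.length + 1) * (3 * d + 1) + 1) (fun x hx => ?_)
      (by simp only [List.length_cons]; ring_nf; omega)
    refine (bd_nearest q c' cs).bind (T := 1) (fun y hy => ?_) le_rfl
    exact bd_charge (by rw [hx, hy, distSq]) le_rfl

/-- A bound for the time of the final assignment of at most `N` points to at most `j` centers. -/
def assignTime (N j d : ℕ) : ℕ := N * (j * (3 * d + 1) + 1) + N + 3

theorem bd_assignAll {N j : ℕ} {Q C : List (Pt d)} (s : ℝ) (hQ : Q.length ≤ N)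
    (hC : C.length ≤ j) :
    Bd (assignAll Q C s) (fun r => (C = [] → r = none) ∧
      (C ≠ [] → r = some (C, s + assignCost Q C))) (assignTime N j d) := by
  rcases C with - | ⟨c, cs⟩
  · exact bd_charge (by simp) (by rw [assignTime]; omega)
  rw [assignAll]
  have h1 : Q.length * ((cs.length + 1) * (3 * d + 1) + 1) ≤ N * (j * (3 * d + 1) + 1) := by
    rw [List.length_cons] at hC
    gcongr
  refine (bd_mapList_eq fun q _ => bd_nearest q c cs).bind (T := N + 2) (fun D hD => ?_)
    (by rw [assignTime]; omega)
  refine (bd_sumList D).bind (T := 1) (fun v hv => ?_) (by rw [hD, List.length_map]; omega)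
  refine bd_charge ⟨by simp, fun _ => ?_⟩ le_rfl
  rw [hv, hD, assignCost]

/-- Splitting a list of points into the nearest half and the rest, by sorting. -/
theorem exists_halves (Q C : List (Pt d)) (D : List (ℝ × Pt d))
    (hD : D = (Q.map fun q => (distSq q C, q)).mergeSort fun u v => decide (u.1 ≤ v.1)) :
    ∃ H, (H ++ (D.drop ((D.length + 1) / 2)).map Prod.snd).Perm Q ∧
      H.length = (Q.length + 1) / 2 ∧
      ((D.take ((D.length + 1) / 2)).map Prod.fst).sum = assignCost H C ∧
      ∀ x ∈ H, ∀ y ∈ (D.drop ((D.length + 1) / 2)).map Prod.snd, distSq x C ≤ distSq y C := by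
  have hperm : D.Perm (Q.map fun q => (distSq q C, q)) := hD ▸ List.mergeSort_perm _ _
  have hlen : D.length = Q.length := by rw [hperm.length_eq, List.length_map]
  have hfst : ∀ u ∈ D, u.1 = distSq u.2 C := by
    intro u hu
    obtain ⟨q, -, rfl⟩ := List.mem_map.1 (hperm.mem_iff.1 hu)
    rfl
  have hsort : D.Pairwise fun u v => u.1 ≤ v.1 := by
    have := List.pairwise_mergeSort (le := fun u v : ℝ × Pt d => decide (u.1 ≤ v.1))
      (fun a b c h1 h2 => by simp only [decide_eq_true_eq] at *; exact h1.trans h2)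
      (fun a b => by simpa using le_total a.1 b.1) (Q.map fun q => (distSq q C, q))
    rw [← hD] at this
    exact this.imp fun h => by simpa using h
  set h := (D.length + 1) / 2 with hh
  refine ⟨(D.take h).map Prod.snd, ?_, ?_, ?_, ?_⟩
  · rw [← List.map_append, List.take_append_drop]
    refine (hperm.map Prod.snd).trans ?_
    rw [List.map_map]
    exact (List.map_id Q).symm ▸ List.Perm.refl _
  · rw [List.length_map, List.length_take]
    omega
  · rw [assignCost, List.map_map]
    refine congrArg _ (List.map_congr_left fun u hu => ?_)
    exact hfst u (List.mem_of_mem_take hu)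
  · intro x hx y hy
    obtain ⟨u, hu, rfl⟩ := List.mem_map.1 hx
    obtain ⟨v, hv, rfl⟩ := List.mem_map.1 hy
    rw [← hfst u (List.mem_of_mem_take hu), ← hfst v (List.mem_of_mem_drop hv)]
    rw [← List.take_append_drop h D, List.pairwise_append] at hsort
    exact hsort.2.2 u hu v hv

/-- What is certain about the result of a search for at most `m` further centers: the centers
found before are kept, and the reported cost is at least the true one. -/
def SearchResult (Q C : List (Pt d)) (s : ℝ) (m : ℕ) (r : Option (List (Pt d) × ℝ)) : Prop :=
  ∀ C' v, r = some (C', v) → C' ≠ [] ∧ C ⊆ C' ∧ C'.length ≤ C.length + m ∧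
    s + assignCost Q C' ≤ v

theorem bd_assignAll_result {N j : ℕ} {Q C : List (Pt d)} (s : ℝ) (m : ℕ) (hQ : Q.length ≤ N)
    (hC : C.length ≤ j) :
    Bd (assignAll Q C s) (SearchResult Q C s m) (assignTime N j d) := by
  refine (bd_assignAll s hQ hC).imp fun r hr => ?_
  rintro C' v rfl
  by_cases h : C = []
  · simpa using hr.1 h
  · have := hr.2 h
    simp only [Option.some.injEq, Prod.mk.injEq] at this
    obtain ⟨rfl, rfl⟩ := this
    exact ⟨h, List.Subset.refl _, by omega, le_rfl⟩

/-- A bound for the time of the common part of a stage of the search (drawing the sample and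
following up the guesses), where each follow-up takes time `T`. -/
def guessTime (k d z T : ℕ) : ℕ :=
  (2 * z + 2 + 2 ^ z * (z + 1) + 2 ^ z * ((z + 1) * d + 1)) + (2 ^ z * (k + T + 1) + 1)

/-- A bound for the time of a stage of the search without the recursive call. -/
def stageTime (N k d z T : ℕ) : ℕ :=
  guessTime k d z T + (N * (k * (3 * d + 1) + 1) + 1 + 2 * N * (Nat.clog 2 N + 1) + (N + 1) + N + 1)

/-- From fewer than `2 ^ h` points, the list is halved at most `h` times before it is empty. -/
theorem bd_halving {N m : ℕ} {z T : ℕ}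
    {next : List (Pt d) → List (Pt d) → ℝ → RT (Option (List (Pt d) × ℝ))}
    (hnext : ∀ Q C s, Q.length ≤ N → C.length + m ≤ k → Bd (next Q C s) (SearchResult Q C s m) T) :
    ∀ (fuel h : ℕ) (Q C : List (Pt d)) (s : ℝ), Q.length < 2 ^ h → Q.length ≤ N →
      C.length + (m + 1) ≤ k →
      Bd (halving z next fuel Q C s) (SearchResult Q C s (m + 1))
        (h * stageTime N k d z T + assignTime N k d)
  | 0, h, Q, C, s, _, hQ, hC => by
    rw [halving]
    exact (bd_assignAll_result (j := k) s _ hQ (by omega)).le (by omega)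
  | fuel + 1, h, [], C, s, _, hQ, hC => by
    rw [halving]
    exact (bd_assignAll_result (j := k) s _ hQ (by omega)).le (by omega)
  | fuel + 1, 0, a :: l, C, s, h0, hQ, hC => by simp at h0
  | fuel + 1, h + 1, a :: l, C, s, h0, hQ, hC => by
    rw [halving]
    set S := assignTime N k d + h * stageTime N k d z T +
      (N * (k * (3 * d + 1) + 1) + 1 + 2 * N * (Nat.clog 2 N + 1) + (N + 1) + N + 1) with hS
    have htot : (h + 1) * stageTime N k d z T + assignTime N k d = guessTime k d z T + S := by
      rw [hS, stageTime]; ring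
    rw [htot]
    refine (bd_sampleMeans z (a :: l)).bind (T := (2 ^ z * (k + T + 1) + 1) + S)
      (fun guesses hg => ?_) (by rw [guessTime]; omega)
    refine (bd_argmin (R := fun c r => SearchResult (a :: l) (C ++ [c]) s m r) (T := k + T)
      fun c _ => ?_).bind (T := S) (fun x hx => ?_) ?_
    · refine (bd_charge (P := fun C' => C' = C ++ [c]) rfl (by omega : C.length + 1 ≤ k)).bind
        (fun C' hC' => ?_) le_rfl
      subst hC'
      exact hnext _ _ _ hQ (by simp; omega)
    · have hx' : SearchResult (a :: l) C s (m + 1) x := by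
        rintro C' v rfl
        obtain ⟨c, -, hc⟩ := (hx.2 C' v rfl).1
        obtain ⟨h1, h2, h3, h4⟩ := hc C' v rfl
        refine ⟨h1, fun y hy => h2 (by simp [hy]), ?_, h4⟩
        simp at h3
        omega
      rcases C with - | ⟨c, cs⟩
      · exact (bd_pure hx')
      dsimp only
      have hcs : cs.length + 1 ≤ k := by simp at hC; omega
      have h1 : (a :: l).length * ((cs.length + 1) * (3 * d + 1) + 1) ≤
          N * (k * (3 * d + 1) + 1) := by gcongr
      refine (bd_mapList_eq (g := fun q => (distSq q (c :: cs), q))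
        (T := (cs.length + 1) * (3 * d + 1)) fun q _ => ?_).bind
        (T := 2 * N * (Nat.clog 2 N + 1) + (N + 1) + N + 1 +
          (assignTime N k d + h * stageTime N k d z T)) (fun D hD => ?_) (by omega)
      · exact (bd_nearest q c cs).bind (T := 0) (fun v hv => bd_pure (by rw [hv])) le_rfl
      have hDl : D.length ≤ N := by rw [hD, List.length_map]; exact hQ
      refine (bd_charge (P := fun u => u = (D.mergeSort fun u v => decide (u.1 ≤ v.1))) rfl
        (show _ ≤ 2 * N * (Nat.clog 2 N + 1) by gcongr)).bind
        (T := (N + 1) + N + 1 + (assignTime N k d + h * stageTime N k d z T))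
        (fun D' hD' => ?_) (by omega)
      have hDl' : D'.length = (a :: l).length := by
        rw [hD', List.length_mergeSort, hD, List.length_map]
      rw [hD] at hD'
      obtain ⟨H, hperm, hHl, hsum, -⟩ := exists_halves _ _ _ hD'
      refine (bd_sumList _).bind
        (T := N + 1 + (assignTime N k d + h * stageTime N k d z T)) (fun v hv => ?_) ?_
      · refine (bd_charge (P := fun u => u = (D'.drop ((D'.length + 1) / 2)).map Prod.snd) rfl
          (hDl'.trans_le hQ)).bind (T := 1 + (assignTime N k d + h * stageTime N k d z T))
          (fun R hR => ?_) (by omega)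
        have hRl : R.length = (a :: l).length - ((a :: l).length + 1) / 2 := by
          rw [hR, List.length_map, List.length_drop, hDl']
        refine (bd_halving hnext fuel h R (c :: cs) (s + v) ?_ ?_ hC).bind (T := 1)
          (fun y hy => ?_) (by omega)
        · rw [pow_succ] at h0
          omega
        · omega
        · refine (bd_better x y).imp fun r hr => ?_
          rcases hr.1 with rfl | rfl
          · exact hx'
          · intro C' w e
            obtain ⟨h2, h3, h4, h5⟩ := hy C' w e
            refine ⟨h2, h3, h4, ?_⟩
            rw [← assignCost_perm hperm, ← hR, assignCost_append]
            rw [hv, hsum] at h5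
            have := assignCost_anti (C := c :: cs) (by simp) h3 H
            linarith
      · rw [List.length_map, List.length_take]
        omega
    · have : guesses.length * (k + T + 1) ≤ 2 ^ z * (k + T + 1) := by gcongr
      omega

/-- A bound for the time of the search for `m` centers, where `N < 2 ^ h`. -/
def searchTime (N k d z h : ℕ) : ℕ → ℕ
  | 0 => assignTime N k d
  | m + 1 => h * stageTime N k d z (searchTime N k d z h m) + assignTime N k d

theorem bd_irredKMeans {N h z : ℕ} (hN : N < 2 ^ h) : ∀ (m : ℕ) (Q C : List (Pt d)) (s : ℝ),
    Q.length ≤ N → C.length + m ≤ k →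
    Bd (irredKMeans z m Q C s) (SearchResult Q C s m) (searchTime N k d z h m)
  | 0, Q, C, s, hQ, hC => by
    rw [irredKMeans]
    exact bd_assignAll_result s _ hQ (by omega)
  | m + 1, Q, C, s, hQ, hC => by
    rw [irredKMeans]
    exact bd_halving (bd_irredKMeans hN m) _ h Q C s (by omega) hQ hC

theorem searchTime_mono {N k d z h m m' : ℕ} (hm : m ≤ m') :
    searchTime N k d z (h + 1) m ≤ searchTime N k d z (h + 1) m' := by
  induction hm with
  | refl => rfl
  | @step m'' _ ih =>
    refine ih.trans ?_
    rw [searchTime]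
    have h1 : searchTime N k d z (h + 1) m'' ≤
        stageTime N k d z (searchTime N k d z (h + 1) m'') := by
      rw [stageTime, guessTime]
      generalize searchTime N k d z (h + 1) m'' = T
      have : 1 * (k + T + 1) ≤ 2 ^ z * (k + T + 1) := Nat.mul_le_mul_right _ Nat.one_le_two_pow
      omega
    nlinarith

theorem bd_kMeansPTAS {N h : ℕ} (ε : ℝ) (P : List (Pt d)) (hP : P.length ≤ N)
    (hN : N < 2 ^ (h + 1)) :
    Bd (kMeansPTAS k ε P) (SearchResult P [] 0 k)
      (k * (searchTime N k d ⌈64 * (k : ℝ) ^ 2 / (ε / (64 * k)) ^ 2⌉₊ (h + 1) k + 1) + 1) := by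
  rw [kMeansPTAS]
  refine (bd_argmin (R := fun i r => i < k ∧ SearchResult P [] 0 (i + 1) r)
    (T := searchTime N k d ⌈64 * (k : ℝ) ^ 2 / (ε / (64 * k)) ^ 2⌉₊ (h + 1) k) fun i hi => ?_).mono
    ?_ (by rw [List.length_range])
  · have hi' := List.mem_range.1 hi
    exact (bd_irredKMeans (k := k) hN (i + 1) P [] 0 hP (by simp; omega)).mono
      (fun r hr => ⟨hi', hr⟩) (searchTime_mono (by omega))
  · rintro r hr C v rfl
    obtain ⟨i, hi, hik, hh⟩ := (hr.2 C v rfl).1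
    obtain ⟨h1, h2, h3, h4⟩ := hh C v rfl
    exact ⟨h1, h2, by omega, h4⟩

section KMeans

/-! ### The scheme for ordinary k-means: success probability -/

/-- The sum of the squared distances to `x` in terms of the mean `τ` of the list. -/
theorem sum_norm_sub_sq (F : List (Pt d)) (τ x : Pt d) (h : (F.length : ℝ) • τ = F.sum) :
    (F.map fun q => ‖q - x‖ ^ 2).sum =
      (F.map fun q => ‖q - τ‖ ^ 2).sum + F.length * ‖x - τ‖ ^ 2 := by
  have h1 : ∀ G : List (Pt d), (G.map fun q => ‖q - x‖ ^ 2).sum =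
      (G.map fun q => ‖q - τ‖ ^ 2).sum + G.length * ‖x - τ‖ ^ 2 -
        2 * inner ℝ (G.sum - (G.length : ℝ) • τ) (x - τ) := by
    intro G
    induction G with
    | nil => simp
    | cons a G ih =>
      have e : ‖a - x‖ ^ 2 = ‖a - τ‖ ^ 2 - 2 * inner ℝ (a - τ) (x - τ) + ‖x - τ‖ ^ 2 := by
        rw [← norm_sub_sq_real]
        congr 2
        abel
      have e2 : (a :: G).sum - ((a :: G).length : ℝ) • τ =
          (a - τ) + (G.sum - (G.length : ℝ) • τ) := by
        simp [add_smul]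
        abel
      rw [List.map_cons, List.sum_cons, ih, e2, inner_add_left, e]
      simp only [List.map_cons, List.sum_cons, List.length_cons, Nat.cast_add, Nat.cast_one]
      ring
  rw [h1, h]
  simp

variable (cl : Pt d → Fin k) (o : Fin k → Pt d)

/-- The number of points in `Q` of clusters outside `J`. -/
def uncovered (J : Finset (Fin k)) (Q : List (Pt d)) : ℕ :=
  (Q.filter fun q => decide (cl q ∉ J)).length

/-- The cost of assigning to `C` the points in `Q` of clusters in `J`. -/
def coveredCost (J : Finset (Fin k)) (C Q : List (Pt d)) : ℝ :=
  (Q.map fun q => if cl q ∈ J then distSq q C else 0).sum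

/-- The cost that the remaining points `Q` will cause: the points of covered clusters, those in
`J`, are assigned to the present centers; for any other point, twice its squared distance to the
center of its cluster is set aside. -/
def potential (J : Finset (Fin k)) (C Q : List (Pt d)) : ℝ :=
  (Q.map fun q => if cl q ∈ J then distSq q C else 2 * ‖q - o (cl q)‖ ^ 2).sum

variable {cl o}

theorem uncovered_append (J : Finset (Fin k)) (Q R : List (Pt d)) :
    uncovered cl J (Q ++ R) = uncovered cl J Q + uncovered cl J R := by
  simp [uncovered]

theorem coveredCost_append (J : Finset (Fin k)) (C Q R : List (Pt d)) :
    coveredCost cl J C (Q ++ R) = coveredCost cl J C Q + coveredCost cl J C R := by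
  simp [coveredCost]

theorem potential_append (J : Finset (Fin k)) (C Q R : List (Pt d)) :
    potential cl o J C (Q ++ R) = potential cl o J C Q + potential cl o J C R := by
  simp [potential]

theorem coveredCost_nonneg (J : Finset (Fin k)) (C Q : List (Pt d)) :
    0 ≤ coveredCost cl J C Q := by
  refine List.sum_nonneg fun x hx => ?_
  obtain ⟨q, -, rfl⟩ := List.mem_map.1 hx
  split_ifs
  · exact distSq_nonneg _ _
  · exact le_rfl

theorem coveredCost_le_potential (J : Finset (Fin k)) (C Q : List (Pt d)) :
    coveredCost cl J C Q ≤ potential cl o J C Q := by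
  refine List.sum_le_sum fun q _ => ?_
  split_ifs
  · exact le_rfl
  · positivity

theorem assignCost_le_coveredCost_add (J : Finset (Fin k)) (C : List (Pt d)) (u : ℝ) :
    ∀ H : List (Pt d), (∀ q ∈ H, distSq q C ≤ u) →
      assignCost H C ≤ coveredCost cl J C H + uncovered cl J H * u
  | [], _ => by simp [assignCost, coveredCost, uncovered]
  | q :: H, h => by
    have ih := assignCost_le_coveredCost_add J C u H fun q hq => h q (by simp [hq])
    have hq := h q (by simp)
    rw [assignCost, coveredCost, uncovered] at *
    by_cases hJ : cl q ∈ J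
    · simp [hJ]
      simpa [add_assoc] using ih
    · simp [hJ]
      simp at ih
      linarith

theorem le_coveredCost (J : Finset (Fin k)) (C : List (Pt d)) (u : ℝ) :
    ∀ H : List (Pt d), (∀ q ∈ H, u ≤ distSq q C) →
      (H.length - uncovered cl J H) * u ≤ coveredCost cl J C H
  | [], _ => by simp [coveredCost, uncovered]
  | q :: H, h => by
    have ih := le_coveredCost J C u H fun q hq => h q (by simp [hq])
    have hq := h q (by simp)
    rw [coveredCost, uncovered] at *
    by_cases hJ : cl q ∈ J
    · simp [hJ]
      simp at ih
      linarith
    · simp [hJ]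
      simpa using ih

/-- Some cluster outside `J` has at least the average number of points. -/
theorem exists_large_cluster (J : Finset (Fin k)) (Q : List (Pt d)) (hJ : 0 < uncovered cl J Q) :
    ∃ j ∉ J, uncovered cl J Q ≤ k * (Q.filter fun q => decide (cl q = j)).length := by
  have h1 : ∀ Q : List (Pt d), uncovered cl J Q =
      ∑ j ∈ Jᶜ, (Q.filter fun q => decide (cl q = j)).length := by
    intro Q
    induction Q with
    | nil => simp [uncovered]
    | cons q Q ih =>
      have e : ∀ j, ((q :: Q).filter fun q => decide (cl q = j)).length =
          (Q.filter fun q => decide (cl q = j)).length + if cl q = j then 1 else 0 := by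
        intro j
        by_cases h : cl q = j <;> simp [h]
      simp only [e, Finset.sum_add_distrib, ← ih, Finset.sum_ite_eq]
      by_cases h : cl q ∈ J <;> simp [uncovered, h]
  by_contra! hc
  have hne : (Jᶜ : Finset (Fin k)).Nonempty := by
    rw [Finset.nonempty_iff_ne_empty]
    intro h
    rw [h1, h] at hJ
    simp at hJ
  have h2 : ∑ j ∈ Jᶜ, k * (Q.filter fun q => decide (cl q = j)).length <
      ∑ _j ∈ (Jᶜ : Finset (Fin k)), uncovered cl J Q :=
    Finset.sum_lt_sum_of_nonempty hne fun j hj => hc j (by simpa using hj)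
  rw [← Finset.mul_sum, ← h1, Finset.sum_const, smul_eq_mul] at h2
  have h3 : (Jᶜ : Finset (Fin k)).card ≤ k := by simpa using Finset.card_le_univ (Jᶜ)
  exact absurd h2 (not_lt.2 (Nat.mul_le_mul_right _ h3))

/-- A center of at most twice the cost for the remaining points of a cluster covers it without
increasing the potential. -/
theorem potential_insert_le {J : Finset (Fin k)} {C Q : List (Pt d)} {j : Fin k} {π : Pt d}
    (hj : j ∉ J) (hC : C = [] → J = ∅)
    (hπ : ((Q.filter fun q => decide (cl q = j)).map fun q => ‖q - π‖ ^ 2).sum ≤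
      2 * ((Q.filter fun q => decide (cl q = j)).map fun q => ‖q - o j‖ ^ 2).sum) :
    potential cl o (insert j J) (C ++ [π]) Q ≤ potential cl o J C Q := by
  have h : ∀ Q : List (Pt d), potential cl o (insert j J) (C ++ [π]) Q ≤ potential cl o J C Q +
      ((Q.filter fun q => decide (cl q = j)).map fun q => ‖q - π‖ ^ 2).sum -
      2 * ((Q.filter fun q => decide (cl q = j)).map fun q => ‖q - o j‖ ^ 2).sum := by
    intro Q
    induction Q with
    | nil => simp [potential]
    | cons q Q ih =>
      rw [potential, potential, List.map_cons, List.sum_cons, List.map_cons, List.sum_cons]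
      rw [potential, potential] at ih
      simp only [Finset.mem_insert] at ih
      by_cases hq : cl q = j
      · have : distSq q (C ++ [π]) ≤ ‖q - π‖ ^ 2 := distSq_le (by simp)
        simp [hq, hj]
        linarith
      · by_cases hqJ : cl q ∈ J
        · have hne : C ≠ [] := fun h => by simp [hC h] at hqJ
          have : distSq q (C ++ [π]) ≤ distSq q C := distSq_anti hne (by simp)
          simp [hq, hqJ]
          linarith
        · simp [hq, hqJ]
          linarith
  have := h Q
  linarith

/-- The random step: from a list in which a cluster `j` makes up a good part, some sampled mean is
a center for the points of this cluster with at most twice the cost of any other. -/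
theorem le_prob_good_guess (a : Pt d) (l : List (Pt d)) (j : Fin k) {z : ℕ} (hk : 0 < k)
    (hz : 288 * k ^ 3 ≤ z)
    (hj : 0 < ((a :: l).filter fun q => decide (cl q = j)).length)
    (hlarge : (l.length + 1) ≤
      9 * k ^ 2 * ((a :: l).filter fun q => decide (cl q = j)).length) :
    1 - ENNReal.ofReal (1 / (4 * k)) ≤ (sampleMeans z (a :: l)).prob (fun ms => ∃ π ∈ ms,
      (((a :: l).filter fun q => decide (cl q = j)).map fun q => ‖q - π‖ ^ 2).sum ≤
      2 * (((a :: l).filter fun q => decide (cl q = j)).map fun q => ‖q - o j‖ ^ 2).sum) := by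
  set F := (a :: l).filter fun q => decide (cl q = j) with hF
  set τ : Pt d := (F.length : ℝ)⁻¹ • F.sum with hτ
  have hb : (0 : ℝ) < F.length := by exact_mod_cast hj
  have hτ' : (F.length : ℝ) • τ = F.sum := by
    rw [hτ, smul_smul, mul_inv_cancel₀ hb.ne', one_smul]
  have hk' : (0 : ℝ) < k := by exact_mod_cast hk
  have hzr : (288 * k ^ 3 : ℝ) ≤ z := by exact_mod_cast hz
  have hz0 : (0 : ℝ) < z := lt_of_lt_of_le (by positivity) hzr
  have hlr : ((l.length + 1 : ℕ) : ℝ) ≤ 9 * k ^ 2 * F.length := by exact_mod_cast hlarge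
  have h := le_prob_sampleMeans id a l (fun q => decide (cl q = j)) z (by exact_mod_cast hz0)
    (T := 8 * k) (by positivity) τ (F.map fun q => ‖q - τ‖ ^ 2).sum F.length hb rfl
    (by rw [List.map_id]; exact hτ') rfl
  rw [List.map_id, id] at h
  refine (tsub_le_tsub_left (ENNReal.ofReal_le_ofReal ?_) 1).trans (h.trans (prob_mono ?_))
  · have h1 : 4 * ((l.length + 1 : ℕ) : ℝ) / (z * F.length) ≤ 1 / (8 * k) := by
      rw [div_le_div_iff₀ (by positivity) (by positivity)]
      nlinarith [mul_le_mul_of_nonneg_right hzr hb.le]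
    have h2 : (1 : ℝ) / (4 * k) = 1 / (8 * k) + 1 / (8 * k) := by field_simp; norm_num
    linarith
  · rintro ms ⟨π, hπ, hle⟩
    refine ⟨π, hπ, ?_⟩
    have h0 : 0 ≤ (F.map fun q => ‖q - τ‖ ^ 2).sum := by
      refine List.sum_nonneg fun x hx => ?_
      obtain ⟨q, -, rfl⟩ := List.mem_map.1 hx
      positivity
    have h1 : 4 * (8 * (k : ℝ)) * ((l.length + 1 : ℕ) : ℝ) / (z * F.length) ≤ 1 := by
      rw [div_le_one (by positivity)]
      nlinarith [mul_le_mul_of_nonneg_right hzr hb.le]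
    have h2 := mul_le_mul_of_nonneg_right h1 h0
    rw [sum_norm_sub_sq F τ π hτ', sum_norm_sub_sq F τ (o j) hτ']
    have h3 : 0 ≤ (F.length : ℝ) * ‖o j - τ‖ ^ 2 := by positivity
    linarith

/-- The bookkeeping for a step that assigns the nearest half `H` of the points, when a fraction
less than `γ` of them is uncovered. The uncovered points of `H` are paid for later, by the points
of `R` of covered clusters, which are all farther from the centers: to this end, the bound `u` for
the distances is carried along with a credit `3 γ u` per remaining point. -/
theorem halving_step_bound {J : Finset (Fin k)} {C Q H R : List (Pt d)} {γ A s u : ℝ}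
    (hperm : (H ++ R).Perm Q) (hHl : H.length = (Q.length + 1) / 2) (hQ : Q ≠ [])
    (hHR : ∀ x ∈ H, ∀ y ∈ R, distSq x C ≤ distSq y C) (hγ0 : 0 < γ) (hγ : γ ≤ 1 / 18)
    (hA : 1 ≤ A) (hu : 0 ≤ u) (hQu : ∀ q ∈ Q, u ≤ distSq q C)
    (hX : uncovered cl J Q < γ * Q.length) :
    ∃ u', 0 ≤ u' ∧ (∀ q ∈ R, u' ≤ distSq q C) ∧
      (uncovered cl J R : ℝ) ≤ 3 * γ * R.length ∧
      (s + assignCost H C) + A * potential cl o J C R + 9 * γ * coveredCost cl J C R -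
        3 * γ * R.length * u' ≤
      s + A * potential cl o J C Q + 9 * γ * coveredCost cl J C Q - 3 * γ * Q.length * u := by
  have hHne : H ≠ [] := by
    rintro rfl
    have := List.length_pos_iff.2 hQ
    simp at hHl
    omega
  have hlen : H.length + R.length = Q.length := by
    rw [← hperm.length_eq, List.length_append]
  have hXsum : uncovered cl J H + uncovered cl J R = uncovered cl J Q := by
    rw [← uncovered_append]
    exact (hperm.filter _).length_eq
  have hDsum : coveredCost cl J C Q = coveredCost cl J C H + coveredCost cl J C R := by
    rw [← coveredCost_append]
    exact (hperm.map _).sum_eq.symm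
  have hPsum : potential cl o J C Q = potential cl o J C H + potential cl o J C R := by
    rw [← potential_append]
    exact (hperm.map _).sum_eq.symm
  obtain ⟨x, hx, hmax⟩ : ∃ x ∈ H, ∀ y ∈ H, distSq y C ≤ distSq x C := by
    obtain ⟨x, hx, h⟩ := H.toFinset.exists_max_image (fun q => distSq q C)
      (by simpa using hHne)
    exact ⟨x, by simpa using hx, fun y hy => h y (by simpa using hy)⟩
  -- only a single point is left in the second case, and it is covered since `γ ≤ 1`
  have hXR : (uncovered cl J Q : ℝ) ≤ 3 * γ * R.length := by
    by_cases h2 : 2 ≤ Q.length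
    · have : Q.length ≤ 3 * R.length := by omega
      have : (Q.length : ℝ) ≤ 3 * R.length := by exact_mod_cast this
      nlinarith
    · have h1 : Q.length = 1 := by
        have := List.length_pos_iff.2 hQ
        omega
      rw [h1] at hX
      have : (uncovered cl J Q : ℝ) < 1 := by push_cast at hX; linarith
      have : uncovered cl J Q < 1 := by exact_mod_cast this
      have : uncovered cl J Q = 0 := by omega
      rw [this, Nat.cast_zero]
      positivity
  have hu' := distSq_nonneg x C
  have hXRr : (uncovered cl J R : ℝ) ≤ uncovered cl J Q := by
    exact_mod_cast (by omega : uncovered cl J R ≤ uncovered cl J Q)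
  have hXHr : (uncovered cl J H : ℝ) ≤ uncovered cl J Q := by
    exact_mod_cast (by omega : uncovered cl J H ≤ uncovered cl J Q)
  refine ⟨distSq x C, hu', fun q hq => hHR x hx q hq, hXRr.trans hXR, ?_⟩
  have h1 := assignCost_le_coveredCost_add (cl := cl) J C _ H hmax
  have h2 : (uncovered cl J H : ℝ) * distSq x C ≤ 3 * γ * R.length * distSq x C := by
    gcongr
    exact hXHr.trans hXR
  have h3 := le_coveredCost (cl := cl) J C u H fun q hq =>
    hQu q (hperm.mem_iff.1 (List.mem_append_left _ hq))
  have h4 : (Q.length : ℝ) ≤ 2 * H.length := by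
    exact_mod_cast (by omega : Q.length ≤ 2 * H.length)
  have h5 : (Q.length : ℝ) / 3 * u ≤ (H.length - uncovered cl J H) * u := by
    gcongr
    nlinarith
  have h6 := coveredCost_le_potential (cl := cl) (o := o) J C H
  have h7 : coveredCost cl J C H ≤ A * potential cl o J C H := by
    have := coveredCost_nonneg (cl := cl) J C H
    nlinarith
  rw [hDsum, hPsum]
  nlinarith

variable (cl o) in
/-- The search for `m` more centers succeeds: with probability at least `p ^ m`, it returns a cost
that exceeds the cost `s` of the points assigned before by at most `1 + m / k` times the
potential. -/
def SearchSucceeds (m : ℕ) (p : ENNReal)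
    (search : List (Pt d) → List (Pt d) → ℝ → RT (Option (List (Pt d) × ℝ))) : Prop :=
  ∀ (Q C : List (Pt d)) (s : ℝ) (J : Finset (Fin k)), k ≤ J.card + m → (C = [] → J = ∅) →
    (C ≠ [] ∨ Q ≠ []) →
    p ^ m ≤ (search Q C s).prob (fun r => ∃ C' v, r = some (C', v) ∧
      v ≤ s + (1 + m / k) * potential cl o J C Q)

/-- Besides the bound wanted, the induction over the halvings carries the credit described at
`halving_step_bound`; the credit is void as long as nothing has been charged, with `u = 0`. -/
theorem searchSucceeds_halving {m z : ℕ} (hk : 2 ≤ k) (hz : 288 * k ^ 3 ≤ z)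
    {next : List (Pt d) → List (Pt d) → ℝ → RT (Option (List (Pt d) × ℝ))}
    (hnext : SearchSucceeds cl o m (1 - ENNReal.ofReal (1 / (4 * k))) next) :
    ∀ (fuel : ℕ) (Q C : List (Pt d)) (s u : ℝ) (J : Finset (Fin k)), Q.length ≤ fuel →
      k ≤ J.card + (m + 1) → (C = [] → J = ∅) → (C ≠ [] ∨ Q ≠ []) → 0 ≤ u →
      (∀ q ∈ Q, u ≤ distSq q C) →
      (u = 0 ∨ (uncovered cl J Q : ℝ) ≤ 3 * (1 / (9 * k)) * Q.length) →
      (1 - ENNReal.ofReal (1 / (4 * k))) ^ (m + 1) ≤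
        (halving z next fuel Q C s).prob (fun r => ∃ C' v, r = some (C', v) ∧
          v ≤ s + (1 + m / k) * potential cl o J C Q +
            9 * (1 / (9 * k)) * coveredCost cl J C Q - 3 * (1 / (9 * k)) * Q.length * u) := by
  set p : ENNReal := 1 - ENNReal.ofReal (1 / (4 * k)) with hp
  have hp1 : p ≤ 1 := tsub_le_self
  have hk0 : (0 : ℝ) < k := by exact_mod_cast (by omega : 0 < k)
  have hk2 : (2 : ℝ) ≤ k := by exact_mod_cast hk
  set γ : ℝ := 1 / (9 * k) with hγ
  have hγ0 : 0 < γ := by positivity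
  have hγ18 : γ ≤ 1 / 18 := by
    rw [hγ]
    exact one_div_le_one_div_of_le (by norm_num) (by linarith)
  set A : ℝ := 1 + m / k with hA
  have hA1 : 1 ≤ A := by rw [hA]; linarith [show (0 : ℝ) ≤ m / k by positivity]
  have hnil : ∀ (C : List (Pt d)) (s u : ℝ) (J : Finset (Fin k)), C ≠ [] →
      p ^ (m + 1) ≤ (assignAll [] C s).prob (fun r => ∃ C' v, r = some (C', v) ∧
          v ≤ s + A * potential cl o J C [] +
            9 * γ * coveredCost cl J C [] - 3 * γ * ([] : List (Pt d)).length * u) := by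
    intro C s u J hC
    refine ((bd_assignAll (N := 0) s (by simp) le_rfl).imp fun r hr => ?_).le_prob
      (pow_le_one₀ zero_le hp1)
    exact ⟨C, _, hr.2 hC, by simp [potential, coveredCost, assignCost]⟩
  intro fuel
  induction fuel with
  | zero =>
    intro Q C s u J hQ _ _ hne _ _ _
    have : Q = [] := List.length_eq_zero_iff.1 (by omega)
    subst this
    rw [halving]
    exact hnil C s u J (by simpa using hne)
  | succ fuel ih =>
    intro Q C s u J hQ hJ hCJ hne hu hQu hX
    rcases Q with - | ⟨a, l⟩
    · rw [halving]
      exact hnil C s u J (by simpa using hne)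
    rw [halving]
    have hl0 : (0 : ℝ) < (a :: l).length := by
      rw [List.length_cons]; positivity
    by_cases hdense : γ * (a :: l).length ≤ uncovered cl J (a :: l)
    · -- a good part of the remaining points is uncovered: guess a center
      have hX0 : 0 < uncovered cl J (a :: l) := by
        have : (0 : ℝ) < uncovered cl J (a :: l) := lt_of_lt_of_le (by positivity) hdense
        exact_mod_cast this
      obtain ⟨j, hjJ, hj⟩ := exists_large_cluster J (a :: l) hX0
      have hj0 : 0 < ((a :: l).filter fun q => decide (cl q = j)).length := by
        by_contra h
        simp only [not_lt, Nat.le_zero] at h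
        rw [h] at hj
        omega
      have hlarge : l.length + 1 ≤
          9 * k ^ 2 * ((a :: l).filter fun q => decide (cl q = j)).length := by
        have h1 : ((uncovered cl J (a :: l) : ℕ) : ℝ) ≤
          k * ((a :: l).filter fun q => decide (cl q = j)).length := by exact_mod_cast hj
        have h2 := hdense.trans h1
        rw [hγ, div_mul_eq_mul_div, one_mul, div_le_iff₀ (by positivity)] at h2
        have h3 : ((l.length + 1 : ℕ) : ℝ) ≤
          ((9 * k ^ 2 * ((a :: l).filter fun q => decide (cl q = j)).length : ℕ) : ℝ) := by
          push_cast at h2 ⊢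
          rw [List.length_cons] at h2
          push_cast at h2
          linarith
        exact_mod_cast h3
      rw [pow_succ, mul_comm]
      refine le_prob_bind (le_prob_good_guess (o := o) a l j (by omega) hz hj0 hlarge) ?_
      rintro guesses ⟨π, hπ, hle⟩
      have hpot : potential cl o (insert j J) (C ++ [π]) (a :: l) ≤ potential cl o J C (a :: l) :=
        potential_insert_le hjJ hCJ hle
      have hcredit : 3 * γ * (a :: l).length * u ≤ 9 * γ * coveredCost cl J C (a :: l) := by
        rcases hX with rfl | hX
        · have := coveredCost_nonneg (cl := cl) J C (a :: l)
          rw [mul_zero]; positivity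
        · have h1 := le_coveredCost (cl := cl) J C u (a :: l) hQu
          have h2 : ((a :: l).length : ℝ) / 3 * u ≤
              ((a :: l).length - uncovered cl J (a :: l)) * u := by
            gcongr
            nlinarith
          nlinarith
      rw [← mul_one (p ^ m)]
      refine le_prob_bind (le_prob_argmin (t := s + A * potential cl o J C (a :: l) +
        9 * γ * coveredCost cl J C (a :: l) - 3 * γ * (a :: l).length * u) hπ ?_) fun x hx => ?_
      · refine (bd_charge (P := fun C' => C' = C ++ [π]) rfl le_rfl).le_prob_bind fun C' hC' => ?_
        subst hC'
        refine (hnext (a :: l) (C ++ [π]) s (insert j J) ?_ (by simp) (by simp)).trans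
          (prob_mono ?_)
        · rw [Finset.card_insert_of_notMem hjJ]
          omega
        · rintro r ⟨C', v, rfl, hv⟩
          have := mul_le_mul_of_nonneg_left hpot (by linarith : 0 ≤ A)
          exact ⟨C', v, rfl, by linarith⟩
      · rcases C with - | ⟨c, cs⟩
        · refine (Bd.prob_eq_one (T := 0) ?_).ge
          exact bd_pure hx
        · refine le_prob_bind_of_forall fun D => le_prob_bind_of_forall fun D' =>
            le_prob_bind_of_forall fun v => le_prob_bind_of_forall fun R =>
            le_prob_bind_of_forall fun y => ?_
          exact (bd_better_le (Or.inl hx)).prob_eq_one.ge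
    · -- nearly all remaining points are covered: assign the nearest half
      rw [not_le] at hdense
      rcases C with - | ⟨c, cs⟩
      · have hJ0 := hCJ rfl
        have : uncovered cl J (a :: l) = (a :: l).length := by simp [uncovered, hJ0]
        rw [this] at hdense
        nlinarith
      refine le_prob_bind_of_forall fun guesses => le_prob_bind_of_forall fun x => ?_
      refine (bd_mapList_eq (g := fun q => (distSq q (c :: cs), q))
        (T := (cs.length + 1) * (3 * d + 1)) fun q _ => ?_).le_prob_bind fun D hD => ?_
      · exact (bd_nearest q c cs).bind (T := 0) (fun v hv => bd_pure (by rw [hv])) le_rfl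
      refine (bd_charge (P := fun u => u = (D.mergeSort fun u v => decide (u.1 ≤ v.1))) rfl
        le_rfl).le_prob_bind fun D' hD' => ?_
      rw [hD] at hD'
      obtain ⟨H, hperm, hHl, hsum, hHR⟩ := exists_halves _ _ _ hD'
      refine (bd_sumList _).le_prob_bind fun v hv => ?_
      refine (bd_charge (P := fun u => u = (D'.drop ((D'.length + 1) / 2)).map Prod.snd) rfl
        le_rfl).le_prob_bind fun R hR => ?_
      rw [← hR] at hperm hHR
      have hRl : H.length + R.length = (a :: l).length := by
        rw [← hperm.length_eq, List.length_append]
      obtain ⟨u', hu'0, hu'R, hXR, hbound⟩ := halving_step_bound (o := o) (s := s) hperm hHl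
        (by simp) hHR hγ0 hγ18 hA1 hu hQu hdense
      have hRfuel : R.length ≤ fuel := by
        simp only [List.length_cons] at hQ hHl hRl
        omega
      refine le_prob_bind_bd (ih R (c :: cs) (s + v) u' J hRfuel hJ hCJ (by simp) hu'0 hu'R
        (Or.inr hXR)) fun y hy => (bd_better_le (Or.inr ?_))
      obtain ⟨C', w, rfl, hw⟩ := hy
      refine ⟨C', w, rfl, hw.trans ?_⟩
      rw [hv, hsum]
      exact hbound

theorem searchSucceeds_irredKMeans {z : ℕ} (hk : 2 ≤ k) (hz : 288 * k ^ 3 ≤ z) :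
    ∀ m, SearchSucceeds cl o m (1 - ENNReal.ofReal (1 / (4 * k))) (irredKMeans z m)
  | 0 => by
    intro Q C s J hJ hCJ hne
    have hJ' : J = Finset.univ := by
      rw [← Finset.card_eq_iff_eq_univ]
      exact le_antisymm (Finset.card_le_univ _) (by simpa using hJ)
    have hC : C ≠ [] := by
      intro h
      have := hCJ h
      rw [this] at hJ
      simp at hJ
      omega
    rw [irredKMeans]
    refine ((bd_assignAll s le_rfl le_rfl).imp fun r hr => ?_).le_prob (by simp)
    refine ⟨C, _, hr.2 hC, ?_⟩
    rw [potential, assignCost, hJ']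
    simp
  | m + 1 => by
    intro Q C s J hJ hCJ hne
    have hk0 : (0 : ℝ) < k := by exact_mod_cast (by omega : 0 < k)
    rw [irredKMeans]
    refine (searchSucceeds_halving hk hz (searchSucceeds_irredKMeans hk hz m) _ Q C s 0 J le_rfl hJ
      hCJ hne le_rfl (fun q _ => distSq_nonneg _ _) (Or.inl rfl)).trans (prob_mono ?_)
    rintro r ⟨C', v, rfl, hv⟩
    refine ⟨C', v, rfl, hv.trans ?_⟩
    have h1 := coveredCost_le_potential (cl := cl) (o := o) J C Q
    have h2 : 9 * (1 / (9 * (k : ℝ))) = 1 / k := by field_simp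
    have h3 : (1 : ℝ) / k * coveredCost cl J C Q ≤ 1 / k * potential cl o J C Q := by gcongr
    rw [h2]
    push_cast
    rw [add_div]
    linarith

/-- For any `k` centers `o`, the scheme returns with good probability a set of centers with at
most four times the cost of `o`. -/
theorem le_prob_kMeansPTAS (hk : 2 ≤ k) {ε : ℝ} (hε : 0 < ε) (hε1 : ε ≤ 1) (P : List (Pt d))
    (hP : P ≠ []) (cl : Pt d → Fin k) (o : Fin k → Pt d) :
    (1 - ENNReal.ofReal (1 / (4 * k))) ^ k ≤ (kMeansPTAS k ε P).prob
      (fun r => ∃ C v, r = some (C, v) ∧ v ≤ 4 * (P.map fun q => ‖q - o (cl q)‖ ^ 2).sum) := by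
  have hk0 : (0 : ℝ) < k := by exact_mod_cast (by omega : 0 < k)
  have hz : 288 * k ^ 3 ≤ ⌈64 * (k : ℝ) ^ 2 / (ε / (64 * k)) ^ 2⌉₊ := by
    have : ((288 * k ^ 3 : ℕ) : ℝ) ≤ (⌈64 * (k : ℝ) ^ 2 / (ε / (64 * k)) ^ 2⌉₊ : ℝ) := by
      refine le_trans ?_ (Nat.le_ceil _)
      rw [div_pow, div_div_eq_mul_div, le_div_iff₀ (by positivity)]
      push_cast
      have h1 : (1 : ℝ) ≤ k := by exact_mod_cast (by omega : 1 ≤ k)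
      have h2 : ε ^ 2 ≤ 1 := pow_le_one₀ hε.le hε1
      calc 288 * (k : ℝ) ^ 3 * ε ^ 2 ≤ 288 * (k : ℝ) ^ 3 * 1 := by gcongr
        _ ≤ 288 * (k : ℝ) ^ 3 * k := by gcongr
        _ ≤ 64 * (k : ℝ) ^ 2 * (64 * k) ^ 2 := by nlinarith [pow_pos hk0 4]
    exact_mod_cast this
  rw [kMeansPTAS]
  refine le_prob_argmin (a := k - 1) (by simp; omega) ?_
  have : k - 1 + 1 = k := by omega
  rw [this]
  refine (searchSucceeds_irredKMeans (cl := cl) (o := o) hk hz k P [] 0 ∅ (by simp) (by simp)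
    (Or.inr hP)).trans (prob_mono ?_)
  rintro r ⟨C, v, rfl, hv⟩
  refine ⟨C, v, rfl, hv.trans (le_of_eq ?_)⟩
  rw [div_self hk0.ne', potential]
  simp only [Finset.notMem_empty, if_false]
  rw [List.sum_map_mul_left]
  ring

end KMeans

/-! ### The bipartite matching procedure and the initial bound -/

/-- The total squared distance of the points to the centers `m` assigned to them by `U`. -/
def totalCost (G : ChromaticInstance n k d) (m : Fin k → Pt d) (U : ChromaticPartition G) : ℝ :=
  ∑ i, ∑ a, ‖G.pt i a - m (U i a)‖ ^ 2

theorem totalCost_eq_sum_sigma (G : ChromaticInstance n k d) (m : Fin k → Pt d)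
    (U : ChromaticPartition G) :
    totalCost G m U = ∑ x : (i : Fin n) × Fin (G.size i), ‖G.pt x.1 x.2 - m (U x.1 x.2)‖ ^ 2 := by
  rw [totalCost, Fintype.sum_sigma]

theorem totalCost_eq_sum_cell (G : ChromaticInstance n k d) (m : Fin k → Pt d)
    (U : ChromaticPartition G) :
    totalCost G m U = ∑ j, ∑ x ∈ U.cell j, ‖G.pt x.1 x.2 - m j‖ ^ 2 := by
  rw [totalCost_eq_sum_sigma, ← Finset.sum_fiberwise _ fun x => U x.1 x.2]
  refine Finset.sum_congr rfl fun j _ => Finset.sum_congr rfl fun x hx => ?_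
  rw [(Finset.mem_filter.1 hx).2]

theorem Solution.objective_eq {G : ChromaticInstance n k d} (s : Solution G) :
    s.objective = 1 / n * totalCost G s.center s.part := by
  rw [Solution.objective, totalCost_eq_sum_cell]

/-- All points of an instance, as indices. -/
def ChromaticInstance.indices (G : ChromaticInstance n k d) : List ((i : Fin n) × Fin (G.size i)) :=
  (List.ofFn fun i => List.ofFn fun a => (⟨i, a⟩ : (i : Fin n) × Fin (G.size i))).flatten

theorem ChromaticInstance.map_indices (G : ChromaticInstance n k d) :
    G.indices.map (fun x => G.pt x.1 x.2) = G.points := by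
  rw [indices, points, List.map_flatten, List.map_ofFn]
  congr 2
  funext i
  exact List.map_ofFn ..

theorem ChromaticInstance.sum_map_indices {M : Type*} [AddCommMonoid M]
    (G : ChromaticInstance n k d) (f : (i : Fin n) × Fin (G.size i) → M) :
    (G.indices.map f).sum = ∑ x, f x := by
  rw [indices, List.map_flatten, List.sum_flatten, List.map_ofFn, List.map_ofFn, List.sum_ofFn,
    Fintype.sum_sigma]
  refine Finset.sum_congr rfl fun i _ => ?_
  rw [Function.comp, Function.comp, List.map_ofFn, List.sum_ofFn]
  rfl

theorem ChromaticInstance.sum_map_filter_indices {M : Type*} [AddCommMonoid M]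
    (G : ChromaticInstance n k d) (p : (i : Fin n) × Fin (G.size i) → Bool)
    (f : (i : Fin n) × Fin (G.size i) → M) :
    ((G.indices.filter p).map f).sum = ∑ x with p x, f x := by
  rw [Finset.sum_filter, ← G.sum_map_indices]
  generalize G.indices = L
  induction L with
  | nil => rfl
  | cons x L ih => by_cases h : p x <;> simp [h, ih]

theorem ChromaticInstance.length_filter_indices (G : ChromaticInstance n k d)
    (p : (i : Fin n) × Fin (G.size i) → Bool) :
    (G.indices.filter p).length = (Finset.univ.filter fun x => p x = true).card := by
  have h := G.sum_map_filter_indices p fun _ => 1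
  simpa using h

theorem ChromaticInstance.length_points (G : ChromaticInstance n k d) :
    G.points.length = Fintype.card ((i : Fin n) × Fin (G.size i)) := by
  have h := G.sum_map_indices fun _ => 1
  rw [← G.map_indices]
  simpa using h

theorem ChromaticInstance.length_points_le (G : ChromaticInstance n k d) :
    G.points.length ≤ k * n := by
  rw [length_points, Fintype.card_sigma]
  simp only [Fintype.card_fin]
  calc ∑ i, G.size i ≤ ∑ _i : Fin n, k := Finset.sum_le_sum fun i _ => G.size_le i
    _ = k * n := by simp [mul_comm]

theorem ChromaticInstance.sum_map_points (G : ChromaticInstance n k d) (f : Pt d → ℝ) :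
    (G.points.map f).sum = ∑ i, ∑ a, f (G.pt i a) := by
  rw [← G.map_indices, List.map_map, G.sum_map_indices, Fintype.sum_sigma]
  rfl

/-- A bound for the time of matching one point-set. -/
def matchTime (k d : ℕ) : ℕ :=
  k * (k * (3 * d + 1) + 2) + 1 + (k ^ k * (k + 1) + (k ^ k * (k + 2) + 1))

theorem card_embedding_le {s k : ℕ} (h : s ≤ k) : Fintype.card (Fin s ↪ Fin k) ≤ k ^ k := by
  rw [Fintype.card_embedding_eq, Fintype.card_fin, Fintype.card_fin]
  refine (Nat.descFactorial_le_pow k s).trans ?_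
  rcases Nat.eq_zero_or_pos k with rfl | hk
  · simp [Nat.le_zero.1 h]
  · exact Nat.pow_le_pow_right hk h

theorem bd_matchSet (G : ChromaticInstance n k d) (m : Fin k → Pt d) (i : Fin n) :
    Bd (matchSet G m i) (fun r => r.2 = ∑ a, ‖G.pt i a - m (r.1 a)‖ ^ 2 ∧
      ∀ e : Fin (G.size i) ↪ Fin k, r.2 ≤ ∑ a, ‖G.pt i a - m (e a)‖ ^ 2) (matchTime k d) := by
  have hs := G.size_le i
  rw [matchSet]
  refine (bd_tabulate (R := fun a (w : Fin k → ℝ) => ∀ j, w j = ‖G.pt i a - m j‖ ^ 2)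
    (T := k * (3 * d + 1) + 1) fun a => ?_).bind
    (T := k ^ k * (k + 1) + (k ^ k * (k + 2) + 1)) (fun w hw => ?_) ?_
  · exact bd_tabulate fun j => bd_sqDist _ _
  · have hcard : (Finset.univ : Finset (Fin (G.size i) ↪ Fin k)).toList.length ≤ k ^ k := by
      rw [Finset.length_toList]
      exact card_embedding_le hs
    refine (bd_charge (P := fun l => l = (Finset.univ : Finset (Fin (G.size i) ↪ Fin k)).toList)
      rfl (show _ ≤ k ^ k * (k + 1) by gcongr)).bind (T := k ^ k * (k + 2) + 1)
      (fun l hl => ?_) le_rfl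
    refine (bd_argmin (R := fun e r => r = some (e, ∑ a, ‖G.pt i a - m (e a)‖ ^ 2))
      (T := k + 1) fun e _ => ?_).bind (T := 0) (fun r hr => ?_) ?_
    · refine (bd_sumList _).bind (T := 0) (fun v hv => bd_pure ?_)
        (by rw [List.length_ofFn]; omega)
      rw [hv, List.sum_ofFn]
      simp only [hw]
    · refine bd_pure ?_
      rcases r with - | ⟨e, v⟩
      · have : Fin.castLEEmb hs ∈ l := by simp [hl]
        simpa using hr.1 rfl _ this
      · obtain ⟨⟨e', -, he'⟩, hmin⟩ := hr.2 e v rfl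
        simp only [Option.some.injEq, Prod.mk.injEq] at he'
        obtain ⟨rfl, rfl⟩ := he'
        refine ⟨rfl, fun e' => ?_⟩
        obtain ⟨r, rfl, hr'⟩ := hmin e' (by simp [hl])
        exact hr' _ _ rfl
    · rw [hl, add_zero]
      gcongr
  · have : G.size i * (k * (3 * d + 1) + 1 + 1) ≤ k * (k * (3 * d + 1) + 2) := by gcongr
    rw [matchTime]
    omega

/-- A bound for the time of the bipartite matching procedure. -/
def bipartiteTime (n k d : ℕ) : ℕ := n * (matchTime k d + 1) + 1 + (n + 1)

theorem bd_bipartiteMatching (G : ChromaticInstance n k d) (m : Fin k → Pt d) :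
    Bd (bipartiteMatching G m) (fun r => r.2 = totalCost G m r.1 ∧
      ∀ U : ChromaticPartition G, r.2 ≤ totalCost G m U) (bipartiteTime n k d) := by
  rw [bipartiteMatching]
  refine (bd_tabulate fun i => bd_matchSet G m i).bind (T := n + 1) (fun r hr => ?_) le_rfl
  refine (bd_sumList _).bind (T := 0) (fun v hv => bd_pure ?_) (by rw [List.length_ofFn])
  rw [hv, List.sum_ofFn]
  refine ⟨?_, fun U => ?_⟩
  · dsimp only [totalCost]
    refine Finset.sum_congr rfl fun i _ => ?_
    exact (hr i).1
  · dsimp only [totalCost]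
    refine Finset.sum_le_sum fun i _ => ?_
    exact (hr i).2 (U i)

theorem bd_bestTuple (G : ChromaticInstance n k d) (ms : List (Fin k → Pt d)) :
    Bd (bestTuple G ms) (fun r => (r = none → ms = []) ∧ ∀ s v, r = some (s, v) →
      v = totalCost G s.center s.part ∧
      ∀ m ∈ ms, ∀ U : ChromaticPartition G, v ≤ totalCost G m U)
      (ms.length * (bipartiteTime n k d + 1) + 1) := by
  rw [bestTuple]
  refine (bd_argmin (R := fun m r => ∃ s v, r = some (s, v) ∧ v = totalCost G s.center s.part ∧
      ∀ U : ChromaticPartition G, v ≤ totalCost G m U) (T := bipartiteTime n k d)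
      fun m _ => ?_).imp fun r hr => ⟨?_, ?_⟩
  · exact (bd_bipartiteMatching G m).bind (T := 0)
      (fun r hr => bd_pure ⟨_, _, rfl, hr.1, hr.2⟩) le_rfl
  · intro h
    by_contra hne
    obtain ⟨m, hm⟩ := List.exists_mem_of_ne_nil ms hne
    obtain ⟨s, v, h', -⟩ := hr.1 h m hm
    simp at h'
  · rintro s v rfl
    obtain ⟨⟨m, -, s', v', h1, h2, -⟩, h3⟩ := hr.2 s v rfl
    simp only [Option.some.injEq, Prod.mk.injEq] at h1
    obtain ⟨rfl, rfl⟩ := h1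
    refine ⟨h2, fun m hm U => ?_⟩
    obtain ⟨r, ⟨s', v', rfl, -, h5⟩, h6⟩ := h3 m hm
    exact (h6 _ _ rfl).trans (h5 U)

theorem mem_tuples {α : Type} {C : List α} : ∀ {k : ℕ} {f : Fin k → α}, (∀ j, f j ∈ C) →
    f ∈ tuples C k
  | 0, f, _ => by
    rw [tuples, List.mem_singleton]
    funext i
    exact i.elim0
  | k + 1, f, h => by
    rw [tuples, List.mem_flatMap]
    refine ⟨f 0, h 0, List.mem_map.2 ⟨fun i => f i.succ, mem_tuples fun j => h _, ?_⟩⟩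
    exact Fin.cons_self_tail f

theorem length_tuples {α : Type} (C : List α) : ∀ k, (tuples C k).length = C.length ^ k
  | 0 => rfl
  | k + 1 => by
    rw [tuples, List.length_flatMap]
    simp [length_tuples C k, pow_succ, mul_comm]

theorem bd_initialBound {N h : ℕ} (G : ChromaticInstance n k d) (ε : ℝ)
    (hP : G.points.length ≤ N) (hN : N < 2 ^ (h + 1)) :
    Bd (initialBound G ε) (fun _ => True)
      ((k * (searchTime N k d ⌈64 * (k : ℝ) ^ 2 / (ε / (64 * k)) ^ 2⌉₊ (h + 1) k + 1) + 1) +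
        (k ^ k * (k + 1) + (k ^ k * (bipartiteTime n k d + 1) + 1 + 1))) := by
  rw [initialBound]
  refine (bd_kMeansPTAS ε G.points hP hN).bind (fun C hC => ?_) le_rfl
  rcases C with - | ⟨C, v⟩
  · exact bd_pure trivial
  dsimp only
  obtain ⟨-, -, hCl, -⟩ := hC C v rfl
  rw [List.length_nil, zero_add] at hCl
  have hl : (tuples C k).length ≤ k ^ k := by
    rw [length_tuples]
    exact Nat.pow_le_pow_left hCl k
  refine (bd_charge (P := fun ts => ts = tuples C k) rfl
    (show _ ≤ k ^ k * (k + 1) by gcongr)).bind (fun ts hts => ?_) le_rfl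
  refine (bd_bestTuple G ts).bind (T := 1) (fun r _ => ?_)
    (by rw [hts]; gcongr)
  rcases r with - | ⟨s, v⟩
  · exact bd_pure trivial
  · exact bd_charge trivial le_rfl

/-- Replacing each center by the nearest point of a set `C` of centers for all points costs little:
the distance of a point `q` to the new center is at most `2 a + b`, where `a` is its distance to
the old center and `b` its distance to `C`. -/
theorem exists_tuple_cost_le (G : ChromaticInstance n k d) (m : Fin k → Pt d)
    (U : ChromaticPartition G) {C : List (Pt d)} (hC : C ≠ []) :
    ∃ f : Fin k → Pt d, (∀ j, f j ∈ C) ∧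
      totalCost G f U ≤ 8 * totalCost G m U + 2 * assignCost G.points C := by
  choose f hf hd using fun j => exists_distSq (m j) hC
  refine ⟨f, hf, ?_⟩
  rw [assignCost, G.sum_map_points, totalCost, totalCost, Finset.mul_sum, Finset.mul_sum,
    ← Finset.sum_add_distrib]
  refine Finset.sum_le_sum fun i _ => ?_
  rw [Finset.mul_sum, Finset.mul_sum, ← Finset.sum_add_distrib]
  refine Finset.sum_le_sum fun a _ => ?_
  set q := G.pt i a
  set j := U i a
  obtain ⟨c, hc, hqc⟩ := exists_distSq q hC
  rw [hqc]
  have h1 : ‖m j - f j‖ ≤ ‖m j - c‖ := by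
    have := distSq_le (q := m j) hc
    rw [hd] at this
    exact le_of_sq_le_sq this (norm_nonneg _)
  have h2 : ‖m j - c‖ ≤ ‖q - m j‖ + ‖q - c‖ := by
    have := norm_sub_le (q - c) (q - m j)
    rw [sub_sub_sub_cancel_left] at this
    linarith
  have h3 : ‖q - f j‖ ≤ ‖q - m j‖ + ‖m j - f j‖ := by
    have := norm_add_le (q - m j) (m j - f j)
    rwa [sub_add_sub_cancel] at this
  have h4 : ‖q - f j‖ ≤ 2 * ‖q - m j‖ + ‖q - c‖ := by linarith
  calc ‖q - f j‖ ^ 2 ≤ (2 * ‖q - m j‖ + ‖q - c‖) ^ 2 := by gcongr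
    _ ≤ 8 * ‖q - m j‖ ^ 2 + 2 * ‖q - c‖ ^ 2 := by nlinarith [sq_nonneg (2 * ‖q - m j‖ - ‖q - c‖)]

/-- The initial bound is, with good probability, correct up to the factor `16`. -/
theorem le_prob_initialBound (G : ChromaticInstance n k d) (hk : 2 ≤ k) {ε : ℝ} (hε : 0 < ε)
    (hε1 : ε ≤ 1) (hP : G.points ≠ []) (m : Fin k → Pt d) (U : ChromaticPartition G)
    (hmin : ∀ m' U', totalCost G m U ≤ totalCost G m' U') :
    (1 - ENNReal.ofReal (1 / (4 * k))) ^ k ≤ (initialBound G ε).prob (fun b => ∃ Δ, b = some Δ ∧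
      totalCost G m U / G.points.length ≤ Δ ∧ Δ ≤ 16 * totalCost G m U / G.points.length) := by
  have hcl : ∀ q : Pt d, ∃ j : Fin k, ∀ j', ‖q - m j‖ ^ 2 ≤ ‖q - m j'‖ ^ 2 := by
    intro q
    have : Nonempty (Fin k) := ⟨⟨0, by omega⟩⟩
    exact Finite.exists_min _
  choose cl hcl using hcl
  have hlt : G.points.length < 2 ^ (G.points.length + 1) :=
    (Nat.lt_two_pow_self).trans (Nat.pow_lt_pow_right (by norm_num) (by omega))
  have hle : (1 - ENNReal.ofReal (1 / (4 * k))) ^ k ≤ (kMeansPTAS k ε G.points).prob (fun r =>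
      ∃ C v, r = some (C, v) ∧ C ≠ [] ∧ assignCost G.points C ≤ 4 * totalCost G m U) := by
    refine (le_prob_kMeansPTAS hk hε hε1 G.points hP cl m).trans
      ((bd_kMeansPTAS ε G.points le_rfl hlt).prob_mono ?_)
    rintro r hr ⟨C, v, rfl, hv⟩
    obtain ⟨h1, -, -, h2⟩ := hr C v rfl
    refine ⟨C, v, rfl, h1, ?_⟩
    have h3 : (G.points.map fun q => ‖q - m (cl q)‖ ^ 2).sum ≤ totalCost G m U := by
      rw [G.sum_map_points]
      exact Finset.sum_le_sum fun i _ => Finset.sum_le_sum fun a _ => hcl _ _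
    linarith
  rw [initialBound, ← mul_one ((1 - ENNReal.ofReal (1 / (4 * k))) ^ k)]
  refine le_prob_bind hle ?_
  rintro b ⟨C, v, rfl, hC, hcost⟩
  dsimp only
  refine (bd_charge (P := fun ts => ts = tuples C k) rfl le_rfl).le_prob_bind fun ts hts => ?_
  refine (bd_bestTuple G ts).le_prob_bind fun r hr => ?_
  obtain ⟨f, hf, hfc⟩ := exists_tuple_cost_le G m U hC
  have hmem : f ∈ ts := hts ▸ mem_tuples hf
  rcases r with - | ⟨s, v⟩
  · rw [hr.1 rfl] at hmem
    simp at hmem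
  · obtain ⟨h1, h2⟩ := hr.2 s v rfl
    refine le_prob_charge le_rfl ⟨_, rfl, ?_, ?_⟩
    · rw [h1]
      gcongr
      exact hmin _ _
    · gcongr
      have := h2 f hmem U
      linarith

/-! ### Means of finite families and the grid in a simplex -/

section Mean

variable {ι : Type} (x : ι → Pt d)

/-- The mean of a finite family of points; `0` for the empty family. -/
def famMean (s : Finset ι) : Pt d := (s.card : ℝ)⁻¹ • ∑ i ∈ s, x i

theorem card_smul_famMean (s : Finset ι) : (s.card : ℝ) • famMean x s = ∑ i ∈ s, x i := by
  rcases s.eq_empty_or_nonempty with rfl | h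
  · simp
  · rw [famMean, smul_smul, mul_inv_cancel₀, one_smul]
    exact_mod_cast h.card_pos.ne'

theorem sum_norm_sub_sq_famMean (s : Finset ι) (y : Pt d) :
    ∑ i ∈ s, ‖x i - y‖ ^ 2 =
      ∑ i ∈ s, ‖x i - famMean x s‖ ^ 2 + s.card * ‖famMean x s - y‖ ^ 2 := by
  have h : ∀ i ∈ s, ‖x i - y‖ ^ 2 = ‖x i - famMean x s‖ ^ 2 +
      2 * inner ℝ (x i - famMean x s) (famMean x s - y) + ‖famMean x s - y‖ ^ 2 := by
    intro i _
    rw [← norm_add_sq_real, sub_add_sub_cancel]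
  rw [Finset.sum_congr rfl h, Finset.sum_add_distrib, Finset.sum_add_distrib, ← Finset.mul_sum,
    ← sum_inner, Finset.sum_sub_distrib, Finset.sum_const, ← card_smul_famMean,
    ← Nat.cast_smul_eq_nsmul ℝ, sub_self, inner_zero_left, Finset.sum_const, nsmul_eq_mul]
  ring

theorem card_mul_norm_famMean_sub_sq_le (s : Finset ι) (y : Pt d) :
    s.card * ‖famMean x s - y‖ ^ 2 ≤ ∑ i ∈ s, ‖x i - y‖ ^ 2 := by
  rw [sum_norm_sub_sq_famMean]
  have : 0 ≤ ∑ i ∈ s, ‖x i - famMean x s‖ ^ 2 := by positivity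
  linarith

theorem sum_norm_sub_famMean_sq_le (s : Finset ι) (y : Pt d) :
    ∑ i ∈ s, ‖x i - famMean x s‖ ^ 2 ≤ ∑ i ∈ s, ‖x i - y‖ ^ 2 := by
  rw [sum_norm_sub_sq_famMean x s y]
  have : 0 ≤ (s.card : ℝ) * ‖famMean x s - y‖ ^ 2 := by positivity
  linarith

theorem norm_famMean_sub_le_sqrt {s : Finset ι} (hs : s.Nonempty) (y : Pt d) {S : ℝ}
    (h : ∑ i ∈ s, ‖x i - y‖ ^ 2 ≤ S) : ‖famMean x s - y‖ ≤ √(S / s.card) := by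
  have hc : (0 : ℝ) < s.card := by exact_mod_cast hs.card_pos
  refine Real.le_sqrt_of_sq_le ?_
  rw [le_div_iff₀ hc, mul_comm]
  exact (card_mul_norm_famMean_sub_sq_le x s y).trans h

theorem norm_famMean_sub_le {s : Finset ι} (hs : s.Nonempty) {y : Pt d} {r : ℝ} (hr : 0 ≤ r)
    (h : ∀ i ∈ s, ‖x i - y‖ ≤ r) : ‖famMean x s - y‖ ≤ r := by
  have hc : (0 : ℝ) < s.card := by exact_mod_cast hs.card_pos
  have h1 : ∑ i ∈ s, ‖x i - y‖ ^ 2 ≤ s.card * r ^ 2 := by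
    rw [← nsmul_eq_mul]
    exact Finset.sum_le_card_nsmul _ _ _ fun i hi => by gcongr; exact h i hi
  refine (norm_famMean_sub_le_sqrt x hs y h1).trans ?_
  rw [mul_div_cancel_left₀ _ hc.ne', Real.sqrt_sq hr]

end Mean

/-- Rounding convex coefficients `w` to multiples of `1 / M`: all of them are rounded down except
for the largest, which makes up for the difference. The rounding errors are at most `w` itself,
their total is small, and so is their total relative to `√w`. -/
theorem exists_rounding {v M : ℕ} (w : Fin v → ℝ) (hw : ∀ l, 0 ≤ w l) (hw1 : ∑ l, w l = 1)
    (hM : v ^ 2 ≤ M) :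
    ∃ (a : Fin v → ℕ) (c : Fin v → ℝ), ∑ l, a l = M ∧ (∀ l, |(a l : ℝ) / M - w l| ≤ w l) ∧
      ∑ l, |(a l : ℝ) / M - w l| ≤ 2 * v / M ∧ (∀ l, 0 ≤ c l) ∧
      (∀ l, |(a l : ℝ) / M - w l| ≤ √(w l) * c l) ∧ ∑ l, c l ≤ v / √M + v ^ 2 / M := by
  have hne : Nonempty (Fin v) := by
    by_contra h
    rw [not_nonempty_iff] at h
    simp at hw1
  have hv : 0 < v := Fin.pos_iff_nonempty.2 hne
  have hv0 : (0 : ℝ) < v := by exact_mod_cast hv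
  have hv1 : (1 : ℝ) ≤ v := by exact_mod_cast hv
  have hMr : (v : ℝ) ^ 2 ≤ M := by exact_mod_cast hM
  have hM0 : (0 : ℝ) < M := lt_of_lt_of_le (by positivity) hMr
  obtain ⟨t, ht⟩ := Finite.exists_max w
  have hwt : 1 / (v : ℝ) ≤ w t := by
    rw [div_le_iff₀ hv0, mul_comm]
    calc (1 : ℝ) = ∑ l, w l := hw1.symm
      _ ≤ ∑ _l : Fin v, w t := Finset.sum_le_sum fun l _ => ht l
      _ = v * w t := by simp
  set f : Fin v → ℕ := fun l => ⌊M * w l⌋₊ with hf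
  have hf1 : ∀ l, (f l : ℝ) / M ≤ w l := fun l => by
    rw [div_le_iff₀ hM0, mul_comm]
    exact Nat.floor_le (mul_nonneg hM0.le (hw l))
  have hf2 : ∀ l, w l - f l / M ≤ 1 / M := fun l => by
    have := (Nat.lt_floor_add_one (M * w l)).le
    rw [sub_le_iff_le_add, ← add_div, le_div_iff₀ hM0]
    linarith
  have hfs : ∑ l ∈ Finset.univ.erase t, f l ≤ M := by
    have : ((∑ l ∈ Finset.univ.erase t, f l : ℕ) : ℝ) ≤ M := by
      push_cast
      calc ∑ l ∈ Finset.univ.erase t, (f l : ℝ) ≤ ∑ l, (f l : ℝ) :=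
            Finset.sum_le_sum_of_subset_of_nonneg (Finset.erase_subset _ _) fun _ _ _ => by
              positivity
        _ ≤ ∑ l, M * w l := Finset.sum_le_sum fun l _ => Nat.floor_le (mul_nonneg hM0.le (hw l))
        _ = M := by rw [← Finset.mul_sum, hw1, mul_one]
    exact_mod_cast this
  set a : Fin v → ℕ := Function.update f t (M - ∑ l ∈ Finset.univ.erase t, f l) with ha
  have hat : a t = M - ∑ l ∈ Finset.univ.erase t, f l := by simp [ha]
  have hal : ∀ l, l ≠ t → a l = f l := fun l hl => by simp [ha, hl]
  have herr : ∀ l, l ≠ t → |(a l : ℝ) / M - w l| = w l - f l / M := fun l hl => by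
    rw [hal l hl, abs_sub_comm, abs_of_nonneg (sub_nonneg.2 (hf1 l))]
  have herrt : |(a t : ℝ) / M - w t| = ∑ l ∈ Finset.univ.erase t, (w l - f l / M) := by
    have h1 : (a t : ℝ) / M - w t = ∑ l ∈ Finset.univ.erase t, (w l - f l / M) := by
      rw [hat, Nat.cast_sub hfs, Finset.sum_sub_distrib, ← Finset.sum_div, sub_div,
        div_self hM0.ne']
      have h2 : ∑ l ∈ Finset.univ.erase t, w l = 1 - w t := by
        rw [← hw1, ← Finset.add_sum_erase _ _ (Finset.mem_univ t)]
        ring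
      rw [h2]
      push_cast
      ring
    rw [h1, abs_of_nonneg]
    exact Finset.sum_nonneg fun l _ => sub_nonneg.2 (hf1 l)
  have hsum : ∑ l ∈ Finset.univ.erase t, (w l - f l / M) ≤ v / M := by
    calc ∑ l ∈ Finset.univ.erase t, (w l - f l / M)
        ≤ ∑ l, (w l - f l / M) :=
          Finset.sum_le_sum_of_subset_of_nonneg (Finset.erase_subset _ _) fun l _ _ =>
            sub_nonneg.2 (hf1 l)
      _ ≤ ∑ _l : Fin v, 1 / (M : ℝ) := Finset.sum_le_sum fun l _ => hf2 l
      _ = v / M := by simp [div_eq_mul_inv]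
  have hvM : (v : ℝ) / M ≤ 1 / v := by
    rw [div_le_div_iff₀ hM0 hv0]
    nlinarith
  have hsM : 0 < √(M : ℝ) := Real.sqrt_pos.2 hM0
  refine ⟨a, Function.update (fun _ => 1 / √M) t (v ^ 2 / M), ?_, ?_, ?_, ?_, ?_, ?_⟩
  · rw [← Finset.add_sum_erase _ _ (Finset.mem_univ t), hat,
      Finset.sum_congr rfl fun l hl => hal l (Finset.ne_of_mem_erase hl)]
    exact Nat.sub_add_cancel hfs
  · intro l
    by_cases hl : l = t
    · rw [hl, herrt]
      linarith
    · rw [herr l hl]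
      have : (0 : ℝ) ≤ f l / M := by positivity
      linarith
  · rw [← Finset.add_sum_erase _ _ (Finset.mem_univ t), herrt,
      Finset.sum_congr rfl fun l hl => herr l (Finset.ne_of_mem_erase hl)]
    rw [mul_div_assoc]
    linarith
  · intro l
    by_cases hl : l = t
    · rw [hl, Function.update_self]; positivity
    · rw [Function.update_of_ne hl]; positivity
  · intro l
    by_cases hl : l = t
    · rw [hl, herrt, Function.update_self]
      have h1 : 1 / (v : ℝ) ≤ √(w t) := by
        refine Real.le_sqrt_of_sq_le (le_trans ?_ hwt)
        rw [div_pow, one_pow]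
        exact one_div_le_one_div_of_le hv0 (by nlinarith)
      calc _ ≤ (v : ℝ) / M := hsum
        _ = 1 / v * (v ^ 2 / M) := by field_simp
        _ ≤ _ := by gcongr
    · rw [herr l hl, Function.update_of_ne hl, mul_one_div, le_div_iff₀ hsM]
      -- the error is at most `w` and at most `1 / M`, hence at most their geometric mean
      have h0 := sub_nonneg.2 (hf1 l)
      refine Real.le_sqrt_of_sq_le ?_
      rw [mul_pow, Real.sq_sqrt hM0.le, sq]
      have h1 : w l - f l / M ≤ w l := by
        have : (0 : ℝ) ≤ f l / M := by positivity
        linarith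
      have h2 : (w l - f l / M) * M ≤ 1 := by
        have := hf2 l
        rwa [le_div_iff₀ hM0] at this
      nlinarith
  · rw [← Finset.add_sum_erase _ _ (Finset.mem_univ t), Function.update_self,
      Finset.sum_congr rfl fun l hl => Function.update_of_ne (Finset.ne_of_mem_erase hl) _ _,
      Finset.sum_const, add_comm, nsmul_eq_mul, mul_one_div]
    gcongr
    exact_mod_cast (Finset.card_le_univ _).trans (by simp)

/-- If a family of points is divided into groups, and the mean of each group is close to the
corresponding vertex of a simplex, then the mean of the whole family is close to a point of the
grid in this simplex. -/
theorem exists_grid_point {ι : Type} (x : ι → Pt d) {U : Finset ι} (hU : U.Nonempty) {v M : ℕ}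
    (hM : v ^ 2 ≤ M) (q : Fin v → Pt d) (g : ι → Fin v) {r κ S : ℝ} (hr : 0 ≤ r) (hκ : 0 ≤ κ)
    (hS : ∑ i ∈ U, ‖x i - famMean x U‖ ^ 2 ≤ S)
    (h : ∀ l, (U.filter fun i => g i = l).Nonempty →
      ‖q l - famMean x (U.filter fun i => g i = l)‖ ≤
        r + κ * √(S / (U.filter fun i => g i = l).card)) :
    ∃ a : Fin v → ℕ, ∑ l, a l = M ∧ ‖∑ l, ((a l : ℝ) / M) • q l - famMean x U‖ ≤
      r * (1 + 2 * v / M) + √(S / U.card) * (2 * κ * v + v / √M + v ^ 2 / M) := by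
  set W : Fin v → Finset ι := fun l => U.filter fun i => g i = l with hW
  set μ := famMean x U with hμ
  set D := √(S / U.card) with hD
  have hb : (0 : ℝ) < U.card := by exact_mod_cast hU.card_pos
  have hS0 : 0 ≤ S := le_trans (by positivity) hS
  set w : Fin v → ℝ := fun l => (W l).card / U.card with hw
  have hw0 : ∀ l, 0 ≤ w l := fun l => by positivity
  have hw1 : ∑ l, w l = 1 := by
    rw [hw, ← Finset.sum_div, div_eq_one_iff_eq hb.ne']
    exact_mod_cast (Finset.card_eq_sum_card_fiberwise (f := g) (s := U) (t := Finset.univ)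
      (fun _ _ => Finset.mem_coe.2 (Finset.mem_univ _))).symm
  set τ : Fin v → Pt d := fun l => famMean x (W l) with hτ
  have hμτ : ∑ l, w l • τ l = μ := by
    have h1 : ∀ l, w l • τ l = (U.card : ℝ)⁻¹ • ∑ i ∈ W l, x i := fun l => by
      rw [← card_smul_famMean, smul_smul, hw]
      congr 1
      field_simp
    rw [Finset.sum_congr rfl fun l _ => h1 l, ← Finset.smul_sum, hμ, famMean]
    congr 1
    exact Finset.sum_fiberwise U g x
  obtain ⟨a, c, ha, hη, hηs, hc0, hc, hcs⟩ := exists_rounding w hw0 hw1 hM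
  set η : Fin v → ℝ := fun l => (a l : ℝ) / M - w l with hηdef
  refine ⟨a, ha, ?_⟩
  have hvpos : 0 < v := by
    obtain ⟨i, -⟩ := hU
    exact Fin.pos (g i)
  have hM0 : (0 : ℝ) < M := by
    have : 0 < M := lt_of_lt_of_le (by positivity) hM
    exact_mod_cast this
  have hη0 : ∑ l, η l = 0 := by
    rw [hηdef, Finset.sum_sub_distrib, hw1, ← Finset.sum_div, ← Nat.cast_sum, ha,
      div_self hM0.ne', sub_self]
  have e : ∑ l, ((a l : ℝ) / M) • q l - μ =
      ∑ l, ((w l + η l) • (q l - τ l) + η l • (τ l - μ)) := by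
    have e1 : ∀ l, (w l + η l) • (q l - τ l) + η l • (τ l - μ) =
        ((a l : ℝ) / M) • q l - w l • τ l - η l • μ := fun l => by
      have : w l + η l = (a l : ℝ) / M := by simp only [hηdef]; ring
      rw [this]
      simp only [smul_sub, hηdef, sub_smul]
      abel
    rw [Finset.sum_congr rfl fun l _ => e1 l, Finset.sum_sub_distrib, Finset.sum_sub_distrib,
      hμτ, ← Finset.sum_smul, hη0, zero_smul, sub_zero]
  rw [e]
  refine (norm_sum_le _ _).trans ?_
  have hterm : ∀ l, ‖(w l + η l) • (q l - τ l) + η l • (τ l - μ)‖ ≤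
      (w l + |η l|) * r + 2 * κ * D + c l * D := by
    intro l
    have hD0 : 0 ≤ D := Real.sqrt_nonneg _
    have hηl : |η l| ≤ w l := hη l
    rcases (W l).eq_empty_or_nonempty with hl | hl
    · have hwl : w l = 0 := by simp [hw, hl]
      have : η l = 0 := by
        rw [hwl] at hηl
        exact abs_nonpos_iff.1 hηl
      rw [this, hwl]
      simp only [add_zero, zero_smul, norm_zero, abs_zero, zero_mul, zero_add]
      have := hc0 l
      positivity
    · have hWl : (0 : ℝ) < (W l).card := by exact_mod_cast hl.card_pos
      set σ := √(S / (W l).card) with hσ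
      have hσ0 : 0 ≤ σ := Real.sqrt_nonneg _
      have h1 : ‖q l - τ l‖ ≤ r + κ * σ := h l hl
      have h2 : ‖τ l - μ‖ ≤ σ := by
        refine norm_famMean_sub_le_sqrt x hl μ (le_trans ?_ hS)
        exact Finset.sum_le_sum_of_subset_of_nonneg (Finset.filter_subset _ _) fun _ _ _ => by
          positivity
      have h3 : √(w l) * σ = D := by
        rw [hσ, ← Real.sqrt_mul (hw0 l), hD, hw]
        congr 1
        field_simp
      have hwle : w l ≤ 1 := by
        rw [← hw1]
        exact Finset.single_le_sum (fun l _ => hw0 l) (Finset.mem_univ l)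
      have h4 : w l * σ ≤ D := by
        rw [← h3]
        gcongr
        exact Real.le_sqrt_of_sq_le (by nlinarith [hw0 l])
      have h5 : |η l| * σ ≤ c l * D := by
        have := mul_le_mul_of_nonneg_right (hc l) hσ0
        calc |η l| * σ ≤ √(w l) * c l * σ := this
          _ = c l * D := by rw [← h3]; ring
      have h6 : |w l + η l| ≤ w l + |η l| := by
        have := abs_add_le (w l) (η l)
        rwa [abs_of_nonneg (hw0 l)] at this
      calc ‖(w l + η l) • (q l - τ l) + η l • (τ l - μ)‖
          ≤ |w l + η l| * ‖q l - τ l‖ + |η l| * ‖τ l - μ‖ := by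
            refine (norm_add_le _ _).trans ?_
            rw [norm_smul, norm_smul, Real.norm_eq_abs, Real.norm_eq_abs]
        _ ≤ (w l + |η l|) * (r + κ * σ) + |η l| * σ := by
            have := hw0 l
            gcongr
        _ ≤ (w l + |η l|) * r + 2 * κ * D + c l * D := by
            have : |η l| * σ ≤ w l * σ := by gcongr
            have h7 : κ * ((w l + |η l|) * σ) ≤ κ * (2 * D) :=
              mul_le_mul_of_nonneg_left (by linarith) hκ
            linarith
  refine (Finset.sum_le_sum fun l _ => hterm l).trans ?_
  have hsum : ∑ l, ((w l + |η l|) * r + 2 * κ * D + c l * D) =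
      (1 + ∑ l, |η l|) * r + v * (2 * κ) * D + (∑ l, c l) * D := by
    rw [Finset.sum_add_distrib, Finset.sum_add_distrib, ← Finset.sum_mul _ _ r,
      ← Finset.sum_mul _ c D, Finset.sum_add_distrib, hw1, Finset.sum_const, Finset.card_univ,
      Fintype.card_fin, nsmul_eq_mul]
    ring
  rw [hsum]
  have hD0 : 0 ≤ D := Real.sqrt_nonneg _
  have h1 : (1 + ∑ l, |η l|) * r ≤ r * (1 + 2 * v / M) := by
    rw [mul_comm]
    gcongr
  have h2 := mul_le_mul_of_nonneg_right hcs hD0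
  have h3 : D * (2 * κ * v + v / √M + v ^ 2 / M) =
      v * (2 * κ) * D + (v / √M + v ^ 2 / M) * D := by ring
  rw [h3]
  linarith

/-! ### Peeling: the geometry of one step -/

/-- The grid points of the simplex with the given vertices. -/
def simplexPoints (ε : ℝ) (V : List (Pt d)) : List (Pt d) :=
  (List.Nat.antidiagonalTuple V.length (⌊2 * (V.length : ℝ) ^ 2 / ε⌋₊ + 1)).map
    fun a => ∑ i, ((a i : ℝ) / (⌊2 * (V.length : ℝ) ^ 2 / ε⌋₊ + 1 : ℕ)) • V.get i

/-- `exists_grid_point` for the fineness of the grid used by the algorithm. -/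
theorem exists_simplexPoint {ι : Type} (x : ι → Pt d) {U : Finset ι} (hU : U.Nonempty)
    (V : List (Pt d)) (g : ι → Fin V.length) {e r κ S : ℝ} (he : 0 < e) (he1 : e ≤ 1)
    (hr : 0 ≤ r) (hκ : 0 ≤ κ) (hS : ∑ i ∈ U, ‖x i - famMean x U‖ ^ 2 ≤ S)
    (h : ∀ l, (U.filter fun i => g i = l).Nonempty →
      ‖V.get l - famMean x (U.filter fun i => g i = l)‖ ≤
        r + κ * √(S / (U.filter fun i => g i = l).card)) :
    ∃ y ∈ simplexPoints (e ^ 2 / 4) V, ‖y - famMean x U‖ ≤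
      r * (1 + e ^ 2 / 4) + √(S / U.card) * (2 * κ * V.length + 0.36 * e + e ^ 2 / 8) := by
  set M := ⌊2 * (V.length : ℝ) ^ 2 / (e ^ 2 / 4)⌋₊ + 1 with hMdef
  have hv1 : 1 ≤ V.length := by
    obtain ⟨i, -⟩ := hU
    exact Fin.pos (g i)
  have hv1r : (1 : ℝ) ≤ V.length := by exact_mod_cast hv1
  have hM8 : 8 * (V.length : ℝ) ^ 2 / e ^ 2 ≤ M := by
    have h1 : 2 * (V.length : ℝ) ^ 2 / (e ^ 2 / 4) = 8 * (V.length : ℝ) ^ 2 / e ^ 2 := by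
      field_simp; norm_num
    rw [← h1, hMdef]
    push_cast
    exact (Nat.lt_floor_add_one _).le
  rw [div_le_iff₀ (by positivity)] at hM8
  have he2 : e ^ 2 ≤ 1 := pow_le_one₀ he.le he1
  have hM0 : (0 : ℝ) < M := by rw [hMdef]; positivity
  have hMv : V.length ^ 2 ≤ M := by
    have : ((V.length ^ 2 : ℕ) : ℝ) ≤ M := by
      push_cast
      nlinarith
    exact_mod_cast this
  obtain ⟨a, ha, hle⟩ := exists_grid_point x hU hMv V.get g hr hκ hS h
  refine ⟨_, List.mem_map.2 ⟨a, List.Nat.mem_antidiagonalTuple.2 ha, rfl⟩, hle.trans ?_⟩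
  have h1 : 2 * (V.length : ℝ) / M ≤ e ^ 2 / 4 := by
    rw [div_le_div_iff₀ hM0 (by norm_num)]
    nlinarith
  have h2 : (V.length : ℝ) ^ 2 / M ≤ e ^ 2 / 8 := by
    rw [div_le_div_iff₀ hM0 (by norm_num)]
    linarith
  have h3 : (V.length : ℝ) / √M ≤ 0.36 * e := by
    rw [div_le_iff₀ (Real.sqrt_pos.2 hM0)]
    have h4 : (V.length : ℝ) / (0.36 * e) ≤ √M := by
      refine Real.le_sqrt_of_sq_le ?_
      rw [div_pow, div_le_iff₀ (by positivity)]
      nlinarith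
    rw [div_le_iff₀ (by positivity)] at h4
    linarith
  have h5 : 2 * κ * V.length + V.length / √M + V.length ^ 2 / M ≤
      2 * κ * V.length + 0.36 * e + e ^ 2 / 8 := by
    linarith
  gcongr

section Peeling

variable {ι : Type} [Fintype ι] (x : ι → Pt d) (u : ι → ℕ)

/-- The `j`-th cell of the optimal partition, `u` being the function that assigns cells. -/
def optCell (j : ℕ) : Finset ι := Finset.univ.filter fun i => u i = j

/-- The cost of the `j`-th cell with respect to its mean. -/
def cellCost (j : ℕ) : ℝ := ∑ i ∈ optCell u j, ‖x i - famMean x (optCell u j)‖ ^ 2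

/-- How far the point on level `l + 1` of a good path may be from the mean of the `l`-th cell:
`e δ_l + (1 + e) (l + 1) √(e / β_l) δ`, where `β_l` is the share of the cell in all points, `δ_l`
the root of the mean squared distance of its points to their mean, and `δ` the root of the mean
optimal cost of all points, of total optimal cost `V`. -/
def peelBound (V e : ℝ) (l : ℕ) : ℝ :=
  e * √(cellCost x u l / (optCell u l).card) +
    (1 + e) * ((l + 1) * √(e * V / (optCell u l).card))

/-- The points on the path approximate the means of the largest cells. -/
def GoodPath (V e : ℝ) (path : List (Pt d)) : Prop :=
  ∀ (l : ℕ) (h : l < path.length), (optCell u l).Nonempty →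
    ‖path[l] - famMean x (optCell u l)‖ ≤ peelBound x u V e l

open Classical in
/-- The points that remain when the points within distance `r` of the path are removed. -/
def farPoints (r : ℝ) (path : List (Pt d)) : Finset ι :=
  Finset.univ.filter fun i => ∀ c ∈ path, r ^ 2 < ‖x i - c‖ ^ 2

variable {x u}

theorem cellCost_nonneg (j : ℕ) : 0 ≤ cellCost x u j := by
  rw [cellCost]; positivity

/-- Removing the balls around the points of a good path leaves a set in which the next cell has a
good share: of the earlier cells, most points are removed, by Chebyshev's inequality, and the later
cells are not larger. -/
theorem card_farPoints_le {V e r : ℝ} {path : List (Pt d)} (huk : ∀ i, u i < k)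
    (hanti : ∀ i j, i ≤ j → (optCell u j).card ≤ (optCell u i).card)
    (hV : ∑ l ∈ Finset.range k, cellCost x u l ≤ V) (he : 0 < e) (he16 : e ≤ 1 / 16)
    (hek : e * k ≤ 1 / 4) (hpath : GoodPath x u V e path) (hlen : path.length < k)
    (hne : (optCell u path.length).Nonempty)
    (hr : (path.length + 1) * √(e * V / (optCell u path.length).card) ≤ r) :
    e * (farPoints x r path).card ≤ 5 * (optCell u path.length).card := by
  classical
  set J := path.length with hJ
  set b := (optCell u J).card with hb
  have hb0 : (0 : ℝ) < b := by exact_mod_cast hne.card_pos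
  have hv0 : ∀ l, 0 ≤ cellCost x u l := cellCost_nonneg
  have hvV : ∀ l < k, cellCost x u l ≤ V := fun l hl =>
    (Finset.single_le_sum (fun l _ => hv0 l) (Finset.mem_range.2 hl)).trans hV
  have hV0 : 0 ≤ V := (Finset.sum_nonneg fun l _ => hv0 l).trans hV
  have hek0 : 0 ≤ e * k := by positivity
  have hterm : ∀ l ∈ Finset.range k, e * ((farPoints x r path).filter fun i => u i = l).card ≤
      e * b + 4 * b * (cellCost x u l / V) := by
    intro l hl
    rw [Finset.mem_range] at hl
    have hpos : 0 ≤ 4 * (b : ℝ) * (cellCost x u l / V) := by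
      have := hv0 l
      positivity
    by_cases hlJ : J ≤ l
    · have h1 : ((farPoints x r path).filter fun i => u i = l).card ≤ b := by
        refine le_trans (Finset.card_le_card ?_) (hanti J l hlJ)
        intro i hi
        exact Finset.mem_filter.2 ⟨Finset.mem_univ _, (Finset.mem_filter.1 hi).2⟩
      have h2 : (((farPoints x r path).filter fun i => u i = l).card : ℝ) ≤ b := by
        exact_mod_cast h1
      nlinarith
    · rw [not_le] at hlJ
      have hbl : (b : ℝ) ≤ (optCell u l).card := by exact_mod_cast hanti l J hlJ.le
      have hlne : (optCell u l).Nonempty := by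
        rw [← Finset.card_pos]
        exact lt_of_lt_of_le hne.card_pos (hanti l J hlJ.le)
      set Y := √(e * V / b) with hY
      have hY0 : 0 ≤ Y := Real.sqrt_nonneg _
      -- the point on the path is closer to the mean of the cell than `r` by a margin of `Y / 2`
      have hrad : peelBound x u V e l ≤ r - Y / 2 := by
        have h1 : √(e * V / (optCell u l).card) ≤ Y := by
          rw [hY]; gcongr
        have h2 : e * √(cellCost x u l / (optCell u l).card) ≤ √e * Y := by
          have h3 : √(cellCost x u l / (optCell u l).card) ≤ √(V / b) := by
            gcongr
            exact hvV l hl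
          have h4 : √e * Y = e * √(V / b) := by
            rw [hY, mul_div_assoc, Real.sqrt_mul he.le, ← mul_assoc, Real.mul_self_sqrt he.le]
          rw [h4]
          gcongr
        have h5 : √e ≤ 1 / 4 := by
          rw [show (1 : ℝ) / 4 = √(1 / 16) by
            rw [show (1 : ℝ) / 16 = (1 / 4) ^ 2 by norm_num, Real.sqrt_sq (by norm_num)]]
          exact Real.sqrt_le_sqrt he16
        have h6 : ((l : ℝ) + 1) ≤ J := by exact_mod_cast hlJ
        have h7 : (J : ℝ) ≤ k := by exact_mod_cast hlen.le
        have h8 : e * J ≤ 1 / 4 := by nlinarith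
        have h9 : (1 + e) * (((l : ℝ) + 1) * √(e * V / (optCell u l).card)) ≤
            (1 + e) * (J * Y) := by gcongr
        have h10 : √e * Y ≤ 1 / 4 * Y := by gcongr
        have h11 : e * J * Y ≤ 1 / 4 * Y := by gcongr
        rw [peelBound]
        nlinarith
      have hpl : path[l] ∈ path := List.getElem_mem hlJ
      have hout : ∀ i ∈ (farPoints x r path).filter fun i => u i = l,
          i ∈ optCell u l ∧ Y / 2 < ‖x i - famMean x (optCell u l)‖ := by
        intro i hi
        obtain ⟨h1, h2⟩ := Finset.mem_filter.1 hi
        refine ⟨Finset.mem_filter.2 ⟨Finset.mem_univ _, h2⟩, ?_⟩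
        have h3 : r < ‖x i - path[l]‖ :=
          lt_of_pow_lt_pow_left₀ 2 (norm_nonneg _) ((Finset.mem_filter.1 h1).2 _ hpl)
        have h4 := hpath l hlJ hlne
        have h5 : ‖x i - path[l]‖ ≤
            ‖x i - famMean x (optCell u l)‖ + ‖path[l] - famMean x (optCell u l)‖ := by
          rw [norm_sub_rev (path[l])]
          exact norm_sub_le_norm_sub_add_norm_sub _ _ _
        linarith
      rcases hV0.eq_or_lt with hV0 | hV0
      · -- if the optimal cost vanishes, no point of the cell remains
        have hempty : ((farPoints x r path).filter fun i => u i = l) = ∅ := by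
          rw [Finset.eq_empty_iff_forall_notMem]
          intro i hi
          obtain ⟨h1, h2⟩ := hout i hi
          have h3 : ‖x i - famMean x (optCell u l)‖ ^ 2 ≤ cellCost x u l :=
            Finset.single_le_sum (f := fun i => ‖x i - famMean x (optCell u l)‖ ^ 2)
              (fun _ _ => by positivity) h1
          have h4 := hvV l hl
          have h5 : 0 < ‖x i - famMean x (optCell u l)‖ := by linarith
          nlinarith
        rw [hempty]
        simp only [Finset.card_empty, Nat.cast_zero, mul_zero]
        positivity
      · have h1 : ((farPoints x r path).filter fun i => u i = l).card * (Y / 2) ^ 2 ≤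
            cellCost x u l := by
          rw [← nsmul_eq_mul]
          refine (Finset.card_nsmul_le_sum _ (fun i => ‖x i - famMean x (optCell u l)‖ ^ 2) _
            fun i hi => ?_).trans ?_
          · gcongr
            exact (hout i hi).2.le
          · exact Finset.sum_le_sum_of_subset_of_nonneg (fun i hi => (hout i hi).1)
              fun _ _ _ => by positivity
        have h2 : Y ^ 2 = e * V / b := Real.sq_sqrt (by positivity)
        rw [div_pow, h2] at h1
        have h3 : e * ((farPoints x r path).filter fun i => u i = l).card ≤
            4 * b * (cellCost x u l / V) := by
          rw [mul_div_assoc', le_div_iff₀ hV0]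
          have : ((farPoints x r path).filter fun i => u i = l).card * (e * V / b / 2 ^ 2) =
            e * ((farPoints x r path).filter fun i => u i = l).card * V / (4 * b) := by
              field_simp
              norm_num
          rw [this, div_le_iff₀ (by positivity)] at h1
          linarith
        have : 0 ≤ e * b := by positivity
        linarith
  have hcard : (farPoints x r path).card =
      ∑ l ∈ Finset.range k, ((farPoints x r path).filter fun i => u i = l).card :=
    Finset.card_eq_sum_card_fiberwise fun i _ => Finset.mem_coe.2 (Finset.mem_range.2 (huk i))
  rw [hcard]
  push_cast
  rw [Finset.mul_sum]
  refine (Finset.sum_le_sum hterm).trans ?_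
  rw [Finset.sum_add_distrib, Finset.sum_const, Finset.card_range, nsmul_eq_mul, ← Finset.mul_sum,
    ← Finset.sum_div]
  have h1 : (∑ l ∈ Finset.range k, cellCost x u l) / V ≤ 1 := div_le_one_of_le₀ hV hV0
  have h2 : 4 * (b : ℝ) * ((∑ l ∈ Finset.range k, cellCost x u l) / V) ≤ 4 * b * 1 := by gcongr
  nlinarith

/-- If part of the next cell remains and `π` is close to the mean of this part, then the simplex
spanned by the path and `π` has a grid point that continues a good path: the removed points are
close to points of the path. -/
theorem exists_child_of_sample {V e r : ℝ} {path : List (Pt d)} {π : Pt d}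
    (he : 0 < e) (he16 : e ≤ 1 / 16) (hek : e * k ≤ 1 / 4) (hlen : path.length < k) (hr0 : 0 ≤ r)
    (hr : r ≤ (1 + e / 2) * ((path.length + 1) * √(e * V / (optCell u path.length).card)))
    (O : Finset ι) (hO : ∀ i, i ∈ O ↔ i ∈ optCell u path.length ∧ i ∈ farPoints x r path)
    (hne : O.Nonempty)
    (hπ : O.card * ‖π - famMean x O‖ ^ 2 ≤ e ^ 4 * ∑ i ∈ O, ‖x i - famMean x O‖ ^ 2) :
    ∃ y ∈ simplexPoints (e ^ 2 / 4) (path ++ [π]),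
      ‖y - famMean x (optCell u path.length)‖ ≤ peelBound x u V e path.length := by
  classical
  set J := path.length with hJ
  have hUne : (optCell u J).Nonempty := by
    obtain ⟨i, hi⟩ := hne
    exact ⟨i, ((hO i).1 hi).1⟩
  have hlenV : (path ++ [π]).length = J + 1 := by simp [hJ]
  have hnear : ∀ i, i ∉ farPoints x r path →
      ∃ l : Fin path.length, ‖x i - path.get l‖ ≤ r := by
    intro i hi
    rw [farPoints, Finset.mem_filter] at hi
    push Not at hi
    obtain ⟨c, hc, hle⟩ := hi (Finset.mem_univ _)
    obtain ⟨l, hl⟩ := List.get_of_mem hc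
    exact ⟨l, hl ▸ le_of_sq_le_sq hle hr0⟩
  set g : ι → Fin (path ++ [π]).length := fun i =>
    if h : i ∈ farPoints x r path then ⟨J, by omega⟩
    else ⟨(hnear i h).choose, by have := (hnear i h).choose.2; omega⟩ with hg
  have hS : ∑ i ∈ optCell u J, ‖x i - famMean x (optCell u J)‖ ^ 2 ≤ cellCost x u J := le_rfl
  have hgrp : ∀ l, ((optCell u J).filter fun i => g i = l).Nonempty →
      ‖(path ++ [π]).get l - famMean x ((optCell u J).filter fun i => g i = l)‖ ≤
        r + e ^ 2 * √(cellCost x u J / ((optCell u J).filter fun i => g i = l).card) := by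
    intro l hl
    have hσ0 : 0 ≤ e ^ 2 * √(cellCost x u J / ((optCell u J).filter fun i => g i = l).card) := by
      positivity
    by_cases hlJ : (l : ℕ) < path.length
    · -- the points of the cell within distance `r` of a point on the path
      have hget : (path ++ [π]).get l = path.get ⟨l, hlJ⟩ := by
        simp [List.getElem_append_left hlJ]
      rw [hget, norm_sub_rev]
      refine (norm_famMean_sub_le x hl hr0 fun i hi => ?_).trans (by linarith)
      have hgi := (Finset.mem_filter.1 hi).2
      rw [hg] at hgi
      by_cases hf : i ∈ farPoints x r path
      · simp only [hf, dif_pos] at hgi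
        rw [← hgi] at hlJ
        exact absurd hlJ (lt_irrefl _)
      · simp only [hf, dif_neg, not_false_eq_true] at hgi
        have hval := congrArg Fin.val hgi
        have h2 : (hnear i hf).choose = ⟨l, hlJ⟩ := Fin.ext hval
        rw [← h2]
        exact (hnear i hf).choose_spec
    · have hlJ' : (l : ℕ) = J := by have := l.2; omega
      have hget : (path ++ [π]).get l = π := by simp [hlJ', hJ]
      have hfil : ((optCell u J).filter fun i => g i = l) = O := by
        ext i
        rw [Finset.mem_filter, hO]
        refine and_congr_right fun _ => ?_
        by_cases hf : i ∈ farPoints x r path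
        · simp only [hg, hf, dif_pos, iff_true]
          ext
          simp [hlJ']
        · simp only [hg, hf, dif_neg, not_false_eq_true, iff_false]
          intro h
          have h2 := congrArg Fin.val h
          have h3 := (hnear i hf).choose.2
          simp only at h2
          omega
      rw [hget, hfil]
      have hO0 : (0 : ℝ) < O.card := by exact_mod_cast hne.card_pos
      have h1 : ∑ i ∈ O, ‖x i - famMean x O‖ ^ 2 ≤ cellCost x u J := by
        refine (sum_norm_sub_famMean_sq_le x O (famMean x (optCell u J))).trans ?_
        exact Finset.sum_le_sum_of_subset_of_nonneg (fun i hi => ((hO i).1 hi).1)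
          fun _ _ _ => by positivity
      have h2 : ‖π - famMean x O‖ ≤ e ^ 2 * √(cellCost x u J / O.card) := by
        have h3 : √((e ^ 2) ^ 2 * (cellCost x u J / O.card)) =
            e ^ 2 * √(cellCost x u J / O.card) := by
          rw [Real.sqrt_mul (by positivity), Real.sqrt_sq (by positivity)]
        rw [← h3]
        refine Real.le_sqrt_of_sq_le ?_
        rw [← mul_div_assoc, le_div_iff₀ hO0]
        have := mul_le_mul_of_nonneg_left h1 (by positivity : 0 ≤ e ^ 4)
        nlinarith
      linarith
  obtain ⟨y, hy, hle⟩ := exists_simplexPoint x hUne (path ++ [π]) g he (by linarith) hr0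
    (κ := e ^ 2) (by positivity) hS hgrp
  refine ⟨y, hy, hle.trans ?_⟩
  rw [hlenV, peelBound]
  have h1 : ((J + 1 : ℕ) : ℝ) ≤ k := by exact_mod_cast hlen
  have h2 : r * (1 + e ^ 2 / 4) ≤ (1 + e) * ((J + 1) * √(e * V / (optCell u J).card)) := by
    calc r * (1 + e ^ 2 / 4) ≤
        (1 + e / 2) * ((J + 1) * √(e * V / (optCell u J).card)) * (1 + e ^ 2 / 4) := by gcongr
      _ = ((1 + e / 2) * (1 + e ^ 2 / 4)) * ((J + 1) * √(e * V / (optCell u J).card)) := by ring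
      _ ≤ _ := by
        gcongr
        nlinarith [pow_pos he 3, mul_pos he he]
  have h3 : 2 * e ^ 2 * ((J + 1 : ℕ) : ℝ) + 0.36 * e + e ^ 2 / 8 ≤ e := by
    have : e * ((J + 1 : ℕ) : ℝ) ≤ 1 / 4 := le_trans (by gcongr) hek
    nlinarith
  have h4 := mul_le_mul_of_nonneg_left h3 (Real.sqrt_nonneg (cellCost x u J / (optCell u J).card))
  linarith

/-- If almost all points of the next cell are removed, then already the simplex spanned by the path
has a grid point that continues a good path. -/
theorem exists_child_of_few {V e r : ℝ} {path : List (Pt d)}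
    (he : 0 < e) (he16 : e ≤ 1 / 16) (hr0 : 0 ≤ r)
    (hr : r ≤ (1 + e / 2) * ((path.length + 1) * √(e * V / (optCell u path.length).card)))
    (O : Finset ι) (hO : ∀ i, i ∈ O ↔ i ∈ optCell u path.length ∧ i ∈ farPoints x r path)
    (hfew : O.card < e ^ 2 / 16 * (optCell u path.length).card) :
    ∃ y ∈ simplexPoints (e ^ 2 / 4) path,
      ‖y - famMean x (optCell u path.length)‖ ≤ peelBound x u V e path.length := by
  classical
  set J := path.length with hJ
  set U := optCell u J with hU
  set m := famMean x U with hm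
  set D := √(cellCost x u J / U.card) with hD
  have hD0 : 0 ≤ D := Real.sqrt_nonneg _
  have hb0 : (0 : ℝ) < U.card := by
    by_contra h
    have : (U.card : ℝ) = 0 := le_antisymm (not_lt.1 h) (by positivity)
    rw [this, mul_zero] at hfew
    have : (0 : ℝ) ≤ O.card := by positivity
    linarith
  have hOU : O ⊆ U := fun i hi => ((hO i).1 hi).1
  set U' := U \ O with hU'
  have hcard : (U'.card : ℝ) + O.card = U.card := by
    exact_mod_cast Finset.card_sdiff_add_card_eq_card hOU
  have he2 : e ^ 2 ≤ 1 / 256 := by nlinarith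
  have hU'b : 0.99 * (U.card : ℝ) ≤ U'.card := by nlinarith
  have hU'0 : (0 : ℝ) < U'.card := by nlinarith
  have hU'ne : U'.Nonempty := by
    rw [← Finset.card_pos]
    exact_mod_cast hU'0
  have hv0 : 0 ≤ cellCost x u J := cellCost_nonneg J
  have hnear : ∀ i ∈ U', ∃ l : Fin path.length, ‖x i - path.get l‖ ≤ r := by
    intro i hi
    rw [hU', Finset.mem_sdiff] at hi
    have hi2 : i ∉ farPoints x r path := fun h => hi.2 ((hO i).2 ⟨hi.1, h⟩)
    rw [farPoints, Finset.mem_filter] at hi2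
    push Not at hi2
    obtain ⟨c, hc, hle⟩ := hi2 (Finset.mem_univ _)
    obtain ⟨l, hl⟩ := List.get_of_mem hc
    exact ⟨l, hl ▸ le_of_sq_le_sq hle hr0⟩
  have hl0 : ∃ _ : Fin path.length, True := by
    obtain ⟨i, hi⟩ := hU'ne
    exact ⟨(hnear i hi).choose, trivial⟩
  set g : ι → Fin path.length := fun i =>
    if h : i ∈ U' then (hnear i h).choose else hl0.choose with hg
  have hS : ∑ i ∈ U', ‖x i - famMean x U'‖ ^ 2 ≤ cellCost x u J := by
    refine (sum_norm_sub_famMean_sq_le x U' m).trans ?_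
    exact Finset.sum_le_sum_of_subset_of_nonneg Finset.sdiff_subset fun _ _ _ => by positivity
  have hgrp : ∀ l, (U'.filter fun i => g i = l).Nonempty →
      ‖path.get l - famMean x (U'.filter fun i => g i = l)‖ ≤
        r + 0 * √(cellCost x u J / (U'.filter fun i => g i = l).card) := by
    intro l hl
    rw [zero_mul, add_zero, norm_sub_rev]
    refine norm_famMean_sub_le x hl hr0 fun i hi => ?_
    obtain ⟨hi1, hi2⟩ := Finset.mem_filter.1 hi
    rw [hg] at hi2
    simp only [hi1, dif_pos] at hi2
    rw [← hi2]
    exact (hnear i hi1).choose_spec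
  obtain ⟨y, hy, hle⟩ := exists_simplexPoint x hU'ne path g he (by linarith) hr0
    (κ := 0) le_rfl hS hgrp
  refine ⟨y, hy, ?_⟩
  -- dropping few points hardly moves the mean
  have hmove : ‖famMean x U' - m‖ ≤ 0.26 * e * D := by
    have h1 : (U'.card : ℝ) • (famMean x U' - m) = -((O.card : ℝ) • (famMean x O - m)) := by
      rw [smul_sub, smul_sub, card_smul_famMean, card_smul_famMean]
      have h2 : ∑ i ∈ U', x i + ∑ i ∈ O, x i = (U'.card : ℝ) • m + (O.card : ℝ) • m := by
        rw [← add_smul, hcard, hm, card_smul_famMean, hU', Finset.sum_sdiff hOU]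
      rw [eq_neg_iff_add_eq_zero, sub_add_sub_comm, h2, sub_self]
    have h3 : (U'.card : ℝ) * ‖famMean x U' - m‖ = O.card * ‖famMean x O - m‖ := by
      have := congrArg norm h1
      rwa [norm_neg, norm_smul, norm_smul, Real.norm_natCast, Real.norm_natCast] at this
    have h4 : (O.card : ℝ) * ‖famMean x O - m‖ ^ 2 ≤ cellCost x u J :=
      (card_mul_norm_famMean_sub_sq_le x O m).trans
        (Finset.sum_le_sum_of_subset_of_nonneg hOU fun _ _ _ => by positivity)
    have h5 : D ^ 2 * U.card = cellCost x u J := by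
      rw [hD, Real.sq_sqrt (by positivity), div_mul_cancel₀ _ hb0.ne']
    have h6 : ((U'.card : ℝ) * ‖famMean x U' - m‖) ^ 2 ≤ (e / 4 * D * U.card) ^ 2 := by
      rw [h3]
      have h7 : (O.card : ℝ) * (O.card * ‖famMean x O - m‖ ^ 2) ≤
          e ^ 2 / 16 * U.card * cellCost x u J := by gcongr
      calc ((O.card : ℝ) * ‖famMean x O - m‖) ^ 2
          = (O.card : ℝ) * (O.card * ‖famMean x O - m‖ ^ 2) := by ring
        _ ≤ e ^ 2 / 16 * U.card * cellCost x u J := h7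
        _ = (e / 4 * D * U.card) ^ 2 := by rw [← h5]; ring
    have h8 := le_of_sq_le_sq h6 (by positivity)
    have h9 : 0.99 * (U.card : ℝ) * ‖famMean x U' - m‖ ≤ U'.card * ‖famMean x U' - m‖ := by
      gcongr
    have h10 : (U.card : ℝ) * (0.99 * ‖famMean x U' - m‖) ≤ U.card * (e / 4 * D) := by linarith
    have h11 := le_of_mul_le_mul_left h10 hb0
    have : 0 ≤ e * D := by positivity
    linarith
  have hspread : √(cellCost x u J / U'.card) ≤ 1.01 * D := by
    have h1 : √((1.01 : ℝ) ^ 2 * (cellCost x u J / U.card)) = 1.01 * D := by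
      rw [Real.sqrt_mul (by positivity), Real.sqrt_sq (by positivity)]
    rw [← h1]
    refine Real.sqrt_le_sqrt ?_
    rw [mul_div_assoc', div_le_div_iff₀ hU'0 hb0]
    nlinarith
  have hr' : r * (1 + e ^ 2 / 4) ≤ (1 + e) * ((J + 1) * √(e * V / U.card)) := by
    calc r * (1 + e ^ 2 / 4) ≤
        (1 + e / 2) * ((J + 1) * √(e * V / U.card)) * (1 + e ^ 2 / 4) := by gcongr
      _ = ((1 + e / 2) * (1 + e ^ 2 / 4)) * ((J + 1) * √(e * V / U.card)) := by ring
      _ ≤ _ := by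
        gcongr
        nlinarith [pow_pos he 3, mul_pos he he]
  have h1 : √(cellCost x u J / U'.card) * (2 * 0 * path.length + 0.36 * e + e ^ 2 / 8) ≤
      1.01 * D * (0.37 * e) := by
    gcongr
    nlinarith
  have h2 : ‖y - m‖ ≤ ‖y - famMean x U'‖ + ‖famMean x U' - m‖ :=
    norm_sub_le_norm_sub_add_norm_sub _ _ _
  rw [peelBound]
  have : 0 ≤ e * D := by positivity
  linarith

end Peeling

/-! ### Peeling: results, running time and success probability -/

/-- Is the point farther than `r` from all points of the list? -/
def isFar (r : ℝ) (path : List (Pt d)) (p : Pt d) : Bool :=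
  path.all fun c => !decide (‖p - c‖ ^ 2 ≤ r ^ 2)

theorem bd_outside (r : ℝ) (p : Pt d) : ∀ path : List (Pt d),
    Bd (outside r p path) (fun b => b = isFar r path p) (path.length * (3 * d + 2) + 1)
  | [] => bd_charge rfl (by omega)
  | c :: cs => by
    rw [outside]
    refine (bd_sqDist p c).bind (T := 2 + (cs.length * (3 * d + 2) + 1)) (fun s hs => ?_)
      (by simp only [List.length_cons]; ring_nf; omega)
    refine (bd_charge (P := fun i => i = decide (s ≤ r ^ 2)) rfl le_rfl).bind
      (T := cs.length * (3 * d + 2) + 1) (fun i hi => ?_) le_rfl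
    subst hi
    subst hs
    by_cases h : ‖p - c‖ ^ 2 ≤ r ^ 2
    · rw [if_pos (by simpa using h)]
      exact bd_pure (by simp [isFar, h])
    · rw [if_neg (by simpa using h)]
      refine (bd_outside r p cs).imp fun b hb => ?_
      simp [hb, isFar, h]

theorem length_antidiagonalTuple_le {N : ℕ} : ∀ (v m : ℕ), m ≤ N →
    (List.Nat.antidiagonalTuple v m).length ≤ (N + 1) ^ v
  | 0, 0, _ => by simp
  | 0, m + 1, _ => by simp
  | v + 1, m, hm => by
    rw [List.Nat.antidiagonalTuple, List.length_flatMap]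
    refine (List.sum_le_card_nsmul _ ((N + 1) ^ v) ?_).trans ?_
    · intro y hy
      obtain ⟨p, hp, rfl⟩ := List.mem_map.1 hy
      rw [List.length_map]
      have := List.Nat.mem_antidiagonal.1 hp
      exact length_antidiagonalTuple_le v p.2 (by omega)
    · rw [List.length_map, List.Nat.length_antidiagonal, smul_eq_mul, pow_succ, mul_comm]
      gcongr

theorem bd_simplexGrid {ε : ℝ} {V : List (Pt d)} {K : ℕ} (hV : V.length ≤ k)
    (hK : (simplexPoints ε V).length ≤ K) :
    Bd (simplexGrid ε V) (fun l => l = simplexPoints ε V) (K * (k * (2 * d + 2) + 1) + 1) := by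
  rw [simplexGrid]
  refine (bd_mapList_eq (T := k * (2 * d + 2)) fun a _ => bd_charge rfl (by gcongr)).mono
    (fun l hl => hl) ?_
  rw [simplexPoints, List.length_map] at hK
  gcongr

theorem length_radii (e δ : ℝ) (j : ℕ) :
    (radii n k e δ j).length = (Nat.clog 2 (k * n) + 1) * (⌈4 + 2 / e⌉₊ + 1) := by
  rw [radii, List.length_flatMap]
  simp

/-- A bound for the number of children of a node, given a bound `K` for the size of the grids. -/
def childCount (n k : ℕ) (e : ℝ) (K : ℕ) : ℕ :=
  (Nat.clog 2 (k * n) + 1) * (⌈4 + 2 / e⌉₊ + 1) * (2 ^ sampleSize k e * K + K)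

/-- A bound for the time that the children of a node for one radius candidate take. -/
def radiusTime (N k d z K : ℕ) : ℕ :=
  (N * (k * (3 * d + 2) + 1 + 1) + 1) +
    ((2 * z + 2 + 2 ^ z * (z + 1) + 2 ^ z * ((z + 1) * d + 1)) +
      ((2 ^ z * (k + (K * (k * (2 * d + 2) + 1) + 1) + K + 1) + 1) +
        ((K * (k * (2 * d + 2) + 1) + 1) + (2 ^ z * K + K))))

/-- A bound for the time that the children of a node take. -/
def childTime (n N k d : ℕ) (e : ℝ) (K : ℕ) : ℕ :=
  12 * ((Nat.clog 2 (k * n) + 1) * (⌈4 + 2 / e⌉₊ + 1)) +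
    ((Nat.clog 2 (k * n) + 1) * (⌈4 + 2 / e⌉₊ + 1) *
      (radiusTime N k d (sampleSize k e) K + (2 ^ sampleSize k e * K + K) + 1) + 1)

theorem bd_children (G : ChromaticInstance n k d) (e δ : ℝ) {path : List (Pt d)} {N K : ℕ}
    (hN : G.points.length ≤ N) (hpath : path.length < k)
    (hK : ∀ V : List (Pt d), V.length ≤ k → (simplexPoints (e ^ 2 / 4) V).length ≤ K) :
    Bd (children G e δ path) (fun cs => cs.length ≤ childCount n k e K)
      (childTime n N k d e K) := by
  rw [children]
  refine (bd_charge (P := fun R => R = radii n k e δ path.length) rfl (by rw [length_radii])).bind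
    (fun R hR => ?_) le_rfl
  have hRl : R.length = (Nat.clog 2 (k * n) + 1) * (⌈4 + 2 / e⌉₊ + 1) := by
    rw [hR, length_radii]
  rw [← hRl]
  refine (bd_flatMapList (R := fun _ _ => True) (M := 2 ^ sampleSize k e * K + K)
    (T := radiusTime N k d (sampleSize k e) K) fun r _ => ?_).imp fun cs hcs => ?_
  · refine (bd_filterList (T := k * (3 * d + 2) + 1) fun p _ =>
      (bd_outside r p path).le (by gcongr)).bind (fun rest hrest => ?_)
      (show G.points.length * (k * (3 * d + 2) + 1 + 1) + 1 + _ ≤ _ by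
        rw [radiusTime]; gcongr)
    refine (bd_sampleMeans (sampleSize k e) rest).bind (fun means hmeans => ?_) le_rfl
    refine (bd_flatMapList (R := fun _ _ => True) (M := K)
      (T := k + (K * (k * (2 * d + 2) + 1) + 1)) fun q _ => ?_).bind
      (T := (K * (k * (2 * d + 2) + 1) + 1) + (2 ^ sampleSize k e * K + K))
      (fun grids hgrids => ?_) (by gcongr)
    · refine (bd_charge (P := fun V => V = path ++ [q]) rfl (show _ ≤ k from hpath)).bind
        (fun V hV => ?_) le_rfl
      have hVl : V.length ≤ k := by rw [hV]; simpa using hpath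
      refine (bd_simplexGrid hVl (hK V hVl)).imp fun l hl => ⟨trivial, ?_⟩
      rw [hl]
      exact hK V hVl
    · refine (bd_simplexGrid hpath.le (hK path hpath.le)).bind (fun grid hgrid => ?_) le_rfl
      have h1 : grids.length + grid.length ≤ 2 ^ sampleSize k e * K + K := by
        refine add_le_add (hgrids.1.trans (Nat.mul_le_mul_right _ hmeans)) ?_
        rw [hgrid]
        exact hK path hpath.le
      exact bd_charge ⟨trivial, by rwa [List.length_append]⟩ h1
  · rw [childCount, ← hRl]
    exact hcs.1

/-- A bound for the time of growing `h` levels of the tree. -/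
def growTime (n N k d : ℕ) (e : ℝ) (K : ℕ) : ℕ → ℕ
  | 0 => 1
  | h + 1 => childTime n N k d e K +
      (childCount n k e K * (k + growTime n N k d e K h + 1) + 1)

theorem bd_grow (G : ChromaticInstance n k d) (e δ : ℝ) {N K : ℕ}
    (hN : G.points.length ≤ N)
    (hK : ∀ V : List (Pt d), V.length ≤ k → (simplexPoints (e ^ 2 / 4) V).length ≤ K) :
    ∀ (h : ℕ) (path : List (Pt d)), path.length + h ≤ k →
      Bd (grow G e δ h path) (fun T => (PeelingTree.paths h T).length ≤ childCount n k e K ^ h)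
        (growTime n N k d e K h)
  | 0, path, _ => bd_charge (by simp [PeelingTree.paths]) le_rfl
  | h + 1, path, hpath => by
    rw [grow]
    refine (bd_children G e δ hN (by omega) hK).bind
      (T := childCount n k e K * (k + growTime n N k d e K h + 1) + 1) (fun cs hcs => ?_) le_rfl
    refine (bd_mapList (R := fun _ (c : Pt d × PeelingTree d h) =>
      (PeelingTree.paths h c.2).length ≤ childCount n k e K ^ h)
      (T := k + growTime n N k d e K h) fun p _ => ?_).mono (fun T hT => ?_) (by gcongr)
    · refine (bd_charge (P := fun V => V = path ++ [p]) rfl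
        (show path.length + 1 ≤ k by omega)).bind (fun V hV => ?_) le_rfl
      refine (bd_grow G e δ hN hK h V (by rw [hV]; simp; omega)).bind (T := 0)
        (fun T hT => bd_pure hT) le_rfl
    · change (List.flatMap (fun c : Pt d × PeelingTree d h => (PeelingTree.paths h c.2).map
        fun f => (Fin.cons c.1 f : Fin (h + 1) → Pt d)) T).length ≤ _
      rw [List.length_flatMap]
      refine (List.sum_le_card_nsmul _ (childCount n k e K ^ h) ?_).trans ?_
      · intro y hy
        obtain ⟨c, hc, rfl⟩ := List.mem_map.1 hy
        rw [List.length_map]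
        clear hpath hy
        induction hT with
        | nil => simp at hc
        | cons h1 _ ih =>
          rcases List.mem_cons.1 hc with rfl | hc
          · exact h1
          · refine ih ?_ hc
            simp only [List.length_cons] at hcs
            omega
      · rw [List.length_map, ← hT.length_eq, smul_eq_mul, pow_succ, mul_comm]
        gcongr

theorem exists_mem_simplexPoints (ε : ℝ) {V : List (Pt d)} (hV : V ≠ []) :
    ∃ y, y ∈ simplexPoints ε V := by
  have h0 : 0 < V.length := List.length_pos_iff.2 hV
  have h1 : (fun i => if i = ⟨0, h0⟩ then ⌊2 * (V.length : ℝ) ^ 2 / ε⌋₊ + 1 else 0) ∈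
      List.Nat.antidiagonalTuple V.length (⌊2 * (V.length : ℝ) ^ 2 / ε⌋₊ + 1) := by
    rw [List.Nat.mem_antidiagonalTuple, Finset.sum_ite_eq']
    simp
  exact ⟨_, List.mem_map.2 ⟨_, h1, rfl⟩⟩

theorem le_prob_children_of_grid (G : ChromaticInstance n k d) {e δ r : ℝ} {path : List (Pt d)}
    (hr : r ∈ radii n k e δ path.length) {y : Pt d} (hy : y ∈ simplexPoints (e ^ 2 / 4) path)
    {S : Pt d → Prop} (hS : S y) : 1 ≤ (children G e δ path).prob (fun cs => ∃ p ∈ cs, S p) := by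
  rw [children]
  refine (bd_charge (P := fun R => R = radii n k e δ path.length) rfl le_rfl).le_prob_bind
    fun R hR => ?_
  subst hR
  refine le_prob_flatMapList hr ?_
  refine le_prob_bind_of_forall fun rest => le_prob_bind_of_forall fun means =>
    le_prob_bind_of_forall fun grids => ?_
  refine (bd_simplexGrid (k := path.length) le_rfl le_rfl).le_prob_bind fun grid hgrid => ?_
  exact le_prob_charge le_rfl ⟨y, by simp [hgrid, hy], hS⟩

theorem le_prob_children_of_sample (G : ChromaticInstance n k d) {e δ r : ℝ}
    {path : List (Pt d)} (hr : r ∈ radii n k e δ path.length) {S : Pt d → Prop} {q : ENNReal}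
    (h : q ≤ (sampleMeans (sampleSize k e) (G.points.filter (isFar r path))).prob
      (fun ms => ∃ π ∈ ms, ∃ y ∈ simplexPoints (e ^ 2 / 4) (path ++ [π]), S y)) :
    q ≤ (children G e δ path).prob (fun cs => ∃ p ∈ cs, S p) := by
  rw [children]
  refine (bd_charge (P := fun R => R = radii n k e δ path.length) rfl le_rfl).le_prob_bind
    fun R hR => ?_
  subst hR
  refine le_prob_flatMapList hr ?_
  refine (bd_filterList fun p _ => bd_outside r p path).le_prob_bind fun rest hrest => ?_
  subst hrest
  rw [← mul_one q]
  refine le_prob_bind h ?_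
  rintro means ⟨π, hπ, y, hy, hS⟩
  have h1 : 1 ≤ (flatMapList (fun q => do
      let V ← charge (path.length + 1) (path ++ [q])
      simplexGrid (e ^ 2 / 4) V) means).prob (fun l => ∃ p ∈ l, S p) := by
    refine le_prob_flatMapList hπ ?_
    refine (bd_charge (P := fun V => V = path ++ [π]) rfl le_rfl).le_prob_bind fun V hV => ?_
    subst hV
    refine ((bd_simplexGrid (k := (path ++ [π]).length) le_rfl le_rfl).imp
      fun l hl => ?_).prob_eq_one.ge
    exact ⟨y, hl ▸ hy, hS⟩
  rw [← mul_one 1]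
  refine le_prob_bind h1 ?_
  rintro grids ⟨p, hp, hpS⟩
  refine le_prob_bind_of_forall fun grid => ?_
  exact le_prob_charge le_rfl ⟨p, by simp [hp], hpS⟩

/-- Among the radius candidates there is a good approximation of the radius wanted for a cell of
`b` out of `N` points. The exponent `t` is chosen to be the least one with `N ≤ 2 ^ t b`. -/
theorem exists_radius {e V δ : ℝ} {b N : ℕ} (he : 0 < e) (hV : 0 ≤ V) (hb : 0 < b)
    (hbN : b ≤ N) (hN : N ≤ k * n) (hδ : √(V / N) ≤ δ) (hδ' : δ ≤ (1 + e) * √(V / N)) (j : ℕ) :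
    ∃ r ∈ radii n k e δ j, (j + 1) * √(e * V / b) ≤ r ∧
      r ≤ (1 + e / 2) * ((j + 1) * √(e * V / b)) := by
  classical
  have hb0 : (0 : ℝ) < b := by exact_mod_cast hb
  have hN0 : (0 : ℝ) < N := by exact_mod_cast hb.trans_le hbN
  have hex : ∃ t, N ≤ 2 ^ t * b :=
    ⟨Nat.clog 2 (k * n), hN.trans ((Nat.le_pow_clog (by norm_num) _).trans
      (Nat.le_mul_of_pos_right _ hb))⟩
  set t := Nat.find hex with ht
  have ht1 : N ≤ 2 ^ t * b := Nat.find_spec hex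
  have htle : t ≤ Nat.clog 2 (k * n) := Nat.find_min' hex
    (hN.trans ((Nat.le_pow_clog (by norm_num) _).trans (Nat.le_mul_of_pos_right _ hb)))
  have ht2 : 2 ^ t * b ≤ 2 * N := by
    rcases Nat.eq_zero_or_pos t with h0 | h0
    · rw [h0]; omega
    · have := Nat.find_min hex (m := t - 1) (by omega)
      have e1 : 2 ^ t = 2 * 2 ^ (t - 1) := by
        rw [← pow_succ']; congr 1; omega
      rw [e1, mul_assoc]
      omega
  have ht1r : (N : ℝ) ≤ 2 ^ t * b := by exact_mod_cast ht1
  have ht2r : (2 : ℝ) ^ t * b ≤ 2 * N := by exact_mod_cast ht2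
  have hmem : ∀ l : ℕ, l ≤ ⌈4 + 2 / e⌉₊ →
      (1 + l * (e / 2)) / (2 * (1 + e)) * (j + 1) * √(2 ^ t) * √e * δ ∈ radii n k e δ j := by
    intro l hl
    rw [radii, List.mem_flatMap]
    refine ⟨t, List.mem_range.2 (by omega), List.mem_map.2 ⟨(l : ℝ), ?_, rfl⟩⟩
    simpa using (by omega : l < ⌈4 + 2 / e⌉₊ + 1)
  rcases (Real.sqrt_nonneg (V / N)).eq_or_lt with h0 | h0
  · -- the optimal cost is zero
    have hδ0 : δ = 0 := by rw [← h0] at hδ hδ'; linarith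
    have hV0 : V = 0 := by
      have h1 := (Real.sqrt_eq_zero (by positivity)).1 h0.symm
      rcases div_eq_zero_iff.1 h1 with h1 | h1
      · exact h1
      · exact absurd h1 hN0.ne'
    refine ⟨_, hmem 0 (Nat.zero_le _), ?_⟩
    simp [hδ0, hV0]
  · have hδ0 : 0 < δ := h0.trans_le hδ
    set D := √(V / N) with hD
    set ω := √(N / (2 ^ t * b)) with hω
    have hω1 : ω ≤ 1 := by
      rw [hω]
      refine Real.sqrt_le_one.2 ?_
      exact div_le_one_of_le₀ ht1r (by positivity)
    have hω2 : 1 / 2 ≤ ω := by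
      refine Real.le_sqrt_of_sq_le ?_
      rw [le_div_iff₀ (by positivity)]
      linarith
    set y := 2 * (1 + e) * ω * (D / δ) with hy
    have hyδ : y * δ = 2 * (1 + e) * ω * D := by
      rw [hy]; field_simp
    have hy1 : 1 ≤ y := by
      have : 1 * δ ≤ y * δ := by
        rw [hyδ, one_mul]
        calc δ ≤ (1 + e) * D := hδ'
          _ = 2 * (1 + e) * (1 / 2) * D := by ring
          _ ≤ 2 * (1 + e) * ω * D := by gcongr
      exact le_of_mul_le_mul_right this hδ0
    have hy2 : y ≤ 2 * (1 + e) := by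
      have : y * δ ≤ 2 * (1 + e) * δ := by
        rw [hyδ]
        calc 2 * (1 + e) * ω * D ≤ 2 * (1 + e) * 1 * δ := by gcongr
          _ = _ := by ring
      exact le_of_mul_le_mul_right this hδ0
    set l := ⌈(y - 1) / (e / 2)⌉₊ with hl
    have hl1 : y - 1 ≤ l * (e / 2) := by
      have := Nat.le_ceil ((y - 1) / (e / 2))
      rwa [div_le_iff₀ (by positivity)] at this
    have hl2 : l * (e / 2) ≤ y - 1 + e / 2 := by
      have := (Nat.ceil_lt_add_one (a := (y - 1) / (e / 2))
        (div_nonneg (by linarith) (by positivity))).le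
      have h2 := mul_le_mul_of_nonneg_right this (by positivity : 0 ≤ e / 2)
      rw [add_mul, div_mul_cancel₀ _ (by positivity : e / 2 ≠ 0), one_mul] at h2
      exact h2
    have hl3 : l ≤ ⌈4 + 2 / e⌉₊ := by
      refine Nat.ceil_le_ceil ?_
      rw [div_le_iff₀ (by positivity)]
      have : (4 + 2 / e) * (e / 2) = 2 * e + 1 := by field_simp; ring
      linarith
    have hR : (j + 1) * √(e * V / b) = y / (2 * (1 + e)) * (j + 1) * √(2 ^ t) * √e * δ := by
      have h1 : √(e * V / b) = ω * √(2 ^ t) * √e * D := by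
        rw [hω, hD, ← Real.sqrt_mul (by positivity), ← Real.sqrt_mul (by positivity),
          ← Real.sqrt_mul (by positivity)]
        congr 1
        field_simp
      rw [h1]
      have h2 : ω * D = y / (2 * (1 + e)) * δ := by
        rw [div_mul_eq_mul_div, hyδ]
        field_simp
      calc (j + 1) * (ω * √(2 ^ t) * √e * D) = (j + 1) * √(2 ^ t) * √e * (ω * D) := by ring
        _ = _ := by rw [h2]; ring
    refine ⟨_, hmem l hl3, ?_, ?_⟩
    · rw [hR]
      gcongr
      linarith
    · rw [hR]
      have h3 : (1 + l * (e / 2)) ≤ (1 + e / 2) * y := by nlinarith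
      calc (1 + l * (e / 2)) / (2 * (1 + e)) * (j + 1) * √(2 ^ t) * √e * δ
          ≤ ((1 + e / 2) * y) / (2 * (1 + e)) * (j + 1) * √(2 ^ t) * √e * δ := by gcongr
        _ = _ := by ring

/-! ### Success probability of the peeling tree -/

/-- The points of an instance as one family. -/
def ChromaticInstance.point (G : ChromaticInstance n k d) (i : (i : Fin n) × Fin (G.size i)) :
    Pt d :=
  G.pt i.1 i.2

theorem GoodPath.append {ι : Type} [Fintype ι] {x : ι → Pt d} {u : ι → ℕ} {V e : ℝ}
    {path : List (Pt d)} {p : Pt d} (h : GoodPath x u V e path)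
    (hp : (optCell u path.length).Nonempty →
      ‖p - famMean x (optCell u path.length)‖ ≤ peelBound x u V e path.length) :
    GoodPath x u V e (path ++ [p]) := by
  intro l hl hne
  rcases Nat.lt_or_ge l path.length with h1 | h1
  · rw [List.getElem_append_left h1]
    exact h l h1 hne
  · have h2 : l = path.length := by
      rw [List.length_append, List.length_singleton] at hl
      omega
    subst h2
    simpa using hp hne

theorem mem_farPoints_iff {ι : Type} [Fintype ι] {x : ι → Pt d} {r : ℝ} {path : List (Pt d)}
    {i : ι} : i ∈ farPoints x r path ↔ isFar r path (x i) = true := by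
  simp [farPoints, isFar]

/-- The samples are large enough: a sample of a set of at most `80 b / e ^ 3` points has, with the
failure probability allowed per level, a subset whose mean approximates the mean of a given subset
of `b` points. -/
theorem sampleSize_bounds {e m b : ℝ} (hk : 2 ≤ k) (he : 0 < e) (he16 : e ≤ 1 / 16) (hb : 0 < b)
    (hm : e ^ 3 * m ≤ 80 * b) :
    0 < sampleSize k e ∧ 4 * m / (sampleSize k e * b) + 1 / (8 * k) ≤ 1 / (4 * k) ∧
      4 * (8 * k) * m / (sampleSize k e * b) ≤ e ^ 4 := by
  have hk2 : (2 : ℝ) ≤ k := by exact_mod_cast hk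
  have hk0 : (0 : ℝ) < k := by linarith
  have hz : 8 * (k : ℝ) ^ 3 / e ^ 9 ≤ sampleSize k e := by
    have hlog : 1 ≤ Real.log ((k : ℝ) ^ 2 / e ^ 6) := by
      rw [Real.le_log_iff_exp_le (by positivity), le_div_iff₀ (by positivity)]
      have h1 : e ^ 6 ≤ 1 := pow_le_one₀ he.le (by linarith)
      have h2 := Real.exp_one_lt_d9
      have h3 := Real.exp_pos 1
      nlinarith
    refine le_trans ?_ (Nat.le_ceil _)
    exact le_mul_of_one_le_right (by positivity) hlog
  have hz0 : (0 : ℝ) < sampleSize k e := lt_of_lt_of_le (by positivity) hz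
  have hzm : 8 * (k : ℝ) ^ 3 * m ≤ 80 * e ^ 6 * (sampleSize k e * b) := by
    rw [div_le_iff₀ (by positivity)] at hz
    have h1 : e ^ 3 * (8 * (k : ℝ) ^ 3 * m) ≤ e ^ 3 * (80 * e ^ 6 * (sampleSize k e * b)) := by
      calc e ^ 3 * (8 * (k : ℝ) ^ 3 * m) = 8 * (k : ℝ) ^ 3 * (e ^ 3 * m) := by ring
        _ ≤ 8 * (k : ℝ) ^ 3 * (80 * b) := by gcongr
        _ ≤ (sampleSize k e * e ^ 9) * (80 * b) := by gcongr
        _ = _ := by ring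
    exact le_of_mul_le_mul_left h1 (by positivity)
  have he2 : e ^ 2 ≤ 1 / 256 := by nlinarith
  have he4 : 0 < e ^ 4 := by positivity
  have he6 : e ^ 6 ≤ 1 / 256 * e ^ 4 := by nlinarith [mul_le_mul_of_nonneg_right he2 he4.le]
  have he41 : e ^ 4 ≤ 1 / 65536 := by nlinarith [sq_nonneg e]
  have hzb : 0 < sampleSize k e * b := by positivity
  refine ⟨by exact_mod_cast hz0, ?_, ?_⟩
  · have h1 : 4 * m / (sampleSize k e * b) ≤ 1 / (8 * k) := by
      rw [div_le_div_iff₀ hzb (by positivity)]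
      have h2 : (k : ℝ) ^ 2 * (4 * m * (8 * k)) ≤ (k : ℝ) ^ 2 * (1 * (sampleSize k e * b)) := by
        have h4 : 320 * e ^ 6 ≤ (k : ℝ) ^ 2 := by nlinarith
        have h5 := mul_le_mul_of_nonneg_right h4 hzb.le
        calc (k : ℝ) ^ 2 * (4 * m * (8 * k)) = 4 * (8 * (k : ℝ) ^ 3 * m) := by ring
          _ ≤ 4 * (80 * e ^ 6 * (sampleSize k e * b)) := by linarith
          _ = 320 * e ^ 6 * (sampleSize k e * b) := by ring
          _ ≤ _ := by linarith
      exact le_of_mul_le_mul_left h2 (by positivity)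
    have h2 : (1 : ℝ) / (4 * k) = 1 / (8 * k) + 1 / (8 * k) := by field_simp; norm_num
    linarith
  · rw [div_le_iff₀ hzb]
    have h2 : (k : ℝ) ^ 2 * (4 * (8 * k) * m) ≤
        (k : ℝ) ^ 2 * (e ^ 4 * (sampleSize k e * b)) := by
      have h4 : 320 * e ^ 6 ≤ (k : ℝ) ^ 2 * e ^ 4 := by
        have h3 : (2 : ℝ) ^ 2 * e ^ 4 ≤ (k : ℝ) ^ 2 * e ^ 4 := by gcongr
        linarith
      have h5 := mul_le_mul_of_nonneg_right h4 hzb.le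
      calc (k : ℝ) ^ 2 * (4 * (8 * k) * m) = 4 * (8 * (k : ℝ) ^ 3 * m) := by ring
        _ ≤ 4 * (80 * e ^ 6 * (sampleSize k e * b)) := by linarith
        _ = 320 * e ^ 6 * (sampleSize k e * b) := by ring
        _ ≤ _ := by linarith
    exact le_of_mul_le_mul_left h2 (by positivity)

/-- If many points of the next cell are far from the path, then the mean of a suitable subset of
the sample, together with the path, spans a simplex with a good grid point. -/
theorem le_prob_children_of_many (G : ChromaticInstance n k d) (hk : 2 ≤ k)
    {u : (i : Fin n) × Fin (G.size i) → ℕ} {V e δ r : ℝ}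
    (he : 0 < e) (he16 : e ≤ 1 / 16) (hek : e * k ≤ 1 / 4)
    {path : List (Pt d)} (hlen : path.length < k)
    (hmem : r ∈ radii n k e δ path.length) (hr0 : 0 ≤ r)
    (hr : r ≤ (1 + e / 2) * ((path.length + 1) * √(e * V / (optCell u path.length).card)))
    (hne : (optCell u path.length).Nonempty)
    (hfar : e * (farPoints G.point r path).card ≤
      5 * (optCell u path.length).card)
    (O : Finset ((i : Fin n) × Fin (G.size i)))
    (hO : ∀ i, i ∈ O ↔ i ∈ optCell u path.length ∧
      i ∈ farPoints G.point r path)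
    (hmany : e ^ 2 / 16 * (optCell u path.length).card ≤ O.card) :
    1 - ENNReal.ofReal (1 / (4 * k)) ≤ (children G e δ path).prob (fun cs => ∃ p ∈ cs,
      ‖p - famMean G.point (optCell u path.length)‖ ≤
        peelBound G.point u V e path.length) := by
  classical
  set x : (i : Fin n) × Fin (G.size i) → Pt d := G.point with hx
  have hb0 : (0 : ℝ) < (optCell u path.length).card := by exact_mod_cast hne.card_pos
  have hO0 : (0 : ℝ) < O.card := lt_of_lt_of_le (by positivity) hmany
  have hOne : O.Nonempty := Finset.card_pos.1 (by exact_mod_cast hO0)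
  refine le_prob_children_of_sample G hmem ?_
  have hlist : G.points.filter (isFar r path) =
      (G.indices.filter (fun i => isFar r path (x i))).map x := by
    rw [← G.map_indices, List.filter_map]
    rfl
  have hcard : (G.indices.filter (fun i => isFar r path (x i))).length =
      (farPoints x r path).card := by
    rw [G.length_filter_indices]
    congr 1
    ext i
    simp [mem_farPoints_iff]
  have hOfar : O.card ≤ (farPoints x r path).card :=
    Finset.card_le_card fun i hi => ((hO i).1 hi).2
  have hfilter : ∀ {M : Type} [AddCommMonoid M] (f : (i : Fin n) × Fin (G.size i) → M),
      (((G.indices.filter (fun i => isFar r path (x i))).filter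
        fun i => decide (u i = path.length)).map f).sum = ∑ i ∈ O, f i := by
    intro M _ f
    rw [List.filter_filter, G.sum_map_filter_indices]
    refine Finset.sum_congr ?_ fun _ _ => rfl
    ext i
    rw [hO, mem_farPoints_iff]
    simp [optCell]
  rw [hlist]
  cases hl : G.indices.filter (fun i => isFar r path (x i)) with
  | nil =>
    rw [hl] at hcard
    have := hOne.card_pos
    simp only [List.length_nil] at hcard
    omega
  | cons a l =>
    rw [hl] at hcard hfilter
    have hm : e ^ 3 * ((l.length + 1 : ℕ) : ℝ) ≤ 80 * O.card := by
      rw [List.length_cons] at hcard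
      rw [hcard]
      calc e ^ 3 * ((farPoints x r path).card : ℝ) = e ^ 2 * (e * (farPoints x r path).card) := by
            ring
        _ ≤ e ^ 2 * (5 * (optCell u path.length).card) := by gcongr
        _ = 80 * (e ^ 2 / 16 * (optCell u path.length).card) := by ring
        _ ≤ 80 * O.card := by gcongr
    obtain ⟨hz, h1, h2⟩ := sampleSize_bounds hk he he16 hO0 hm
    have hk0 : (0 : ℝ) < k := by
      have : (0 : ℝ) < (k : ℝ) := by exact_mod_cast (by omega : 0 < k)
      exact this
    refine le_trans ?_ ((le_prob_sampleMeans x a l (fun i => decide (u i = path.length))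
      (sampleSize k e) hz (T := 8 * k) (by positivity) (famMean x O)
      (∑ i ∈ O, ‖x i - famMean x O‖ ^ 2) O.card hO0 ?_ ?_ ?_).trans (prob_mono ?_))
    · exact tsub_le_tsub_left (ENNReal.ofReal_le_ofReal h1) _
    · have := hfilter (M := ℕ) fun _ => 1
      simp only [List.map_const', List.sum_replicate, smul_eq_mul, mul_one,
        Finset.sum_const] at this
      rw [this]
    · rw [card_smul_famMean, hfilter]
    · rw [hfilter]
    · rintro ms ⟨π, hπ, hle⟩
      refine ⟨π, hπ, ?_⟩
      refine exists_child_of_sample he he16 hek hlen hr0 hr O hO hOne (hle.trans ?_)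
      gcongr

/-- A good path extends to a child with high probability. -/
theorem le_prob_children (G : ChromaticInstance n k d) (hk : 2 ≤ k)
    {u : (i : Fin n) × Fin (G.size i) → ℕ} {V e δ : ℝ} (huk : ∀ i, u i < k)
    (hanti : ∀ i j, i ≤ j → (optCell u j).card ≤ (optCell u i).card)
    (h0 : (optCell u 0).Nonempty)
    (hV : ∑ l ∈ Finset.range k, cellCost G.point u l ≤ V) (he : 0 < e)
    (he16 : e ≤ 1 / 16) (hek : e * k ≤ 1 / 4)
    (hδ : √(V / G.points.length) ≤ δ) (hδ' : δ ≤ (1 + e) * √(V / G.points.length))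
    {path : List (Pt d)} (hlen : path.length < k)
    (hpath : GoodPath G.point u V e path) :
    1 - ENNReal.ofReal (1 / (4 * k)) ≤ (children G e δ path).prob (fun cs => ∃ p ∈ cs,
      GoodPath G.point u V e (path ++ [p])) := by
  classical
  set x : (i : Fin n) × Fin (G.size i) → Pt d := G.point with hx
  have hV0 : 0 ≤ V := (Finset.sum_nonneg fun l _ => cellCost_nonneg l).trans hV
  have hle : ∀ j, (optCell u j).card ≤ G.points.length := fun j => by
    rw [G.length_points]
    exact Finset.card_le_univ _
  by_cases hne : (optCell u path.length).Nonempty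
  · obtain ⟨r, hmem, hr1, hr2⟩ := exists_radius he hV0 hne.card_pos (hle _)
      G.length_points_le hδ hδ' path.length
    have hr0 : 0 ≤ r := le_trans (by positivity) hr1
    set O := (farPoints x r path).filter fun i => u i = path.length with hOdef
    have hO : ∀ i, i ∈ O ↔ i ∈ optCell u path.length ∧ i ∈ farPoints x r path := fun i => by
      simp [hOdef, optCell, and_comm]
    rcases lt_or_ge (O.card : ℝ) (e ^ 2 / 16 * (optCell u path.length).card) with h | h
    · obtain ⟨y, hy, hyle⟩ := exists_child_of_few he he16 hr0 hr2 O hO h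
      exact tsub_le_self.trans (le_prob_children_of_grid G hmem hy (hpath.append fun _ => hyle))
    · exact (le_prob_children_of_many G hk he he16 hek hlen hmem hr0 hr2 hne
        (card_farPoints_le huk hanti hV he he16 hek hpath hlen hne hr1) O hO h).trans
        (prob_mono fun cs ⟨p, hp, hple⟩ => ⟨p, hp, hpath.append fun _ => hple⟩)
  · -- for an empty cell every child will do
    have hnil : path ≠ [] := by
      rintro rfl
      exact hne h0
    obtain ⟨r, hmem, -⟩ := exists_radius he hV0 h0.card_pos (hle _)
      G.length_points_le hδ hδ' path.length
    obtain ⟨y, hy⟩ := exists_mem_simplexPoints (e ^ 2 / 4) hnil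
    exact tsub_le_self.trans (le_prob_children_of_grid G hmem hy
      (hpath.append fun h => absurd h hne))

/-- If every path with the property `S` extends with probability at least `q`, then `h` levels
extend it with probability at least `q ^ h`. -/
theorem le_prob_grow (G : ChromaticInstance n k d) {e δ : ℝ} {S : List (Pt d) → Prop}
    {q : ENNReal}
    (h : ∀ path : List (Pt d), path.length < k → S path →
      q ≤ (children G e δ path).prob (fun cs => ∃ p ∈ cs, S (path ++ [p]))) :
    ∀ (h : ℕ) (path : List (Pt d)), path.length + h = k → S path →
      q ^ h ≤ (grow G e δ h path).prob (fun T => ∃ f ∈ T.paths h, S (path ++ List.ofFn f))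
  | 0, path, _, hS => by
    rw [pow_zero]
    exact le_prob_charge le_rfl ⟨fun i => i.elim0, by simp [PeelingTree.paths], by simpa using hS⟩
  | m + 1, path, hlen, hS => by
    rw [grow, pow_succ']
    refine le_prob_bind (h path (by omega) hS) ?_
    rintro cs ⟨p, hp, hpS⟩
    refine (le_prob_mapList (S := fun c : Pt d × PeelingTree d m =>
      ∃ f ∈ c.2.paths m, S (path ++ List.ofFn (Fin.cons c.1 f : Fin (m + 1) → Pt d))) hp ?_).trans
      (prob_mono ?_)
    · refine (bd_charge (P := fun V => V = path ++ [p]) rfl le_rfl).le_prob_bind fun V hV => ?_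
      subst hV
      rw [← mul_one (q ^ m)]
      refine le_prob_bind (le_prob_grow G h m (path ++ [p]) (by simp; omega) hpS) ?_
      rintro T ⟨f, hf, hfS⟩
      refine le_prob_charge le_rfl ⟨f, hf, ?_⟩
      rw [List.ofFn_cons]
      simpa using hfS
    · rintro T ⟨c, hc, f, hf, hfS⟩
      exact ⟨_, List.mem_flatMap.2 ⟨c, hc, List.mem_map.2 ⟨f, hf, rfl⟩⟩, hfS⟩

/-! ### The success probability of the algorithm -/

/-- The function that assigns to every point the number of its cell. -/
def ChromaticPartition.cellIndex {G : ChromaticInstance n k d} (U : ChromaticPartition G)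
    (i : (i : Fin n) × Fin (G.size i)) : ℕ :=
  U i.1 i.2

theorem mem_optCell {ι : Type} [Fintype ι] {u : ι → ℕ} {j : ℕ} {i : ι} :
    i ∈ optCell u j ↔ u i = j := by
  simp [optCell]

theorem optCell_cellIndex {G : ChromaticInstance n k d} (U : ChromaticPartition G) (j : Fin k) :
    optCell U.cellIndex j = U.cell j := by
  ext i
  rw [mem_optCell]
  simp [ChromaticPartition.cell, ChromaticPartition.cellIndex, Fin.ext_iff]

/-- The cost for arbitrary centers, compared with the cost for the means of the cells. -/
theorem totalCost_eq_sum_cellCost_add (G : ChromaticInstance n k d) (m : Fin k → Pt d)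
    (U : ChromaticPartition G) :
    totalCost G m U = ∑ j : Fin k, (cellCost G.point U.cellIndex j +
      (optCell U.cellIndex j).card *
        ‖famMean G.point (optCell U.cellIndex j) - m j‖ ^ 2) := by
  rw [totalCost_eq_sum_cell]
  refine Finset.sum_congr rfl fun j _ => ?_
  rw [← optCell_cellIndex, cellCost, ← sum_norm_sub_sq_famMean]
  rfl

/-- There is an optimal solution whose centers are the means of the cells, with the cells sorted by
decreasing size. -/
theorem exists_sorted_optimum (G : ChromaticInstance n k d) :
    ∃ (m : Fin k → Pt d) (U : ChromaticPartition G),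
      (∀ m' U', totalCost G m U ≤ totalCost G m' U') ∧
      totalCost G m U = ∑ j : Fin k, cellCost G.point U.cellIndex j ∧
      ∀ i j, i ≤ j → (optCell U.cellIndex j).card ≤ (optCell U.cellIndex i).card := by
  classical
  have : Finite (ChromaticPartition G) :=
    inferInstanceAs (Finite ((i : Fin n) → Fin (G.size i) ↪ Fin k))
  have : Nonempty (ChromaticPartition G) := ⟨fun i => Fin.castLEEmb (G.size_le i)⟩
  obtain ⟨U₀, hU₀⟩ := Finite.exists_min fun U : ChromaticPartition G =>
    ∑ j : Fin k, cellCost G.point U.cellIndex j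
  -- sorting in the order dual makes the sizes decrease
  set f : Fin k → ℕᵒᵈ := fun j => OrderDual.toDual (optCell U₀.cellIndex j).card with hf
  set σ := Tuple.sort f with hσ
  have hmono : Monotone (f ∘ σ) := Tuple.monotone_sort f
  set U : ChromaticPartition G := fun i => (U₀ i).trans σ.symm.toEmbedding with hU
  have hcell : ∀ j : Fin k, optCell U.cellIndex j = optCell U₀.cellIndex (σ j : Fin k) := by
    intro j
    rw [optCell_cellIndex, optCell_cellIndex]
    ext i
    simp [ChromaticPartition.cell, hU, Equiv.symm_apply_eq]
  have hcost : ∑ j : Fin k, cellCost G.point U.cellIndex j =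
      ∑ j : Fin k, cellCost G.point U₀.cellIndex j := by
    rw [← Equiv.sum_comp σ fun j : Fin k => cellCost G.point U₀.cellIndex j]
    refine Finset.sum_congr rfl fun j _ => ?_
    rw [cellCost, cellCost, hcell]
  have htotal : totalCost G (fun j => famMean G.point (optCell U.cellIndex j)) U =
      ∑ j : Fin k, cellCost G.point U.cellIndex j := by
    rw [totalCost_eq_sum_cellCost_add]
    simp
  refine ⟨fun j => famMean G.point (optCell U.cellIndex j), U, fun m' U' => ?_, htotal, ?_⟩
  · rw [htotal, hcost, totalCost_eq_sum_cellCost_add G m' U']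
    refine (hU₀ U').trans (Finset.sum_le_sum fun j _ => ?_)
    exact le_add_of_nonneg_right (by positivity)
  · intro i j hij
    by_cases hj : j < k
    · have h1 := hmono (a := ⟨i, hij.trans_lt hj⟩) (b := ⟨j, hj⟩) hij
      have h2 := hcell ⟨i, hij.trans_lt hj⟩
      have h3 := hcell ⟨j, hj⟩
      simp only at h2 h3
      rw [h2, h3]
      exact h1
    · have : optCell U.cellIndex j = ∅ := by
        refine Finset.filter_eq_empty_iff.2 fun i _ h => hj ?_
        rw [← h]
        exact (U i.1 i.2).2
      rw [this]
      exact Nat.zero_le _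

/-- The points on a good path are nearly optimal centers for the optimal partition. -/
theorem totalCost_le_of_goodPath (G : ChromaticInstance n k d) (U : ChromaticPartition G)
    {V e ε : ℝ} (hk : 2 ≤ k) (hV : V = ∑ j : Fin k, cellCost G.point U.cellIndex j) (he : 0 < e)
    (heε : 100 * k ^ 3 * e ≤ ε) (hε : ε ≤ 1) {f : Fin k → Pt d}
    (hf : GoodPath G.point U.cellIndex V e (List.ofFn f)) :
    totalCost G f U ≤ (1 + ε) * V := by
  have hk2 : (2 : ℝ) ≤ k := by exact_mod_cast hk
  have hv0 : ∀ j, 0 ≤ cellCost G.point U.cellIndex j := cellCost_nonneg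
  have hV0 : 0 ≤ V := hV ▸ Finset.sum_nonneg fun j _ => hv0 j
  have hk3 : (8 : ℝ) ≤ (k : ℝ) ^ 3 := by
    calc (8 : ℝ) = 2 ^ 3 := by norm_num
      _ ≤ (k : ℝ) ^ 3 := by gcongr
  have he1 : e ≤ 1 / 100 := by nlinarith
  have hterm : ∀ j : Fin k, (optCell U.cellIndex j).card *
      ‖famMean G.point (optCell U.cellIndex j) - f j‖ ^ 2 ≤
        2 * e ^ 2 * cellCost G.point U.cellIndex j + 2 * (1 + e) ^ 2 * k ^ 2 * e * V := by
    intro j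
    have hvj := hv0 j
    rcases (optCell U.cellIndex j).eq_empty_or_nonempty with h0 | hne
    · rw [h0, Finset.card_empty, Nat.cast_zero, zero_mul]
      positivity
    · have hb : (0 : ℝ) < (optCell U.cellIndex j).card := by exact_mod_cast hne.card_pos
      have h1 := hf j (by simp) hne
      rw [List.getElem_ofFn, norm_sub_rev, peelBound] at h1
      set b : ℝ := ((optCell U.cellIndex j).card : ℝ) with hbdef
      set v := cellCost G.point U.cellIndex j with hv
      have hs1 : √(v / b) ^ 2 = v / b := Real.sq_sqrt (by positivity)
      have hs2 : √(e * V / b) ^ 2 = e * V / b := Real.sq_sqrt (by positivity)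
      have hj : ((j : ℕ) : ℝ) + 1 ≤ k := by exact_mod_cast j.2
      calc b * ‖famMean G.point (optCell U.cellIndex j) - f j‖ ^ 2
          ≤ b * (e * √(v / b) + (1 + e) * ((j + 1) * √(e * V / b))) ^ 2 := by
            gcongr
        _ ≤ b * (2 * (e * √(v / b)) ^ 2 + 2 * ((1 + e) * ((j + 1) * √(e * V / b))) ^ 2) := by
            gcongr
            nlinarith [sq_nonneg (e * √(v / b) - (1 + e) * ((j + 1) * √(e * V / b)))]
        _ = 2 * e ^ 2 * v + 2 * (1 + e) ^ 2 * (j + 1) ^ 2 * e * V := by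
            rw [mul_pow, mul_pow, mul_pow, hs1, hs2]
            field_simp
        _ ≤ _ := by gcongr
  rw [totalCost_eq_sum_cellCost_add]
  calc ∑ j : Fin k, (cellCost G.point U.cellIndex j + (optCell U.cellIndex j).card *
        ‖famMean G.point (optCell U.cellIndex j) - f j‖ ^ 2)
      ≤ ∑ j : Fin k, (cellCost G.point U.cellIndex j +
        (2 * e ^ 2 * cellCost G.point U.cellIndex j + 2 * (1 + e) ^ 2 * k ^ 2 * e * V)) :=
        Finset.sum_le_sum fun j _ => by linarith [hterm j]
    _ = V + (2 * e ^ 2 * V + k * (2 * (1 + e) ^ 2 * k ^ 2 * e * V)) := by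
        rw [Finset.sum_add_distrib, Finset.sum_add_distrib, ← Finset.mul_sum, ← hV,
          Finset.sum_const, Finset.card_univ, Fintype.card_fin, nsmul_eq_mul]
    _ = (1 + (2 * e ^ 2 + 2 * (1 + e) ^ 2 * (k ^ 3 * e))) * V := by ring
    _ ≤ (1 + ε) * V := by
        gcongr
        have h3 : (1 + e) ^ 2 ≤ 2 := by nlinarith
        have h4 : (k : ℝ) ^ 3 * e ≤ ε / 100 := by linarith
        have h5 : 0 ≤ (k : ℝ) ^ 3 * e := by positivity
        have h6 : e ≤ ε / 100 := by nlinarith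
        have h7 : (1 + e) ^ 2 * ((k : ℝ) ^ 3 * e) ≤ 2 * (ε / 100) := by gcongr
        nlinarith

/-- One of the values tried for `δ` is a good approximation of the root `D` of the mean optimal
cost, if `Δ` is one up to a factor of `16`. -/
theorem exists_guess {e D Δ : ℝ} (hk : 2 ≤ k) (he : 0 < e) (hD : 0 ≤ D) (h1 : D ^ 2 ≤ Δ)
    (h2 : Δ ≤ 16 * D ^ 2) : ∃ i < ⌈2 * (k : ℝ) / e⌉₊,
      D ≤ √Δ / (2 * k) + ((i : ℝ) + 1) * (e / (2 * k)) * √Δ ∧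
      √Δ / (2 * k) + ((i : ℝ) + 1) * (e / (2 * k)) * √Δ ≤ (1 + e) * D := by
  have hk2 : (2 : ℝ) ≤ k := by exact_mod_cast hk
  have hk0 : (0 : ℝ) < k := by linarith
  have hs1 : D ≤ √Δ := Real.le_sqrt_of_sq_le h1
  have hs2 : √Δ ≤ 4 * D := by
    refine Real.sqrt_le_iff.2 ⟨by positivity, by linarith [h2, mul_pow 4 D 2]⟩
  rcases hD.eq_or_lt with h0 | h0
  · have hΔ : √Δ = 0 := by linarith [Real.sqrt_nonneg Δ]
    exact ⟨0, Nat.ceil_pos.2 (by positivity), by simp [hΔ, ← h0], by simp [hΔ, ← h0]⟩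
  · set s := √Δ with hs
    have hs0 : 0 < s := h0.trans_le hs1
    -- in units of `√Δ / (2 k)`, the values tried are `1 + (i + 1) e`, and `y` is the value wanted
    set y := 2 * k * D / s with hy
    have hyD : D = y * (s / (2 * k)) := by rw [hy]; field_simp
    have hy1 : 1 ≤ y := by
      rw [hy, le_div_iff₀ hs0]
      nlinarith
    have hy2 : y ≤ 2 * k := by
      rw [hy, div_le_iff₀ hs0]
      gcongr
    have hfl : (⌊(y - 1) / e⌋₊ : ℝ) * e ≤ y - 1 := by
      rw [← le_div_iff₀ he]
      exact Nat.floor_le (div_nonneg (by linarith) he.le)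
    have hfl2 : y - 1 ≤ ((⌊(y - 1) / e⌋₊ : ℝ) + 1) * e := by
      rw [← div_le_iff₀ he]
      exact (Nat.lt_floor_add_one _).le
    have hform : s / (2 * k) + ((⌊(y - 1) / e⌋₊ : ℝ) + 1) * (e / (2 * k)) * s =
        (1 + ((⌊(y - 1) / e⌋₊ : ℝ) + 1) * e) * (s / (2 * k)) := by ring
    refine ⟨⌊(y - 1) / e⌋₊, ?_, ?_, ?_⟩
    · have h3 : (⌊(y - 1) / e⌋₊ : ℝ) < ⌈2 * (k : ℝ) / e⌉₊ := by
        refine lt_of_lt_of_le ?_ (Nat.le_ceil _)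
        rw [lt_div_iff₀ he]
        linarith
      exact_mod_cast h3
    · rw [hform]
      nth_rewrite 1 [hyD]
      gcongr
      linarith
    · rw [hform]
      calc _ ≤ (1 + e) * y * (s / (2 * k)) := by
            gcongr
            nlinarith
        _ = (1 + e) * D := by rw [mul_assoc, ← hyD]

/-- By Bernoulli's inequality each factor is at least `3 / 4`. -/
theorem half_le_pow_mul_pow (hk : 2 ≤ k) :
    ENNReal.ofReal (1 / 2) ≤ (1 - ENNReal.ofReal (1 / (4 * k))) ^ k *
      (1 - ENNReal.ofReal (1 / (4 * k))) ^ k := by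
  have hk2 : (2 : ℝ) ≤ k := by exact_mod_cast hk
  have h1 : (1 : ℝ) / (4 * k) ≤ 1 / 8 := by
    refine one_div_le_one_div_of_le (by norm_num) (by linarith)
  have h0 : (0 : ℝ) ≤ 1 / (4 * k) := by positivity
  have h2 : (3 / 4 : ℝ) ≤ (1 - 1 / (4 * k)) ^ k := by
    have := one_add_mul_le_pow (a := -(1 / (4 * (k : ℝ)))) (by linarith) k
    have h3 : 1 + (k : ℝ) * -(1 / (4 * k)) = 3 / 4 := by field_simp; norm_num
    rw [h3] at this
    simpa [sub_eq_add_neg] using this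
  rw [← ENNReal.ofReal_one, ← ENNReal.ofReal_sub _ h0, ← ENNReal.ofReal_pow (by linarith),
    ← ENNReal.ofReal_mul (by positivity)]
  refine ENNReal.ofReal_le_ofReal ?_
  nlinarith

/-- The algorithm succeeds if the initial bound is good and if one of the trees contains a good
path; both happen with probability at least `(1 - 1 / (4 k)) ^ k`. -/
theorem le_prob_kCMeans (G : ChromaticInstance n k d) {e ε : ℝ} (hk : 2 ≤ k)
    (hG : ∃ i, 0 < G.size i) (he : 0 < e) (heε : 100 * k ^ 3 * e ≤ ε) (hε : ε ≤ 1) :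
    ENNReal.ofReal (1 / 2) ≤ (kCMeans G e).prob (fun out => ∃ s, out = some s ∧ s.IsApprox ε) := by
  classical
  have hk2 : (2 : ℝ) ≤ k := by exact_mod_cast hk
  have hk3 : 4 * (k : ℝ) ≤ (k : ℝ) ^ 3 := by
    have h1 : (4 : ℝ) ≤ (k : ℝ) ^ 2 := by nlinarith
    nlinarith
  have he16 : e ≤ 1 / 16 := by nlinarith
  have hek : e * k ≤ 1 / 4 := by nlinarith
  have hε0 : 0 ≤ ε := le_trans (by positivity) heε
  obtain ⟨i₀, hi₀⟩ := hG
  have hcard : 0 < G.points.length := by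
    rw [G.length_points]
    exact Fintype.card_pos_iff.2 ⟨⟨i₀, ⟨0, hi₀⟩⟩⟩
  obtain ⟨m, U, hmin, hcost, hanti⟩ := exists_sorted_optimum G
  set V := totalCost G m U with hV
  have hV0 : 0 ≤ V := by
    rw [hcost]
    exact Finset.sum_nonneg fun j _ => cellCost_nonneg _
  have hsum : ∑ l ∈ Finset.range k, cellCost G.point U.cellIndex l ≤ V := by
    rw [hcost, Finset.sum_range]
  have hfirst : (optCell U.cellIndex 0).Nonempty := by
    have h1 : (optCell U.cellIndex (U i₀ ⟨0, hi₀⟩)).Nonempty :=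
      ⟨⟨i₀, ⟨0, hi₀⟩⟩, mem_optCell.2 rfl⟩
    exact Finset.card_pos.1 (h1.card_pos.trans_le (hanti _ _ (Nat.zero_le _)))
  refine (half_le_pow_mul_pow hk).trans ?_
  rw [kCMeans]
  refine le_prob_bind (le_prob_initialBound G hk he (by linarith)
    (List.length_pos_iff.1 hcard) m U hmin) ?_
  rintro b ⟨Δ, rfl, hΔ1, hΔ2⟩
  have hD2 : √(V / G.points.length) ^ 2 = V / G.points.length := Real.sq_sqrt (by positivity)
  obtain ⟨i, hi, hδ1, hδ2⟩ := exists_guess (Δ := Δ) hk he (Real.sqrt_nonneg (V / G.points.length))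
    (by rw [hD2]; exact hΔ1) (by rw [hD2, ← mul_div_assoc]; exact hΔ2)
  have hpaths : (1 - ENNReal.ofReal (1 / (4 * k))) ^ k ≤ (flatMapList (fun i : ℝ => do
      let δ ← charge 10 (√Δ / (2 * k) + (i + 1) * (e / (2 * k)) * √Δ)
      let T ← spherePeelingTree G e δ
      charge ((T.paths k).length * (k + 1)) (T.paths k))
        ((List.range ⌈2 * (k : ℝ) / e⌉₊).map Nat.cast)).prob
      (fun ms => ∃ f ∈ ms, GoodPath G.point U.cellIndex V e (List.ofFn f)) := by
    refine le_prob_flatMapList (List.mem_map.2 ⟨i, List.mem_range.2 hi, rfl⟩) ?_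
    refine (bd_charge (P := fun δ => δ = √Δ / (2 * k) + ((i : ℝ) + 1) * (e / (2 * k)) * √Δ) rfl
      le_rfl).le_prob_bind fun δ hδ => ?_
    rw [← hδ] at hδ1 hδ2
    rw [← mul_one (_ ^ k)]
    refine le_prob_bind (le_prob_grow G (S := GoodPath G.point U.cellIndex V e)
      (fun path hlen hpath => le_prob_children G hk (fun i => (U i.1 i.2).2) hanti hfirst hsum he
        he16 hek hδ1 hδ2 hlen hpath) k [] (by simp) (fun l hl => absurd hl (by simp))) ?_
    rintro T ⟨f, hf, hfgood⟩
    exact le_prob_charge le_rfl ⟨f, hf, by simpa using hfgood⟩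
  rw [← mul_one ((1 - ENNReal.ofReal (1 / (4 * k))) ^ k)]
  -- the range of the loop in the algorithm is a list of reals, by an inserted coercion
  have hlist : (do let i ← List.range ⌈2 * (k : ℝ) / e⌉₊; pure (i : ℝ)) =
      (List.range ⌈2 * (k : ℝ) / e⌉₊).map Nat.cast :=
    List.flatMap_pure_eq_map _ _
  rw [← hlist] at hpaths
  refine le_prob_bind hpaths ?_
  rintro ms ⟨f, hf, hfgood⟩
  refine (bd_bestTuple G ms).le_prob_bind ?_
  rintro r ⟨hnone, hsome⟩
  rcases r with _ | ⟨s, v⟩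
  · rw [hnone rfl] at hf
    simp at hf
  · obtain ⟨hv, hle⟩ := hsome s v rfl
    refine le_prob_charge le_rfl ⟨s, rfl, fun s' => ?_⟩
    rw [s.objective_eq, s'.objective_eq, ← hv, mul_left_comm]
    gcongr
    calc v ≤ totalCost G f U := hle f hf U
      _ ≤ (1 + ε) * V := totalCost_le_of_goodPath G U hk hcost he heε hε hfgood
      _ ≤ _ := by
        gcongr
        exact hmin _ _

/-! ### The running time -/

theorem assignTime_le {W : ℕ} (hW : 16 ≤ W) (hkW : k ≤ W) (hn : 1 ≤ n) (hd : 1 ≤ d) :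
    assignTime (k * n) k d ≤ W ^ 3 * (n * d) := by
  calc assignTime (k * n) k d = (k * n) * (k * (3 * d + 1) + 1) + k * n + 3 := rfl
    _ ≤ (W * n) * (W * (3 * d + 1) + 1) + W * n + 3 := by gcongr
    _ ≤ W ^ 3 * (n * d) := by
      -- in terms of `W - 16`, `n - 1` and `d - 1`, the difference has nonnegative coefficients
      obtain ⟨w, rfl⟩ := Nat.exists_eq_add_of_le hW
      obtain ⟨a, rfl⟩ := Nat.exists_eq_add_of_le hn
      obtain ⟨b, rfl⟩ := Nat.exists_eq_add_of_le hd
      zify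
      rw [← sub_nonneg]
      ring_nf
      positivity

theorem guessTime_le {W z T : ℕ} (hW : 16 ≤ W) (hkW : k + 2 ≤ W) (hz : z + 2 ≤ W)
    (hzW : 2 ^ z ≤ W) (hd : 1 ≤ d) : guessTime k d z T ≤ W ^ 3 * d + W * T := by
  calc guessTime k d z T = (2 * z + 2 + 2 ^ z * (z + 1) + 2 ^ z * ((z + 1) * d + 1)) +
        (2 ^ z * (k + T + 1) + 1) := rfl
    _ ≤ (2 * W + 2 + W * (W + 1) + W * ((W + 1) * d + 1)) + (W * (W + T + 1) + 1) := by
      gcongr <;> omega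
    _ ≤ W ^ 3 * d + W * T := by
      obtain ⟨w, rfl⟩ := Nat.exists_eq_add_of_le hW
      obtain ⟨b, rfl⟩ := Nat.exists_eq_add_of_le hd
      zify
      rw [← sub_nonneg]
      ring_nf
      positivity

theorem stageTime_le {W z T L : ℕ} (hW : 16 ≤ W) (hkW : k + 2 ≤ W) (hz : z + 2 ≤ W)
    (hzW : 2 ^ z ≤ W) (hn : 1 ≤ n) (hd : 1 ≤ d) (hL : Nat.clog 2 (k * n) + 1 ≤ L) :
    stageTime (k * n) k d z T ≤ 2 * W ^ 3 * (n * d) * L + W * T := by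
  have hL1 : 1 ≤ L := by omega
  calc stageTime (k * n) k d z T = guessTime k d z T + (k * n * (k * (3 * d + 1) + 1) + 1 +
        2 * (k * n) * (Nat.clog 2 (k * n) + 1) + (k * n + 1) + k * n + 1) := rfl
    _ ≤ (W ^ 3 * d + W * T) + (W * n * (W * (3 * d + 1) + 1) + 1 +
        2 * (W * n) * L + (W * n + 1) + W * n + 1) := by
      gcongr
      · exact guessTime_le hW hkW hz hzW hd
      all_goals omega
    _ ≤ 2 * W ^ 3 * (n * d) * L + W * T := by
      obtain ⟨w, rfl⟩ := Nat.exists_eq_add_of_le hW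
      obtain ⟨a, rfl⟩ := Nat.exists_eq_add_of_le hn
      obtain ⟨b, rfl⟩ := Nat.exists_eq_add_of_le hd
      obtain ⟨l, rfl⟩ := Nat.exists_eq_add_of_le hL1
      zify
      rw [← sub_nonneg]
      ring_nf
      positivity

/-- The search for all `k` centers makes `O(n d (log n) ^ (k + 1))` steps: every level contributes
a factor of order `log n`, the depth of the halving, and sorting contributes another one. -/
theorem searchTime_le {W z L h : ℕ} (hW : 16 ≤ W) (hkW : k + 2 ≤ W) (hz : z + 2 ≤ W)
    (hzW : 2 ^ z ≤ W) (hn : 1 ≤ n) (hd : 1 ≤ d) (hL : Nat.clog 2 (k * n) + 1 ≤ L) (hh : h ≤ L) :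
    ∀ m, searchTime (k * n) k d z h m ≤ W ^ (2 * m + 3) * (n * d) * L ^ (m + 1)
  | 0 => by
    have h1 := assignTime_le (k := k) hW (by omega) hn hd
    refine h1.trans (Nat.le_mul_of_pos_right _ ?_)
    rw [zero_add, pow_one]
    omega
  | m + 1 => by
    have h1 := assignTime_le (k := k) hW (by omega) hn hd
    have hL1 : 1 ≤ L := by omega
    calc searchTime (k * n) k d z h (m + 1)
        = h * stageTime (k * n) k d z (searchTime (k * n) k d z h m) + assignTime (k * n) k d := rfl
      _ ≤ L * (2 * W ^ 3 * (n * d) * L + W * (W ^ (2 * m + 3) * (n * d) * L ^ (m + 1))) +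
          W ^ 3 * (n * d) := by
        refine add_le_add (Nat.mul_le_mul hh ((stageTime_le hW hkW hz hzW hn hd hL).trans ?_)) h1
        gcongr
        exact searchTime_le hW hkW hz hzW hn hd hL hh m
      _ = 2 * W ^ 3 * (n * d) * L ^ 2 + W ^ 3 * (n * d) * 1 +
          W ^ (2 * m + 4) * (n * d) * L ^ (m + 2) := by ring
      _ ≤ 2 * W ^ (2 * m + 4) * (n * d) * L ^ (m + 2) + W ^ (2 * m + 4) * (n * d) * L ^ (m + 2) +
          W ^ (2 * m + 4) * (n * d) * L ^ (m + 2) := by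
        gcongr
        any_goals omega
        exact Nat.one_le_pow _ _ hL1
      _ = 4 * W ^ (2 * m + 4) * (n * d) * L ^ (m + 2) := by ring
      _ ≤ W * W ^ (2 * m + 4) * (n * d) * L ^ (m + 2) := by gcongr; omega
      _ = W ^ (2 * (m + 1) + 3) * (n * d) * L ^ (m + 1 + 1) := by ring

theorem bipartiteTime_le {W : ℕ} (hW : 16 ≤ W) (hkW : k + 2 ≤ W) (hkk : k ^ k ≤ W)
    (hn : 1 ≤ n) (hd : 1 ≤ d) : bipartiteTime n k d + 1 ≤ W ^ 3 * (n * d) := by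
  calc bipartiteTime n k d + 1 = n * (k * (k * (3 * d + 1) + 2) + 1 +
        (k ^ k * (k + 1) + (k ^ k * (k + 2) + 1)) + 1) + 1 + (n + 1) + 1 := rfl
    _ ≤ n * (W * (W * (3 * d + 1) + 2) + 1 + (W * W + (W * W + 1)) + 1) + 1 + (n + 1) + 1 := by
      gcongr <;> omega
    _ ≤ W ^ 3 * (n * d) := by
      obtain ⟨w, rfl⟩ := Nat.exists_eq_add_of_le hW
      obtain ⟨a, rfl⟩ := Nat.exists_eq_add_of_le hn
      obtain ⟨b, rfl⟩ := Nat.exists_eq_add_of_le hd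
      zify
      rw [← sub_nonneg]
      ring_nf
      positivity

theorem childCount_le {e : ℝ} {W L K : ℕ} (hW : 16 ≤ W) (he : ⌈4 + 2 / e⌉₊ + 1 ≤ W)
    (hz : 2 ^ sampleSize k e ≤ W) (hK : K ≤ W) (hL : Nat.clog 2 (k * n) + 1 ≤ L) :
    childCount n k e K ≤ W ^ 4 * L := by
  calc childCount n k e K ≤ L * W * (W * W + W) := by rw [childCount]; gcongr
    _ = W * (W + 1) * W * L := by ring
    _ ≤ W * (W * W) * W * L := by
      gcongr
      nlinarith
    _ = W ^ 4 * L := by ring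

theorem childTime_le {e : ℝ} {W L K : ℕ} (hW : 16 ≤ W) (hkW : k + 2 ≤ W)
    (he : ⌈4 + 2 / e⌉₊ + 1 ≤ W) (hz : sampleSize k e + 2 ≤ W) (hzW : 2 ^ sampleSize k e ≤ W)
    (hK : K ≤ W) (hn : 1 ≤ n) (hd : 1 ≤ d) (hL : Nat.clog 2 (k * n) + 1 ≤ L) :
    childTime n (k * n) k d e K ≤ W ^ 6 * (n * d) * L := by
  have hL1 : 1 ≤ L := by omega
  have h1 : radiusTime (k * n) k d (sampleSize k e) K + (2 ^ sampleSize k e * K + K) + 1 ≤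
      W ^ 4 * (n * d) := by
    calc radiusTime (k * n) k d (sampleSize k e) K + (2 ^ sampleSize k e * K + K) + 1
        ≤ ((W * n) * (W * (3 * d + 2) + 1 + 1) + 1) +
          ((2 * W + 2 + W * (W + 1) + W * ((W + 1) * d + 1)) +
            ((W * (W + (W * (W * (2 * d + 2) + 1) + 1) + W + 1) + 1) +
              ((W * (W * (2 * d + 2) + 1) + 1) + (W * W + W)))) + (W * W + W) + 1 := by
          rw [radiusTime]
          gcongr <;> omega
      _ ≤ W ^ 4 * (n * d) := by
        obtain ⟨w, rfl⟩ := Nat.exists_eq_add_of_le hW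
        obtain ⟨a, rfl⟩ := Nat.exists_eq_add_of_le hn
        obtain ⟨b, rfl⟩ := Nat.exists_eq_add_of_le hd
        zify
        rw [← sub_nonneg]
        ring_nf
        positivity
  calc childTime n (k * n) k d e K ≤ 12 * (L * W) + (L * W * (W ^ 4 * (n * d)) + 1) := by
        rw [childTime]
        gcongr
    _ ≤ W ^ 6 * (n * d) * L := by
      obtain ⟨w, rfl⟩ := Nat.exists_eq_add_of_le hW
      obtain ⟨a, rfl⟩ := Nat.exists_eq_add_of_le hn
      obtain ⟨b, rfl⟩ := Nat.exists_eq_add_of_le hd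
      obtain ⟨l, rfl⟩ := Nat.exists_eq_add_of_le hL1
      zify
      rw [← sub_nonneg]
      ring_nf
      positivity

theorem growTime_le {e : ℝ} {W L K : ℕ} (hW : 16 ≤ W) (hkW : k + 2 ≤ W)
    (he : ⌈4 + 2 / e⌉₊ + 1 ≤ W) (hz : sampleSize k e + 2 ≤ W) (hzW : 2 ^ sampleSize k e ≤ W)
    (hK : K ≤ W) (hn : 1 ≤ n) (hd : 1 ≤ d) (hL : Nat.clog 2 (k * n) + 1 ≤ L) :
    ∀ h, growTime n (k * n) k d e K h ≤ W ^ (7 * h + 1) * (n * d) * L ^ h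
  | 0 => by
    calc growTime n (k * n) k d e K 0 = 1 := rfl
      _ ≤ _ := Nat.one_le_iff_ne_zero.2 (by positivity)
  | h + 1 => by
    have hL1 : 1 ≤ L := by omega
    have hnd : 1 ≤ n * d := Nat.one_le_iff_ne_zero.2 (by positivity)
    have hP : 1 ≤ L ^ h := Nat.one_le_pow _ _ hL1
    have hQ : 1 ≤ W ^ (7 * h) := Nat.one_le_pow _ _ (by omega)
    calc growTime n (k * n) k d e K (h + 1) = childTime n (k * n) k d e K +
          (childCount n k e K * (k + growTime n (k * n) k d e K h + 1) + 1) := rfl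
      _ ≤ W ^ 6 * (n * d) * L + (W ^ 4 * L * (W +
          W ^ (7 * h + 1) * (n * d) * L ^ h + 1) + 1) := by
        gcongr
        · exact childTime_le hW hkW he hz hzW hK hn hd hL
        · exact childCount_le hW he hzW hK hL
        · omega
        · exact growTime_le hW hkW he hz hzW hK hn hd hL h
      _ ≤ W ^ 8 * W ^ (7 * h) * (n * d) * L ^ h * L := by
        rw [pow_succ W (7 * h)]
        generalize W ^ (7 * h) = Q at hQ
        generalize L ^ h = P at hP
        generalize n * d = A at hnd
        obtain ⟨w, rfl⟩ := Nat.exists_eq_add_of_le hW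
        obtain ⟨q, rfl⟩ := Nat.exists_eq_add_of_le hQ
        obtain ⟨p, rfl⟩ := Nat.exists_eq_add_of_le hP
        obtain ⟨a, rfl⟩ := Nat.exists_eq_add_of_le hnd
        obtain ⟨l, rfl⟩ := Nat.exists_eq_add_of_le hL1
        zify
        rw [← sub_nonneg]
        ring_nf
        positivity
      _ = W ^ (7 * (h + 1) + 1) * (n * d) * L ^ (h + 1) := by ring

/-- A bound for the number of steps of the algorithm that separates the dependence on `n` and `d`
from that on `k` and the accuracy: `W` bounds everything that depends only on the latter. -/
theorem bd_kCMeans (G : ChromaticInstance n k d) {e : ℝ} {W L K : ℕ} (hW : 16 ≤ W)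
    (hkW : k + 2 ≤ W) (hkk : k ^ k ≤ W) (hn : 1 ≤ n) (hd : 1 ≤ d)
    (hz₁ : ⌈64 * (k : ℝ) ^ 2 / (e / (64 * k)) ^ 2⌉₊ + 2 ≤ W)
    (hzW₁ : 2 ^ ⌈64 * (k : ℝ) ^ 2 / (e / (64 * k)) ^ 2⌉₊ ≤ W)
    (he : ⌈4 + 2 / e⌉₊ + 1 ≤ W) (hR : ⌈2 * (k : ℝ) / e⌉₊ ≤ W)
    (hz : sampleSize k e + 2 ≤ W) (hzW : 2 ^ sampleSize k e ≤ W) (hK : K ≤ W)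
    (hKV : ∀ V : List (Pt d), V.length ≤ k → (simplexPoints (e ^ 2 / 4) V).length ≤ K)
    (hL : Nat.clog 2 (k * n) + 1 = L) :
    Bd (kCMeans G e) (fun _ => True) (W ^ (7 * k + 8) * (n * d) * L ^ (k + 1)) := by
  have hL1 : 1 ≤ L := by omega
  have hnd : 1 ≤ n * d := Nat.one_le_iff_ne_zero.2 (by positivity)
  have hP : 1 ≤ L ^ k := Nat.one_le_pow _ _ hL1
  have hQ : 1 ≤ W ^ (7 * k) := Nat.one_le_pow _ _ (by omega)
  have hpath : childCount n k e K ^ k ≤ W ^ (7 * k) * L ^ k := by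
    calc childCount n k e K ^ k ≤ (W ^ 4 * L) ^ k := by
          gcongr
          exact childCount_le hW he hzW hK hL.le
      _ = W ^ (4 * k) * L ^ k := by rw [mul_pow, ← pow_mul]
      _ ≤ W ^ (7 * k) * L ^ k := by
        gcongr <;> omega
  have hbip := bipartiteTime_le (n := n) (d := d) hW hkW hkk hn hd
  have hsearch : searchTime (k * n) k d ⌈64 * (k : ℝ) ^ 2 / (e / (64 * k)) ^ 2⌉₊
      (Nat.clog 2 (k * n) + 1) k ≤ W ^ 3 * W ^ (7 * k) * (n * d) * L ^ k * L := by
    calc _ ≤ W ^ (2 * k + 3) * (n * d) * L ^ (k + 1) :=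
          searchTime_le hW hkW hz₁ hzW₁ hn hd hL.le hL.le k
      _ ≤ W ^ (7 * k + 3) * (n * d) * L ^ (k + 1) := by
        gcongr <;> omega
      _ = _ := by ring
  have hgrow : growTime n (k * n) k d e K k ≤ W * W ^ (7 * k) * (n * d) * L ^ k * L := by
    calc _ ≤ W ^ (7 * k + 1) * (n * d) * L ^ k * 1 := by
          rw [mul_one]
          exact growTime_le hW hkW he hz hzW hK hn hd hL.le k
      _ ≤ W ^ (7 * k + 1) * (n * d) * L ^ k * L := by gcongr
      _ = _ := by ring
  have hinit := bd_initialBound G e G.length_points_le (h := Nat.clog 2 (k * n))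
    ((Nat.le_pow_clog (by norm_num) _).trans_lt (Nat.pow_lt_pow_right (by norm_num) (by omega)))
  have hinit2 : (k * (searchTime (k * n) k d ⌈64 * (k : ℝ) ^ 2 / (e / (64 * k)) ^ 2⌉₊
      (Nat.clog 2 (k * n) + 1) k + 1) + 1) +
        (k ^ k * (k + 1) + (k ^ k * (bipartiteTime n k d + 1) + 1 + 1)) ≤
      W ^ 6 * W ^ (7 * k) * (n * d) * L ^ k * L := by
    calc _ ≤ (W * (W ^ 3 * W ^ (7 * k) * (n * d) * L ^ k * L + 1) + 1) +
        (W * W + (W * (W ^ 3 * (n * d)) + 1 + 1)) := by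
          gcongr <;> omega
      _ ≤ _ := by
        generalize W ^ (7 * k) = Q at hQ
        generalize L ^ k = P at hP
        generalize n * d = A at hnd
        obtain ⟨w, rfl⟩ := Nat.exists_eq_add_of_le hW
        obtain ⟨q, rfl⟩ := Nat.exists_eq_add_of_le hQ
        obtain ⟨p, rfl⟩ := Nat.exists_eq_add_of_le hP
        obtain ⟨a, rfl⟩ := Nat.exists_eq_add_of_le hnd
        obtain ⟨l, rfl⟩ := Nat.exists_eq_add_of_le hL1
        zify
        rw [← sub_nonneg]
        ring_nf
        positivity
  set R := ⌈2 * (k : ℝ) / e⌉₊ with hRdef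
  have htotal : W ^ 6 * W ^ (7 * k) * (n * d) * L ^ k * L +
      ((R * ((10 + (growTime n (k * n) k d e K k + childCount n k e K ^ k * (k + 1))) +
        childCount n k e K ^ k + 1) + 1) +
        (R * childCount n k e K ^ k * (bipartiteTime n k d + 1) + 1)) ≤
      W ^ (7 * k + 8) * (n * d) * L ^ (k + 1) := by
    calc _ ≤ W ^ 6 * W ^ (7 * k) * (n * d) * L ^ k * L +
          ((W * ((10 + (W * W ^ (7 * k) * (n * d) * L ^ k * L + W ^ (7 * k) * L ^ k * W)) +
          W ^ (7 * k) * L ^ k + 1) + 1) +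
          (W * (W ^ (7 * k) * L ^ k) * (W ^ 3 * (n * d)) + 1)) := by
          gcongr
          omega
      _ ≤ W ^ 8 * W ^ (7 * k) * (n * d) * L ^ k * L := by
        generalize W ^ (7 * k) = Q at hQ
        generalize L ^ k = P at hP
        generalize n * d = A at hnd
        obtain ⟨w, rfl⟩ := Nat.exists_eq_add_of_le hW
        obtain ⟨q, rfl⟩ := Nat.exists_eq_add_of_le hQ
        obtain ⟨p, rfl⟩ := Nat.exists_eq_add_of_le hP
        obtain ⟨a, rfl⟩ := Nat.exists_eq_add_of_le hnd
        obtain ⟨l, rfl⟩ := Nat.exists_eq_add_of_le hL1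
        zify
        rw [← sub_nonneg]
        ring_nf
        positivity
      _ = _ := by ring
  rw [kCMeans]
  refine hinit.bind (T := (R * ((10 + (growTime n (k * n) k d e K k +
    childCount n k e K ^ k * (k + 1))) + childCount n k e K ^ k + 1) + 1) +
        (R * childCount n k e K ^ k * (bipartiteTime n k d + 1) + 1)) (fun b _ => ?_)
    ((Nat.add_le_add_right hinit2 _).trans htotal)
  rcases b with _ | Δ
  · exact bd_pure trivial
  have hlist : (do let i ← List.range ⌈2 * (k : ℝ) / e⌉₊; pure (i : ℝ)) =
      (List.range ⌈2 * (k : ℝ) / e⌉₊).map Nat.cast :=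
    List.flatMap_pure_eq_map _ _
  have hlen : ((List.range ⌈2 * (k : ℝ) / e⌉₊).map (Nat.cast : ℕ → ℝ)).length = R := by
    rw [List.length_map, List.length_range]
  refine (bd_flatMapList (R := fun _ _ => True) (M := childCount n k e K ^ k)
    (T := 10 + (growTime n (k * n) k d e K k + childCount n k e K ^ k * (k + 1)))
    fun i _ => ?_).bind (T := R * childCount n k e K ^ k * (bipartiteTime n k d + 1) + 1)
    (fun ms hms => ?_) ?_
  · refine (bd_charge (P := fun _ => True) trivial le_rfl).bind (fun δ _ => ?_) le_rfl
    refine (bd_grow G e δ G.length_points_le hKV k [] (by simp)).bind (fun T hT => ?_) le_rfl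
    exact bd_charge ⟨trivial, hT⟩ (by gcongr)
  · refine ((bd_bestTuple G ms).bind (T := 0) (fun r _ => bd_pure trivial) le_rfl).le ?_
    have h1 := hms.1
    rw [hlist, hlen] at h1
    rw [add_zero]
    gcongr
  · rw [hlist, hlen]

/-- A bound, polynomial in `x = k / ε`, for the sizes of all samples and grids, for `k`, and for
the numbers of radius candidates and of values tried for `δ`. The degree is that of the bound
`8 k ^ 5 / e ^ 15` for the size of the samples, where `1 / e = 100 k ^ 3 / ε ≤ 100 x ^ 4`. -/
def sizeBound (x : ℝ) : ℕ := ⌈10 ^ 31 * x ^ 65⌉₊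

theorem sizeBound_bounds {ε e : ℝ} (hk : 2 ≤ k) (hε : 0 < ε) (hε1 : ε ≤ 1)
    (he : e = 1 / 100 * ε / (k : ℝ) ^ 3) :
    k ≤ sizeBound (k / ε) ∧ ⌈64 * (k : ℝ) ^ 2 / (e / (64 * k)) ^ 2⌉₊ ≤ sizeBound (k / ε) ∧
      ⌈4 + 2 / e⌉₊ ≤ sizeBound (k / ε) ∧ ⌈2 * (k : ℝ) / e⌉₊ ≤ sizeBound (k / ε) ∧
      sampleSize k e ≤ sizeBound (k / ε) ∧
      ∀ v : ℕ, v ≤ k → ⌊2 * (v : ℝ) ^ 2 / (e ^ 2 / 4)⌋₊ + 1 ≤ sizeBound (k / ε) := by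
  have hk2 : (2 : ℝ) ≤ k := by exact_mod_cast hk
  have hk0 : (0 : ℝ) < k := by linarith
  set x : ℝ := k / ε with hx
  have hkx : (k : ℝ) ≤ x := by
    rw [hx, le_div_iff₀ hε]
    nlinarith
  have hx2 : 2 ≤ x := hk2.trans hkx
  have hx0 : 0 < x := by linarith
  have hx1 : 1 ≤ x := by linarith
  have he0 : 0 < e := by rw [he]; positivity
  have hinv : 1 / e ≤ 100 * x ^ 4 := by
    have h1 : 1 / e = 100 * (k : ℝ) ^ 2 * x := by
      rw [he, hx]
      field_simp
    rw [h1]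
    calc 100 * (k : ℝ) ^ 2 * x ≤ 100 * x ^ 2 * x := by gcongr
      _ = 100 * x ^ 3 := by ring
      _ ≤ 100 * x ^ 4 := by gcongr; norm_num
  have hinv0 : 0 ≤ 1 / e := by positivity
  have hpow : ∀ (a : ℝ) (i : ℕ), 0 ≤ a → a ≤ 10 ^ 31 → i ≤ 65 → a * x ^ i ≤ 10 ^ 31 * x ^ 65 :=
    fun a i ha0 ha hi => by gcongr
  have hone : ∀ i : ℕ, 1 ≤ x ^ i := fun i => one_le_pow₀ hx1
  refine ⟨?_, ?_, ?_, ?_, ?_, ?_⟩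
  · have h1 : (k : ℝ) ≤ sizeBound x := by
      calc (k : ℝ) ≤ 1 * x ^ 1 := by rw [one_mul, pow_one]; exact hkx
        _ ≤ 10 ^ 31 * x ^ 65 := hpow 1 1 (by norm_num) (by norm_num) (by norm_num)
        _ ≤ _ := Nat.le_ceil _
    exact_mod_cast h1
  · refine Nat.ceil_le_ceil ?_
    calc 64 * (k : ℝ) ^ 2 / (e / (64 * k)) ^ 2 = 262144 * (k : ℝ) ^ 4 * (1 / e) ^ 2 := by
          field_simp
          norm_num
      _ ≤ 262144 * x ^ 4 * (100 * x ^ 4) ^ 2 := by gcongr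
      _ = 2621440000 * x ^ 12 := by ring
      _ ≤ _ := hpow _ _ (by norm_num) (by norm_num) (by norm_num)
  · refine Nat.ceil_le_ceil ?_
    calc 4 + 2 / e = 4 * 1 + 2 * (1 / e) := by ring
      _ ≤ 4 * x ^ 4 + 2 * (100 * x ^ 4) := by
        gcongr
        exact hone 4
      _ = 204 * x ^ 4 := by ring
      _ ≤ _ := hpow _ _ (by norm_num) (by norm_num) (by norm_num)
  · refine Nat.ceil_le_ceil ?_
    calc 2 * (k : ℝ) / e = 2 * k * (1 / e) := by ring
      _ ≤ 2 * x * (100 * x ^ 4) := by gcongr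
      _ = 200 * x ^ 5 := by ring
      _ ≤ _ := hpow _ _ (by norm_num) (by norm_num) (by norm_num)
  · refine Nat.ceil_le_ceil ?_
    calc 8 * (k : ℝ) ^ 3 / e ^ 9 * Real.log ((k : ℝ) ^ 2 / e ^ 6)
        ≤ 8 * (k : ℝ) ^ 3 / e ^ 9 * ((k : ℝ) ^ 2 / e ^ 6) := by
          gcongr
          exact Real.log_le_self (by positivity)
      _ = 8 * (k : ℝ) ^ 5 * (1 / e) ^ 15 := by
        field_simp
      _ ≤ 8 * x ^ 5 * (100 * x ^ 4) ^ 15 := by gcongr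
      _ = 8 * 10 ^ 30 * x ^ 65 := by ring
      _ ≤ _ := hpow _ _ (by norm_num) (by norm_num) (by norm_num)
  · intro v hv
    have hvk : (v : ℝ) ≤ k := by exact_mod_cast hv
    have h1 : ((⌊2 * (v : ℝ) ^ 2 / (e ^ 2 / 4)⌋₊ + 1 : ℕ) : ℝ) ≤ sizeBound x := by
      push_cast
      calc (⌊2 * (v : ℝ) ^ 2 / (e ^ 2 / 4)⌋₊ : ℝ) + 1 ≤ 2 * (v : ℝ) ^ 2 / (e ^ 2 / 4) + 1 := by
            gcongr
            exact Nat.floor_le (by positivity)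
        _ = 8 * (v : ℝ) ^ 2 * (1 / e) ^ 2 + 1 := by
          field_simp
          ring
        _ ≤ 8 * x ^ 2 * (100 * x ^ 4) ^ 2 + x ^ 10 := by
          gcongr
          · exact hvk.trans hkx
          · exact hone 10
        _ = 80001 * x ^ 10 := by ring
        _ ≤ _ := hpow _ _ (by norm_num) (by norm_num) (by norm_num)
        _ ≤ _ := Nat.le_ceil _
    exact_mod_cast h1

theorem length_simplexPoints_le {M : ℕ} {ε : ℝ} (hkM : k ≤ M)
    (h : ∀ v : ℕ, v ≤ k → ⌊2 * (v : ℝ) ^ 2 / ε⌋₊ + 1 ≤ M) (V : List (Pt d))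
    (hV : V.length ≤ k) : (simplexPoints ε V).length ≤ 2 ^ M ^ 2 := by
  rw [simplexPoints, List.length_map]
  calc _ ≤ (M + 1) ^ V.length := length_antidiagonalTuple_le _ _ (h _ hV)
    _ ≤ (M + 1) ^ M := by gcongr <;> omega
    _ ≤ (2 ^ M) ^ M := by
      gcongr
      exact Nat.lt_two_pow_self
    _ = 2 ^ M ^ 2 := by rw [← pow_mul, sq]

theorem clog_add_one_le_log (hn : 2 ≤ n) (hk : 2 ≤ k) :
    ((Nat.clog 2 (k * n) + 1 : ℕ) : ℝ) ≤ 8 * k * Real.log n := by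
  have hk2 : (2 : ℝ) ≤ k := by exact_mod_cast hk
  have hn2 : (2 : ℝ) ≤ n := by exact_mod_cast hn
  have hkn : 1 < k * n := by nlinarith
  have h1 : (2 : ℝ) ^ (Nat.clog 2 (k * n) - 1) ≤ k * n := by
    exact_mod_cast (Nat.pow_pred_clog_lt_self (by norm_num) hkn).le
  have h2 := Real.log_le_log (by positivity) h1
  rw [Real.log_pow, Real.log_mul (by positivity) (by positivity)] at h2
  have hc : 0 < Nat.clog 2 (k * n) := Nat.clog_pos (by norm_num) hkn
  rw [Nat.cast_sub hc, Nat.cast_one] at h2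
  have h3 : Real.log k ≤ k - 1 := Real.log_le_sub_one_of_pos (by positivity)
  have h4 : Real.log 2 ≤ Real.log n := Real.log_le_log (by norm_num) hn2
  have h5 := Real.log_two_gt_d9
  have h6 := Real.log_two_lt_d9
  push_cast
  set c : ℝ := (Nat.clog 2 (k * n) : ℝ)
  set l := Real.log n
  have h7 : (c + 1) * Real.log 2 ≤ 8 * k * l * Real.log 2 := by
    have h8 : (c + 1) * Real.log 2 ≤ k - 1 + l + 2 * Real.log 2 := by linarith
    have h9 : (1.38 : ℝ) ≤ k * l := by nlinarith
    have h10 : l ≤ k * l := by nlinarith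
    have h11 : 0.69 * (k : ℝ) ≤ k * l := by nlinarith
    have h12 : 5.5 * (k * l) ≤ 8 * k * l * Real.log 2 := by nlinarith
    linarith
  exact le_of_mul_le_mul_right h7 (by linarith)

/-- The running time with an explicit exponent in place of the polynomial in `k / ε`; the factors
`k` lost in comparing `log₂ (k n)` with `log n` are absorbed in the power of two. -/
theorem timeLE_kCMeans (G : ChromaticInstance n k d) {ε : ℝ} (hn : 2 ≤ n) (hk : 2 ≤ k)
    (hd : 1 ≤ d) (hε : 0 < ε) (hε1 : ε ≤ 1) :
    (kCMeans G (1 / 100 * ε / (k : ℝ) ^ 3)).TimeLE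
      (2 ^ (sizeBound (k / ε) ^ 2 * (8 * sizeBound (k / ε) + 9)) * n * Real.log n ^ (k + 1) *
        d) := by
  set e := 1 / 100 * ε / (k : ℝ) ^ 3 with he
  obtain ⟨hkM, hz₁, hr, hR, hz, hg⟩ := sizeBound_bounds hk hε hε1 he
  set M := sizeBound (k / ε) with hM
  have hM4 : 4 ≤ M := by
    refine le_trans ?_ hr
    have h1 : (4 : ℝ) ≤ ⌈4 + 2 / e⌉₊ :=
      le_trans (le_add_of_nonneg_right (by positivity)) (Nat.le_ceil _)
    exact_mod_cast h1
  set W := 2 ^ M ^ 2 with hW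
  have hMW : M + 3 ≤ 2 ^ M := by
    have h1 : M - 1 < 2 ^ (M - 1) := Nat.lt_two_pow_self
    have h2 : 2 ^ M = 2 * 2 ^ (M - 1) := by rw [← pow_succ']; congr 1; omega
    omega
  have hMM : 2 ^ M ≤ W := by
    rw [hW]
    gcongr
    · norm_num
    · nlinarith
  have h8W : 8 * M ≤ W := by
    calc 8 * M ≤ 2 ^ 3 * 2 ^ M := by
          gcongr
          · norm_num
          · omega
      _ = 2 ^ (M + 3) := by ring
      _ ≤ W := by
        rw [hW]
        gcongr
        · norm_num
        · nlinarith
  have hW16 : 16 ≤ W := by omega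
  have hkk : k ^ k ≤ W := by
    calc k ^ k ≤ M ^ M := by gcongr; omega
      _ ≤ (2 ^ M) ^ M := by gcongr; omega
      _ = W := by rw [← pow_mul, hW, sq]
  have hpow : ∀ {z : ℕ}, z ≤ M → 2 ^ z ≤ W := fun {z} hz =>
    (Nat.pow_le_pow_right (by norm_num) hz).trans hMM
  have hbd := bd_kCMeans G hW16 (by omega) hkk (by omega) hd (by omega) (hpow hz₁)
    (by omega) (by omega) (by omega) (hpow hz) le_rfl
    (length_simplexPoints_le hkM hg) rfl
  intro a ha
  have hle := (hbd a ha).2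
  have hlog : 0 ≤ Real.log n := Real.log_natCast_nonneg n
  have hlr : (a.2 : ℝ) ≤ (W : ℝ) ^ (7 * k + 8) * (n * d) *
      ((Nat.clog 2 (k * n) + 1 : ℕ) : ℝ) ^ (k + 1) := by exact_mod_cast hle
  have h8 : 8 * (k : ℝ) ≤ W := by exact_mod_cast (by omega : 8 * k ≤ W)
  have hW1 : (1 : ℝ) ≤ W := by exact_mod_cast (by omega : 1 ≤ W)
  calc (a.2 : ℝ) ≤ (W : ℝ) ^ (7 * k + 8) * (n * d) *
        ((Nat.clog 2 (k * n) + 1 : ℕ) : ℝ) ^ (k + 1) := hlr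
    _ ≤ (W : ℝ) ^ (7 * k + 8) * (n * d) * (W * Real.log n) ^ (k + 1) := by
      gcongr
      exact (clog_add_one_le_log hn hk).trans (by gcongr)
    _ = (W : ℝ) ^ (8 * k + 9) * n * Real.log n ^ (k + 1) * d := by
      rw [mul_pow]
      ring
    _ ≤ (W : ℝ) ^ (8 * M + 9) * n * Real.log n ^ (k + 1) * d := by
      gcongr
    _ = _ := by
      rw [hW]
      push_cast
      rw [← pow_mul]

end

end ChromaticClustering

theorem mainTheorem1 :
    ∃ (c p C : ℝ) (q : Polynomial ℝ), 0 < c ∧ c ≤ 1 ∧ 0 < p ∧ 0 < C ∧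
      ∀ (n k d : ℕ) (ε : ℝ) (G : ChromaticClustering.ChromaticInstance n k d),
        2 ≤ n → 2 ≤ k → 1 ≤ d → 0 < ε → ε ≤ 1 → (∃ i, 0 < G.size i) →
          ENNReal.ofReal p ≤ (ChromaticClustering.kCMeans G (c * ε / (k : ℝ) ^ 3)).prob
              (fun out => ∃ s, out = some s ∧ s.IsApprox ε) ∧
          (ChromaticClustering.kCMeans G (c * ε / (k : ℝ) ^ 3)).TimeLE
              (C * (2 : ℝ) ^ (q.eval ((k : ℝ) / ε)) * n * Real.log n ^ (k + 1) * d) := by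
  -- `10 ^ 31 X ^ 65 + 1` bounds `sizeBound`, and the exponent is that of `timeLE_kCMeans`
  refine ⟨1 / 100, 1 / 2, 1, (10 ^ 31 * Polynomial.X ^ 65 + 1) ^ 2 *
    (8 * (10 ^ 31 * Polynomial.X ^ 65 + 1) + 9), by norm_num, by norm_num, by norm_num,
    by norm_num, fun n k d ε G hn hk hd hε hε1 hG => ⟨?_, fun a ha => ?_⟩⟩
  · have hk0 : (0 : ℝ) < k := by exact_mod_cast (by omega : 0 < k)
    refine ChromaticClustering.le_prob_kCMeans G hk hG (by positivity) (le_of_eq ?_) hε1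
    field_simp
  · refine (ChromaticClustering.timeLE_kCMeans G hn hk hd hε hε1 a ha).trans ?_
    rw [one_mul]
    have hlog : 0 ≤ Real.log n := Real.log_natCast_nonneg n
    have hx : (0 : ℝ) ≤ k / ε := by positivity
    have hM : (ChromaticClustering.sizeBound (k / ε) : ℝ) ≤ 10 ^ 31 * (k / ε) ^ 65 + 1 :=
      (Nat.ceil_lt_add_one (by positivity)).le
    gcongr
    rw [← Real.rpow_natCast]
    refine Real.rpow_le_rpow_of_exponent_le (by norm_num) ?_
    simp only [Polynomial.eval_mul, Polynomial.eval_add, Polynomial.eval_pow, Polynomial.eval_X,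
      Polynomial.eval_ofNat, Polynomial.eval_one]
    push_cast
    gcongr
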